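/- **Setting.** Let $\mathcal X_1,\mathcal X_2,\mathcal Y_1,\mathcal Y_2,\mathcal Z$ be standard Borel spaces (finite, countable or continuous alphabets), $\mathcal Y_1,\mathcal Y_2$ non-empty. A memoryless two-way wiretap channel is a Markov kernel $P_{Y_1Y_2Z|X_1X_2}$: User $i$ has input $X_i$ and output $Y_i$ ($i=1,2$), and the eavesdropper observes $Z$. Let $g_i:\mathcal X_i\to\mathbb R$ be measurable cost functions and let $c_1,c_2\in\mathbb R$. Logarithms are natural. **Codes.** A non-adaptive code of length $n$ consists of finite non-empty message sets $\mathcal M_1,\mathcal M_2$; stochastic encoders $\phi_i$ which, given $m_i\in\mathcal M_i$, draw the whole block $X_i^n\in\mathcal X_i^n$; and measurable decoders $\psi_1:\mathcal X_1^n\times\mathcal Y_1^n\to\mathcal M_2$ and $\psi_2:\mathcal X_2^n\times\mathcal Y_2^n\to\mathcal M_1$. The messages $M_1,M_2$ are independent and uniform, and the channel is used $n$ times independently. The code satisfies the peak cost constraint $(c_1,c_2)$ if $\frac1n\sum_{j=1}^n g_i(X_{i,j})\le c_i$ almost surely for every message $m_i$, $i=1,2$. Its error probability is the probability that $\psi_1(X_1^n,Y_1^n)\ne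 M_2$ or $\psi_2(X_2^n,Y_2^n)\ne M_1$. Let $\mathcal C_J^{c_1,c_2}$ be the set of pairs $(R_1,R_2)$ for which there is a sequence of such codes of length $n=1,2,\dots$, all satisfying the peak cost constraint $(c_1,c_2)$, with $\frac1n\log|\mathcal M_i|\to R_i$ ($i=1,2$), error probability tending to $0$, and $I(M_1,M_2;Z^n)\to0$ (strong joint secrecy). Let $\mathcal C_I^{c_1,c_2}$ be defined in the same way with the last condition replaced by $I(M_1;Z^n)\to0$ and $I(M_2;Z^n)\to0$ (strong individual secrecy). **Regions.** Let $\mathcal Q^{c_1,c_2}$ be the set of all distributions $P=P_{V_1}P_{X_1|V_1}P_{V_2}P_{X_2|V_2}$, with $V_1,V_2$ in arbitrary standard Borel spaces, such that $\mathbb E[g_i(X_i)]$ exists and is at most $c_i$ for $i=1,2$. With $(Y_1,Y_2,Z)$ obtained from $(X_1,X_2)$ through the channel, let $\mathcal R_J(P)$ be the set of $(R_1,R_2)$ with $R_1,R_2\ge0$ and $$R_1\le I(Y_2;V_1|X_2)-I(Z;V_1),\qquad R_2\le I(Y_1;V_2|X_1)-I(Z;V_2),$$ $$R_1+R_2\le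 I(Y_2;V_1|X_2)+I(Y_1;V_2|X_1)-I(V_1,V_2;Z),$$ and let $\mathcal R_I(P)$ be the set defined in the same way with the last inequality replaced by $$\max\{R_1,R_2\}\le I(Y_2;V_1|X_2)+I(Y_1;V_2|X_1)-I(V_1,V_2;Z).$$ (A difference $\infty-\infty$ is read as $-\infty$.) For $a\in\{J,I\}$ let $\mathcal R_a^{c_1,c_2}$ be the closure of the convex hull of $\bigcup_{P\in\mathcal Q^{c_1,c_2}}\mathcal R_a(P)$. Let $\hat{\mathcal R}_a^{c_1,c_2}$ be the set of all pairs $\big(\sum_{j=1}^m Q(j)R_1^j,\ \sum_{j=1}^m Q(j)R_2^j\big)$, where $m\in\mathbb N$, $Q$ is a probability distribution on $\{1,\dots,m\}$, $c_i^1,\dots,c_i^m$ are real numbers with $\inf g_i\le c_i^j\le\sup g_i$ and $\sum_jQ(j)c_i^j\le c_i$ for $i=1,2$, and $(R_1^j,R_2^j)\in\mathcal R_a^{c_1^j,c_2^j}$ for every $j$. **Theorem 2.** For all $c_1,c_2\in\mathbb R$, $$\mathcal R_J^{c_1,c_2}\subset\mathcal C_J^{c_1,c_2},\qquad \mathcal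 R_I^{c_1,c_2}\subset\mathcal C_I^{c_1,c_2},$$ and, with time sharing, $$\hat{\mathcal R}_J^{c_1,c_2}\subset\mathcal C_J^{c_1,c_2},\qquad \hat{\mathcal R}_I^{c_1,c_2}\subset\mathcal C_I^{c_1,c_2}.$$ -/

import Mathlib

open MeasureTheory ProbabilityTheory Filter Topology
open scoped ENNReal

namespace TWWC

noncomputable section

/-! ### Information measures (natural logarithm, values in `[0, ∞]`) -/

section Information

variable {Ω A B C : Type*} [MeasurableSpace Ω] [MeasurableSpace A] [MeasurableSpace B]
  [MeasurableSpace C]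

/-- Mutual information `I(f; h)` of two random variables under `μ`:
the divergence of the joint law from the product of the marginal laws. -/
def mutualInfo (f : Ω → A) (h : Ω → B) (μ : Measure Ω) : ℝ≥0∞ :=
  InformationTheory.klDiv (μ.map (fun ω => (f ω, h ω))) ((μ.map f).prod (μ.map h))

/-- Conditional mutual information `I(f; h | k)` under `μ`: the divergence of the joint law
of `(k, f, h)` from the law `P_k × P_{f|k} × P_{h|k}`. -/
def condMutualInfo [StandardBorelSpace A] [Nonempty A] [StandardBorelSpace B] [Nonempty B]
    (f : Ω → A) (h : Ω → B) (k : Ω → C) (μ : Measure Ω) [IsFiniteMeasure μ] : ℝ≥0∞ :=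
  InformationTheory.klDiv (μ.map (fun ω => (k ω, f ω, h ω)))
    ((μ.map k) ⊗ₘ ((condDistrib f k μ) ×ₖ (condDistrib h k μ)))

end Information

/-! ### Memoryless extension of a channel -/

section Memoryless

variable {A B : Type*} [MeasurableSpace A] [MeasurableSpace B]

lemma measurable_pi_kernel (W : Kernel A B) [IsMarkovKernel W] (n : ℕ) :
    Measurable (fun x : Fin n → A => Measure.pi (fun k => W (x k))) := by
  refine Measurable.measure_of_isPiSystem_of_isProbabilityMeasure
    generateFrom_pi.symm isPiSystem_pi ?_
  rintro _ ⟨s, hs, rfl⟩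
  have h : (fun x : Fin n → A => Measure.pi (fun k => W (x k)) (Set.univ.pi s))
      = fun x => ∏ k, W (x k) (s k) := by
    funext x
    exact Measure.pi_pi _ _
  rw [h]
  refine Finset.measurable_prod _ fun k _ => ?_
  exact (W.measurable_coe (hs k (Set.mem_univ k))).comp (measurable_pi_apply k)

/-- `n` independent uses of the channel `W`. -/
def memoryless (W : Kernel A B) [IsMarkovKernel W] (n : ℕ) : Kernel (Fin n → A) (Fin n → B) where
  toFun x := Measure.pi (fun k => W (x k))
  measurable' := measurable_pi_kernel W n

instance (W : Kernel A B) [IsMarkovKernel W] (n : ℕ) : IsMarkovKernel (memoryless W n) :=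
  ⟨fun x => inferInstanceAs (IsProbabilityMeasure (Measure.pi (fun k => W (x k))))⟩

end Memoryless

/-! ### Non-adaptive codes -/

section Codes

variable (X₁ X₂ Y₁ Y₂ : Type*) [MeasurableSpace X₁] [MeasurableSpace X₂] [MeasurableSpace Y₁]
  [MeasurableSpace Y₂]

/-- A non-adaptive code of length `n` for the two-way channel: two message sets, two stochastic
encoders `φᵢ` producing the whole input block from the message alone, and two decoders; the
decoder of User `i` sees the input block and the output block of User `i`. -/
structure Code (n : ℕ) where
  M₁ : ℕ
  M₂ : ℕ
  M₁_pos : 0 < M₁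
  M₂_pos : 0 < M₂
  enc₁ : Kernel (Fin M₁) (Fin n → X₁)
  enc₂ : Kernel (Fin M₂) (Fin n → X₂)
  markov₁ : IsMarkovKernel enc₁
  markov₂ : IsMarkovKernel enc₂
  dec₁ : (Fin n → X₁) × (Fin n → Y₁) → Fin M₂
  dec₂ : (Fin n → X₂) × (Fin n → Y₂) → Fin M₁
  measurable_dec₁ : Measurable dec₁
  measurable_dec₂ : Measurable dec₂

attribute [instance] Code.markov₁ Code.markov₂

end Codes

section CodePerformance

variable {X₁ X₂ Y₁ Y₂ Z : Type*} [MeasurableSpace X₁] [MeasurableSpace X₂] [MeasurableSpace Y₁]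
  [MeasurableSpace Y₂] [MeasurableSpace Z] {n : ℕ}

/-- Sample space of one transmission: messages, input blocks, and output block. -/
abbrev Code.Sample (C : Code X₁ X₂ Y₁ Y₂ n) (Z : Type*) : Type _ :=
  ((Fin C.M₁ × Fin C.M₂) × ((Fin n → X₁) × (Fin n → X₂))) × (Fin n → Y₁ × Y₂ × Z)

/-- Joint law of `((M₁, M₂), (X₁ⁿ, X₂ⁿ), (Y₁, Y₂, Z)ⁿ)`, the messages being independent
and uniform. -/
def Code.law (C : Code X₁ X₂ Y₁ Y₂ n) (W : Kernel (X₁ × X₂) (Y₁ × Y₂ × Z)) [IsMarkovKernel W] :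
    Measure (C.Sample Z) :=
  (((uniformOn (Set.univ : Set (Fin C.M₁))).prod (uniformOn (Set.univ : Set (Fin C.M₂)))) ⊗ₘ
      (C.enc₁ ∥ₖ C.enc₂)) ⊗ₘ
    ((memoryless W n).comap
      (fun ω : (Fin C.M₁ × Fin C.M₂) × ((Fin n → X₁) × (Fin n → X₂)) =>
        fun k => (ω.2.1 k, ω.2.2 k))
      (by fun_prop))

/-- Average probability that at least one of the two users decodes wrongly. -/
def Code.errorProb (C : Code X₁ X₂ Y₁ Y₂ n) (W : Kernel (X₁ × X₂) (Y₁ × Y₂ × Z))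
    [IsMarkovKernel W] : ℝ≥0∞ :=
  C.law W {ω | C.dec₁ (ω.1.2.1, fun k => (ω.2 k).1) ≠ ω.1.1.2 ∨
    C.dec₂ (ω.1.2.2, fun k => (ω.2 k).2.1) ≠ ω.1.1.1}

/-- `I(M₁, M₂; Zⁿ)`. -/
def Code.leakage (C : Code X₁ X₂ Y₁ Y₂ n) (W : Kernel (X₁ × X₂) (Y₁ × Y₂ × Z))
    [IsMarkovKernel W] : ℝ≥0∞ :=
  mutualInfo (fun ω : C.Sample Z => ω.1.1) (fun ω => fun k => (ω.2 k).2.2) (C.law W)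

/-- `I(M₁; Zⁿ)`. -/
def Code.leakage₁ (C : Code X₁ X₂ Y₁ Y₂ n) (W : Kernel (X₁ × X₂) (Y₁ × Y₂ × Z))
    [IsMarkovKernel W] : ℝ≥0∞ :=
  mutualInfo (fun ω : C.Sample Z => ω.1.1.1) (fun ω => fun k => (ω.2 k).2.2) (C.law W)

/-- `I(M₂; Zⁿ)`. -/
def Code.leakage₂ (C : Code X₁ X₂ Y₁ Y₂ n) (W : Kernel (X₁ × X₂) (Y₁ × Y₂ × Z))
    [IsMarkovKernel W] : ℝ≥0∞ :=
  mutualInfo (fun ω : C.Sample Z => ω.1.1.2) (fun ω => fun k => (ω.2 k).2.2) (C.law W)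

/-- Peak cost constraint: for every message, the codeword almost surely has average cost
at most `cᵢ`. -/
def Code.PeakCost (C : Code X₁ X₂ Y₁ Y₂ n) (g₁ : X₁ → ℝ) (g₂ : X₂ → ℝ) (c₁ c₂ : ℝ) : Prop :=
  (∀ m, ∀ᵐ x ∂(C.enc₁ m), (1 / (n : ℝ)) * ∑ k, g₁ (x k) ≤ c₁) ∧
  (∀ m, ∀ᵐ x ∂(C.enc₂ m), (1 / (n : ℝ)) * ∑ k, g₂ (x k) ≤ c₂)

/-- Rate pairs achievable under strong joint secrecy by non-adaptive codes with the peak cost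
constraint (the capacity region `𝒞_{J,S,N,2}^{P,c₁,c₂}`). -/
def capacityJoint (W : Kernel (X₁ × X₂) (Y₁ × Y₂ × Z)) [IsMarkovKernel W]
    (g₁ : X₁ → ℝ) (g₂ : X₂ → ℝ) (c₁ c₂ : ℝ) : Set (ℝ × ℝ) :=
  {R | ∃ C : ∀ n : ℕ, Code X₁ X₂ Y₁ Y₂ n,
    (∀ n, 1 ≤ n → (C n).PeakCost g₁ g₂ c₁ c₂) ∧
    Tendsto (fun n : ℕ => Real.log ((C n).M₁ : ℝ) / (n : ℝ)) atTop (𝓝 R.1) ∧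
    Tendsto (fun n : ℕ => Real.log ((C n).M₂ : ℝ) / (n : ℝ)) atTop (𝓝 R.2) ∧
    Tendsto (fun n => (C n).errorProb W) atTop (𝓝 0) ∧
    Tendsto (fun n => (C n).leakage W) atTop (𝓝 0)}

/-- Rate pairs achievable under strong individual secrecy by non-adaptive codes with the peak cost
constraint (the capacity region `𝒞_{I,S,N,2}^{P,c₁,c₂}`). -/
def capacityIndividual (W : Kernel (X₁ × X₂) (Y₁ × Y₂ × Z)) [IsMarkovKernel W]
    (g₁ : X₁ → ℝ) (g₂ : X₂ → ℝ) (c₁ c₂ : ℝ) : Set (ℝ × ℝ) :=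
  {R | ∃ C : ∀ n : ℕ, Code X₁ X₂ Y₁ Y₂ n,
    (∀ n, 1 ≤ n → (C n).PeakCost g₁ g₂ c₁ c₂) ∧
    Tendsto (fun n : ℕ => Real.log ((C n).M₁ : ℝ) / (n : ℝ)) atTop (𝓝 R.1) ∧
    Tendsto (fun n : ℕ => Real.log ((C n).M₂ : ℝ) / (n : ℝ)) atTop (𝓝 R.2) ∧
    Tendsto (fun n => (C n).errorProb W) atTop (𝓝 0) ∧
    Tendsto (fun n => (C n).leakage₁ W) atTop (𝓝 0) ∧
    Tendsto (fun n => (C n).leakage₂ W) atTop (𝓝 0)}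

end CodePerformance

/-! ### Single-letter regions -/

/-- A distribution `P_V × P_{X|V}` on `V × X`. -/
structure Input (V X : Type*) [MeasurableSpace V] [MeasurableSpace X] where
  pV : Measure V
  pre : Kernel V X
  isProb : IsProbabilityMeasure pV
  isMarkov : IsMarkovKernel pre

attribute [instance] Input.isProb Input.isMarkov

section Inputs

variable {V X : Type*} [MeasurableSpace V] [MeasurableSpace X]

/-- The joint law of `(V, X)`. -/
def Input.joint (P : Input V X) : Measure (V × X) := P.pV ⊗ₘ P.pre

instance (P : Input V X) : IsProbabilityMeasure P.joint :=
  inferInstanceAs (IsProbabilityMeasure (P.pV ⊗ₘ P.pre))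

/-- The expected cost of `X` exists and is at most `c`. -/
def Input.CostLE (P : Input V X) (g : X → ℝ) (c : ℝ) : Prop :=
  Integrable g (P.joint.map Prod.snd) ∧ ∫ x, g x ∂(P.joint.map Prod.snd) ≤ c

end Inputs

section Regions

variable {X₁ X₂ Y₁ Y₂ Z : Type*} [MeasurableSpace X₁] [MeasurableSpace X₂] [MeasurableSpace Y₁]
  [MeasurableSpace Y₂] [MeasurableSpace Z]

section SingleLetter

variable {V₁ V₂ : Type*} [MeasurableSpace V₁] [MeasurableSpace V₂]

/-- Joint law of `(((V₁, X₁), (V₂, X₂)), (Y₁, Y₂, Z))`. -/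
def letterLaw (W : Kernel (X₁ × X₂) (Y₁ × Y₂ × Z)) (P₁ : Input V₁ X₁) (P₂ : Input V₂ X₂) :
    Measure (((V₁ × X₁) × (V₂ × X₂)) × (Y₁ × Y₂ × Z)) :=
  (P₁.joint.prod P₂.joint) ⊗ₘ
    (W.comap (fun p : (V₁ × X₁) × (V₂ × X₂) => (p.1.2, p.2.2)) (by fun_prop))

instance (W : Kernel (X₁ × X₂) (Y₁ × Y₂ × Z)) [IsMarkovKernel W] (P₁ : Input V₁ X₁)
    (P₂ : Input V₂ X₂) : IsProbabilityMeasure (letterLaw W P₁ P₂) := by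
  unfold letterLaw
  infer_instance

variable (W : Kernel (X₁ × X₂) (Y₁ × Y₂ × Z)) [IsMarkovKernel W]
  (P₁ : Input V₁ X₁) (P₂ : Input V₂ X₂)

/-- `I(Y₂; V₁ | X₂)`. -/
def infoY₂ [StandardBorelSpace Y₂] [Nonempty Y₂] [StandardBorelSpace V₁] [Nonempty V₁] : ℝ≥0∞ :=
  condMutualInfo (fun ω => ω.2.2.1) (fun ω => ω.1.1.1) (fun ω => ω.1.2.2) (letterLaw W P₁ P₂)

/-- `I(Y₁; V₂ | X₁)`. -/
def infoY₁ [StandardBorelSpace Y₁] [Nonempty Y₁] [StandardBorelSpace V₂] [Nonempty V₂] : ℝ≥0∞ :=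
  condMutualInfo (fun ω => ω.2.1) (fun ω => ω.1.2.1) (fun ω => ω.1.1.2) (letterLaw W P₁ P₂)

/-- `I(Z; V₁)`. -/
def infoZ₁ : ℝ≥0∞ :=
  mutualInfo (fun ω => ω.2.2.2) (fun ω => ω.1.1.1) (letterLaw W P₁ P₂)

/-- `I(Z; V₂)`. -/
def infoZ₂ : ℝ≥0∞ :=
  mutualInfo (fun ω => ω.2.2.2) (fun ω => ω.1.2.1) (letterLaw W P₁ P₂)

/-- `I(V₁, V₂; Z)`. -/
def infoZ : ℝ≥0∞ :=
  mutualInfo (fun ω => (ω.1.1.1, ω.1.2.1)) (fun ω => ω.2.2.2) (letterLaw W P₁ P₂)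

/- In the next two definitions the differences are taken in `EReal`, where `⊤ - ⊤ = ⊥`:
an indeterminate difference of infinite informations admits no rate pair. -/

/-- The region `ℛ_{J,N}(P_{V₁ V₂ X₁ X₂})`. -/
def letterRegionJoint [StandardBorelSpace Y₁] [Nonempty Y₁] [StandardBorelSpace Y₂] [Nonempty Y₂]
    [StandardBorelSpace V₁] [Nonempty V₁] [StandardBorelSpace V₂] [Nonempty V₂] : Set (ℝ × ℝ) :=
  {R | 0 ≤ R.1 ∧ 0 ≤ R.2 ∧
    (R.1 : EReal) ≤ (infoY₂ W P₁ P₂ : EReal) - (infoZ₁ W P₁ P₂ : EReal) ∧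
    (R.2 : EReal) ≤ (infoY₁ W P₁ P₂ : EReal) - (infoZ₂ W P₁ P₂ : EReal) ∧
    ((R.1 + R.2 : ℝ) : EReal) ≤
      (infoY₂ W P₁ P₂ : EReal) + (infoY₁ W P₁ P₂ : EReal) - (infoZ W P₁ P₂ : EReal)}

/-- The region `ℛ_{I,N}(P_{V₁ V₂ X₁ X₂})`. -/
def letterRegionIndividual [StandardBorelSpace Y₁] [Nonempty Y₁] [StandardBorelSpace Y₂]
    [Nonempty Y₂] [StandardBorelSpace V₁] [Nonempty V₁] [StandardBorelSpace V₂] [Nonempty V₂] :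
    Set (ℝ × ℝ) :=
  {R | 0 ≤ R.1 ∧ 0 ≤ R.2 ∧
    (R.1 : EReal) ≤ (infoY₂ W P₁ P₂ : EReal) - (infoZ₁ W P₁ P₂ : EReal) ∧
    (R.2 : EReal) ≤ (infoY₁ W P₁ P₂ : EReal) - (infoZ₂ W P₁ P₂ : EReal) ∧
    ((max R.1 R.2 : ℝ) : EReal) ≤
      (infoY₁ W P₁ P₂ : EReal) + (infoY₂ W P₁ P₂ : EReal) - (infoZ W P₁ P₂ : EReal)}

end SingleLetter

variable (W : Kernel (X₁ × X₂) (Y₁ × Y₂ × Z)) [IsMarkovKernel W]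
  [StandardBorelSpace Y₁] [Nonempty Y₁] [StandardBorelSpace Y₂] [Nonempty Y₂]

/-- The region `ℛ_{J,N}^{c₁,c₂}`: closure of the convex hull of the union over all auxiliary
alphabets and all `P_{V₁} P_{X₁|V₁} P_{V₂} P_{X₂|V₂}` with expected costs at most `c₁`, `c₂`. Every
standard Borel space is isomorphic to one in `Type`, so this ranges over all of them. -/
def regionJoint (g₁ : X₁ → ℝ) (g₂ : X₂ → ℝ) (c₁ c₂ : ℝ) : Set (ℝ × ℝ) :=
  closure (convexHull ℝ {R | ∃ (V₁ V₂ : Type) (_ : MeasurableSpace V₁) (_ : MeasurableSpace V₂)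
    (_ : StandardBorelSpace V₁) (_ : StandardBorelSpace V₂) (_ : Nonempty V₁) (_ : Nonempty V₂)
    (P₁ : Input V₁ X₁) (P₂ : Input V₂ X₂),
    P₁.CostLE g₁ c₁ ∧ P₂.CostLE g₂ c₂ ∧ R ∈ letterRegionJoint W P₁ P₂})

/-- The region `ℛ_{I,N}^{c₁,c₂}`. -/
def regionIndividual (g₁ : X₁ → ℝ) (g₂ : X₂ → ℝ) (c₁ c₂ : ℝ) : Set (ℝ × ℝ) :=
  closure (convexHull ℝ {R | ∃ (V₁ V₂ : Type) (_ : MeasurableSpace V₁) (_ : MeasurableSpace V₂)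
    (_ : StandardBorelSpace V₁) (_ : StandardBorelSpace V₂) (_ : Nonempty V₁) (_ : Nonempty V₂)
    (P₁ : Input V₁ X₁) (P₂ : Input V₂ X₂),
    P₁.CostLE g₁ c₁ ∧ P₂.CostLE g₂ c₂ ∧ R ∈ letterRegionIndividual W P₁ P₂})

end Regions

/-- `c` lies between the infimum and the supremum of the range of `g`. -/
def InCostRange {X : Type*} (g : X → ℝ) (c : ℝ) : Prop :=
  (⨅ x, (g x : EReal)) ≤ (c : EReal) ∧ (c : EReal) ≤ ⨆ x, (g x : EReal)

/-- Time-sharing extension of a family `S c₁ c₂` of regions: averages, under a finitely supported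
distribution `Q`, of rate pairs in `S (d₁ j) (d₂ j)`, where the `Q`-averages of the cost levels
`d₁`, `d₂` are at most `c₁`, `c₂`. -/
def timeShared {X₁ X₂ : Type*} (S : ℝ → ℝ → Set (ℝ × ℝ)) (g₁ : X₁ → ℝ) (g₂ : X₂ → ℝ)
    (c₁ c₂ : ℝ) : Set (ℝ × ℝ) :=
  {R | ∃ (m : ℕ) (Q d₁ d₂ : Fin m → ℝ) (r : Fin m → ℝ × ℝ),
    (∀ j, 0 ≤ Q j) ∧ ∑ j, Q j = 1 ∧
    (∀ j, InCostRange g₁ (d₁ j)) ∧ (∀ j, InCostRange g₂ (d₂ j)) ∧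
    ∑ j, Q j * d₁ j ≤ c₁ ∧ ∑ j, Q j * d₂ j ≤ c₂ ∧
    (∀ j, r j ∈ S (d₁ j) (d₂ j)) ∧
    R = (∑ j, Q j * (r j).1, ∑ j, Q j * (r j).2)}

end

end TWWC

open scoped NNReal

namespace TWWC

set_option linter.unusedSectionVars false

section RandomCodebook

variable {U V ι κ : Type*} [Finite U] [MeasurableSpace U] [MeasurableSingletonClass U]
  [Finite V] [MeasurableSpace V] [MeasurableSingletonClass V] [Fintype ι] [Fintype κ]
  {p : Measure U} [IsProbabilityMeasure p] {q : Measure V} [IsProbabilityMeasure q]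

lemma integral_pi_eval (G : U → ℝ) (a : ι) :
    ∫ c, G (c a) ∂(Measure.pi fun _ : ι => p) = ∫ u, G u ∂p := by
  have h := measurePreserving_eval (fun _ : ι => p) a
  have h2 := integral_map (μ := Measure.pi fun _ : ι => p) (f := G) h.measurable.aemeasurable
    (Measurable.of_discrete (f := G)).aestronglyMeasurable
  rw [h.map_eq] at h2
  exact h2.symm

lemma map_pi_eval_pair {a b : ι} (hab : a ≠ b) :
    (Measure.pi fun _ : ι => p).map (fun c => (c a, c b)) = p.prod p := by
  have hi : iIndepFun (fun (i : ι) (c : ι → U) => c i) (Measure.pi fun _ : ι => p) :=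
    iIndepFun_pi (X := fun _ u => u) (fun _ => aemeasurable_id)
  have h := (indepFun_iff_map_prod_eq_prod_map_map (measurable_pi_apply a).aemeasurable
    (measurable_pi_apply b).aemeasurable).1
    (hi.indepFun hab)
  rw [h]
  exact congrArg₂ _ (measurePreserving_eval (fun _ : ι => p) a).map_eq
    (measurePreserving_eval (fun _ : ι => p) b).map_eq

lemma integral_pi_eval_pair (G : U → U → ℝ) {a b : ι} (hab : a ≠ b) :
    ∫ c, G (c a) (c b) ∂(Measure.pi fun _ : ι => p) = ∫ u, ∫ u', G u u' ∂p ∂p := by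
  rw [integral_integral (f := G) Integrable.of_finite, ← map_pi_eval_pair hab,
    integral_map (by fun_prop)]
  exact (Measurable.of_discrete (f := fun z : U × U => G z.1 z.2)).aestronglyMeasurable

lemma lintegral_pi_eval_pair (G : U → U → ℝ≥0∞) {a b : ι} (hab : a ≠ b) :
    ∫⁻ c, G (c a) (c b) ∂(Measure.pi fun _ : ι => p) = ∫⁻ u, ∫⁻ u', G u u' ∂p ∂p := by
  rw [lintegral_lintegral (f := G) Measurable.of_discrete.aemeasurable, ← map_pi_eval_pair hab,
    lintegral_map Measurable.of_discrete (by fun_prop)]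

lemma lintegral_pi_eval (G : U → ℝ≥0∞) (a : ι) :
    ∫⁻ c, G (c a) ∂(Measure.pi fun _ : ι => p) = ∫⁻ u, G u ∂p := by
  have h := measurePreserving_eval (fun _ : ι => p) a
  have h2 := lintegral_map (μ := Measure.pi fun _ : ι => p) (f := G) Measurable.of_discrete
    h.measurable
  rw [h.map_eq] at h2
  exact h2.symm

lemma sum_integral_pi_eval_pair (G : U → U → ℝ) (a : ι) :
    ∑ b, ∫ c, G (c a) (c b) ∂(Measure.pi fun _ : ι => p)
      = ∫ u, G u u ∂p + ((Fintype.card ι : ℝ) - 1) * ∫ u, ∫ u', G u u' ∂p ∂p := by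
  classical
  rw [← Finset.add_sum_erase _ _ (Finset.mem_univ a), integral_pi_eval (fun u => G u u)]
  congr 1
  rw [Finset.sum_congr rfl fun b hb => integral_pi_eval_pair G (Finset.ne_of_mem_erase hb).symm,
    Finset.sum_const, Finset.card_erase_of_mem (Finset.mem_univ a), nsmul_eq_mul,
    Finset.card_univ, Nat.cast_sub (Fintype.card_pos_iff.2 ⟨a⟩)]
  simp

/-- The bilinear second moment of two independent random codebooks around the codeword pair
`(a, b)`. -/
lemma sum_integral_codebooks_le (h k : U → V → ℝ) (hh : ∀ u v, 0 ≤ h u v) (hk : ∀ u v, 0 ≤ k u v)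
    (a : ι) (b : κ) :
    ∫ c, ∫ d, h (c a) (d b) * ∑ a', ∑ b', k (c a') (d b') ∂(Measure.pi fun _ : κ => q)
        ∂(Measure.pi fun _ : ι => p)
      ≤ ∫ u, ∫ v, h u v * (k u v + Fintype.card κ * ∫ v', k u v' ∂q
          + Fintype.card ι * ∫ u', k u' v ∂p
          + Fintype.card ι * Fintype.card κ * ∫ u', ∫ v', k u' v' ∂q ∂p) ∂q ∂p := by
  have hκ : (1 : ℝ) ≤ Fintype.card κ := by exact_mod_cast Fintype.card_pos_iff.2 ⟨b⟩
  have hι : (1 : ℝ) ≤ Fintype.card ι := by exact_mod_cast Fintype.card_pos_iff.2 ⟨a⟩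
  set G : U → U → ℝ := fun u u' => ∫ v, h u v * k u' v ∂q
    + ((Fintype.card κ : ℝ) - 1) * ∫ v, ∫ v', h u v * k u' v' ∂q ∂q with hG
  have e1 : ∀ c : ι → U, ∫ d, h (c a) (d b) * ∑ a', ∑ b', k (c a') (d b')
      ∂(Measure.pi fun _ : κ => q) = ∑ a', G (c a) (c a') := by
    intro c
    simp_rw [Finset.mul_sum]
    rw [integral_finsetSum _ fun _ _ => Integrable.of_finite]
    refine Finset.sum_congr rfl fun a' _ => ?_
    rw [integral_finsetSum _ fun _ _ => Integrable.of_finite]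
    exact sum_integral_pi_eval_pair (fun v v' => h (c a) v * k (c a') v') b
  simp_rw [e1]
  rw [integral_finsetSum _ fun _ _ => Integrable.of_finite, sum_integral_pi_eval_pair]
  have hI : ∀ (F : U → ℝ), Integrable F p := fun F => Integrable.of_finite
  have hJ : ∀ (F : V → ℝ), Integrable F q := fun F => Integrable.of_finite
  have e2 : ∀ u, ∫ v, h u v * (k u v + Fintype.card κ * ∫ v', k u v' ∂q
          + Fintype.card ι * ∫ u', k u' v ∂p
          + Fintype.card ι * Fintype.card κ * ∫ u', ∫ v', k u' v' ∂q ∂p) ∂q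
      = ∫ v, h u v * k u v ∂q + Fintype.card κ * ∫ v, ∫ v', h u v * k u v' ∂q ∂q
        + Fintype.card ι * ∫ u', ∫ v, h u v * k u' v ∂q ∂p
        + Fintype.card ι * Fintype.card κ * ∫ u', ∫ v, ∫ v', h u v * k u' v' ∂q ∂q ∂p := by
    intro u
    rw [integral_integral_swap (f := fun u' v => h u v * k u' v) Integrable.of_finite]
    rw [integral_integral_swap (f := fun u' v => ∫ v', h u v * k u' v' ∂q) Integrable.of_finite]
    simp_rw [mul_add, integral_const_mul]
    rw [integral_add (hJ _) (hJ _), integral_add (hJ _) (hJ _), integral_add (hJ _) (hJ _)]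
    simp_rw [mul_left_comm (h u _), integral_const_mul]
  simp_rw [e2]
  rw [integral_add (hI _) (hI _), integral_add (hI _) (hI _), integral_add (hI _) (hI _)]
  simp_rw [integral_const_mul, hG]
  rw [integral_add (hI _) (hI _)]
  have e3 : ∀ u, ∫ u', (∫ v, h u v * k u' v ∂q
      + ((Fintype.card κ : ℝ) - 1) * ∫ v, ∫ v', h u v * k u' v' ∂q ∂q) ∂p
      = ∫ u', ∫ v, h u v * k u' v ∂q ∂p
        + ((Fintype.card κ : ℝ) - 1) * ∫ u', ∫ v, ∫ v', h u v * k u' v' ∂q ∂q ∂p := by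
    intro u
    rw [integral_add (hI _) (hI _), integral_const_mul]
  simp_rw [e3]
  rw [integral_add (hI _) (hI _)]
  simp_rw [integral_const_mul]
  have hk1 : ∀ u, 0 ≤ ∫ v', k u v' ∂q := fun u => integral_nonneg (hk u)
  have n1 : 0 ≤ ∫ u, ∫ v, h u v * ∫ v', k u v' ∂q ∂q ∂p :=
    integral_nonneg fun u => integral_nonneg fun v => mul_nonneg (hh u v) (hk1 u)
  have n2 : 0 ≤ ∫ u, ∫ u', ∫ v, h u v * k u' v ∂q ∂p ∂p :=
    integral_nonneg fun u => integral_nonneg fun u' => integral_nonneg fun v =>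
      mul_nonneg (hh u v) (hk u' v)
  have n3 : 0 ≤ ∫ u, ∫ u', ∫ v, h u v * ∫ v', k u' v' ∂q ∂q ∂p ∂p :=
    integral_nonneg fun u => integral_nonneg fun u' => integral_nonneg fun v =>
      mul_nonneg (hh u v) (hk1 u')
  nlinarith [mul_nonneg (sub_nonneg.2 hκ) n3, mul_nonneg (sub_nonneg.2 hι) n3]

end RandomCodebook

section Resolvability

variable {U V ι κ : Type*} [Finite U] [MeasurableSpace U] [MeasurableSingletonClass U]
  [Finite V] [MeasurableSpace V] [MeasurableSingletonClass V] [Fintype ι] [Fintype κ]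
  {p : Measure U} [IsProbabilityMeasure p] {q : Measure V} [IsProbabilityMeasure q]

/-- The mean of `k` over all pairs of codewords of two codebooks. -/
noncomputable def codebookMean (k : U → V → ℝ) (c : ι → U) (d : κ → V) : ℝ :=
  ((Fintype.card ι : ℝ) * Fintype.card κ)⁻¹ * ∑ a, ∑ b, k (c a) (d b)

/-- The conditional mean of `codebookMean k` given one of its codeword pairs, up to replacing
`(A - 1) / A` by `1`. -/
noncomputable def localMean (ι κ : Type*) [Fintype ι] [Fintype κ] (p : Measure U) (q : Measure V)
    (k : U → V → ℝ) (u : U) (v : V) : ℝ :=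
  ((Fintype.card ι : ℝ) * Fintype.card κ)⁻¹ * k u v + (Fintype.card ι : ℝ)⁻¹ * ∫ v', k u v' ∂q
    + (Fintype.card κ : ℝ)⁻¹ * ∫ u', k u' v ∂p + ∫ u', ∫ v', k u' v' ∂q ∂p

lemma mul_log_le_tangent {k f t : ℝ} (hk : 0 ≤ k) (hf : 0 < k → 0 < f) (ht : 0 < k → 0 < t) :
    k * Real.log f ≤ k * Real.log t + k / t * f - k := by
  rcases hk.eq_or_lt with rfl | hk
  · simp
  have hf := hf hk
  have ht := ht hk
  have h := Real.log_le_sub_one_of_pos (div_pos hf ht)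
  rw [Real.log_div hf.ne' ht.ne'] at h
  have : k * (Real.log f - Real.log t) ≤ k * (f / t - 1) := by gcongr
  have e : k / t * f = k * (f / t) := by ring
  rw [e]; linarith

lemma integral_codebookMean [Nonempty ι] [Nonempty κ] (k : U → V → ℝ) :
    ∫ c, ∫ d, codebookMean k c d ∂(Measure.pi fun _ : κ => q) ∂(Measure.pi fun _ : ι => p)
      = ∫ u, ∫ v, k u v ∂q ∂p := by
  have hκ : (Fintype.card κ : ℝ) ≠ 0 := by simp
  have hι : (Fintype.card ι : ℝ) ≠ 0 := by simp
  simp only [codebookMean]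
  have e1 : ∀ c : ι → U, ∫ d, ((Fintype.card ι : ℝ) * Fintype.card κ)⁻¹ *
      ∑ a, ∑ b, k (c a) (d b) ∂(Measure.pi fun _ : κ => q)
      = (Fintype.card ι : ℝ)⁻¹ * ∑ a, ∫ v, k (c a) v ∂q := by
    intro c
    rw [integral_const_mul, integral_finsetSum _ fun _ _ => Integrable.of_finite]
    have : ∀ a, ∫ d, ∑ b, k (c a) (d b) ∂(Measure.pi fun _ : κ => q)
        = Fintype.card κ * ∫ v, k (c a) v ∂q := by
      intro a
      rw [integral_finsetSum _ fun _ _ => Integrable.of_finite,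
        Finset.sum_congr rfl fun b _ => integral_pi_eval (fun v => k (c a) v) b]
      simp
    simp_rw [this, ← Finset.mul_sum]
    field_simp
  simp_rw [e1]
  rw [integral_const_mul, integral_finsetSum _ fun _ _ => Integrable.of_finite,
    Finset.sum_congr rfl fun b _ => integral_pi_eval (fun u => ∫ v, k u v ∂q) b]
  simp

lemma integral_codebookMean_mul_log_le [Nonempty ι] [Nonempty κ] (k : U → V → ℝ)
    (hk : ∀ u v, 0 ≤ k u v) :
    ∫ c, ∫ d, codebookMean k c d * Real.log (codebookMean k c d)
        ∂(Measure.pi fun _ : κ => q) ∂(Measure.pi fun _ : ι => p)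
      ≤ ∫ u, ∫ v, k u v * Real.log (localMean ι κ p q k u v) ∂q ∂p := by
  have hκ : (0 : ℝ) < Fintype.card κ := by exact_mod_cast Fintype.card_pos
  have hι : (0 : ℝ) < Fintype.card ι := by exact_mod_cast Fintype.card_pos
  set N : ℝ := (Fintype.card ι : ℝ) * Fintype.card κ with hN
  have hN0 : 0 < N := mul_pos hι hκ
  set t := localMean ι κ p q k with ht
  have htk : ∀ u v, N⁻¹ * k u v ≤ t u v := by
    intro u v
    have h1 : 0 ≤ ∫ v', k u v' ∂q := integral_nonneg (hk u)
    have h2 : 0 ≤ ∫ u', k u' v ∂p := integral_nonneg fun u' => hk u' v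
    have h3 : 0 ≤ ∫ u', ∫ v', k u' v' ∂q ∂p := integral_nonneg fun u' => integral_nonneg (hk u')
    simp only [ht, localMean]
    have h4 : 0 ≤ (Fintype.card ι : ℝ)⁻¹ * ∫ v', k u v' ∂q := by positivity
    have h5 : 0 ≤ (Fintype.card κ : ℝ)⁻¹ * ∫ u', k u' v ∂p := by positivity
    linarith
  have ht0 : ∀ u v, 0 ≤ t u v := fun u v => le_trans (by have := hk u v; positivity) (htk u v)
  have htp : ∀ u v, 0 < k u v → 0 < t u v := fun u v h =>
    lt_of_lt_of_le (by positivity) (htk u v)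
  have hfp : ∀ (c : ι → U) (d : κ → V) a b, 0 < k (c a) (d b) → 0 < codebookMean k c d := by
    intro c d a b h
    refine mul_pos (inv_pos.2 hN0) (lt_of_lt_of_le h ?_)
    refine le_trans ?_ (Finset.single_le_sum (f := fun a => ∑ b, k (c a) (d b))
      (fun i _ => Finset.sum_nonneg fun j _ => hk _ _) (Finset.mem_univ a))
    exact Finset.single_le_sum (f := fun b => k (c a) (d b)) (fun j _ => hk _ _)
      (Finset.mem_univ b)
  have hI : ∀ (F : (ι → U) → ℝ), Integrable F (Measure.pi fun _ : ι => p) :=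
    fun F => Integrable.of_finite
  have hJ : ∀ (F : (κ → V) → ℝ), Integrable F (Measure.pi fun _ : κ => q) :=
    fun F => Integrable.of_finite
  have hIu : ∀ (F : U → ℝ), Integrable F p := fun F => Integrable.of_finite
  have hJv : ∀ (F : V → ℝ), Integrable F q := fun F => Integrable.of_finite
  have key : ∀ a b, ∫ c, ∫ d, k (c a) (d b) * Real.log (codebookMean k c d)
        ∂(Measure.pi fun _ : κ => q) ∂(Measure.pi fun _ : ι => p)
      ≤ ∫ u, ∫ v, k u v * Real.log (t u v) ∂q ∂p := by
    intro a b
    have h1 : ∫ c, ∫ d, k (c a) (d b) * Real.log (codebookMean k c d)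
        ∂(Measure.pi fun _ : κ => q) ∂(Measure.pi fun _ : ι => p)
        ≤ ∫ c, ∫ d, (k (c a) (d b) * Real.log (t (c a) (d b)) +
          k (c a) (d b) / t (c a) (d b) * codebookMean k c d - k (c a) (d b))
          ∂(Measure.pi fun _ : κ => q) ∂(Measure.pi fun _ : ι => p) :=
      integral_mono (hI _) (hI _) fun c => integral_mono (hJ _) (hJ _) fun d =>
        mul_log_le_tangent (hk _ _) (hfp c d a b) (htp _ _)
    refine h1.trans ?_
    have e : ∀ c : ι → U, ∫ d, (k (c a) (d b) * Real.log (t (c a) (d b)) +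
          k (c a) (d b) / t (c a) (d b) * codebookMean k c d - k (c a) (d b))
          ∂(Measure.pi fun _ : κ => q)
        = ∫ v, k (c a) v * Real.log (t (c a) v) ∂q +
          N⁻¹ * ∫ d, k (c a) (d b) / t (c a) (d b) * ∑ a', ∑ b', k (c a') (d b')
            ∂(Measure.pi fun _ : κ => q) - ∫ v, k (c a) v ∂q := by
      intro c
      rw [integral_sub (hJ _) (hJ _), integral_add (hJ _) (hJ _),
        integral_pi_eval (fun v => k (c a) v * Real.log (t (c a) v)),
        integral_pi_eval (fun v => k (c a) v), ← integral_const_mul]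
      congr 3
      funext d
      simp only [codebookMean]
      ring
    simp_rw [e]
    rw [integral_sub (hI _) (hI _), integral_add (hI _) (hI _), integral_const_mul,
      integral_pi_eval (fun u => ∫ v, k u v * Real.log (t u v) ∂q),
      integral_pi_eval (fun u => ∫ v, k u v ∂q)]
    have h2 := sum_integral_codebooks_le (p := p) (q := q) (fun u v => k u v / t u v) k
      (fun u v => div_nonneg (hk u v) (ht0 u v)) hk a b
    have h3 : ∫ u, ∫ v, k u v / t u v * (k u v + Fintype.card κ * ∫ v', k u v' ∂q
          + Fintype.card ι * ∫ u', k u' v ∂p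
          + Fintype.card ι * Fintype.card κ * ∫ u', ∫ v', k u' v' ∂q ∂p) ∂q ∂p
        ≤ N * ∫ u, ∫ v, k u v ∂q ∂p := by
      have e0 : N * ∫ u, ∫ v, k u v ∂q ∂p = ∫ u, ∫ v, N * k u v ∂q ∂p := by
        simp_rw [integral_const_mul]
      refine le_of_le_of_eq ?_ e0.symm
      refine integral_mono (hIu _) (hIu _) fun u => ?_
      refine integral_mono (hJv _) (hJv _) fun v => ?_
      dsimp only
      have e3 : k u v + Fintype.card κ * ∫ v', k u v' ∂q
          + Fintype.card ι * ∫ u', k u' v ∂p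
          + Fintype.card ι * Fintype.card κ * ∫ u', ∫ v', k u' v' ∂q ∂p = N * t u v := by
        simp only [ht, localMean, hN]
        field_simp
      rw [e3]
      rcases (hk u v).eq_or_lt with h0 | h0
      · simp [← h0]
      · have := htp u v h0
        apply le_of_eq
        field_simp
    have h4 : N⁻¹ * ∫ c, ∫ d, k (c a) (d b) / t (c a) (d b) * ∑ a', ∑ b', k (c a') (d b')
            ∂(Measure.pi fun _ : κ => q) ∂(Measure.pi fun _ : ι => p)
        ≤ ∫ u, ∫ v, k u v ∂q ∂p := by
      rw [inv_mul_le_iff₀ hN0]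
      exact h2.trans h3
    linarith
  have e : ∀ c : ι → U, ∫ d, codebookMean k c d * Real.log (codebookMean k c d)
        ∂(Measure.pi fun _ : κ => q)
      = N⁻¹ * ∑ a, ∑ b, ∫ d, k (c a) (d b) * Real.log (codebookMean k c d)
        ∂(Measure.pi fun _ : κ => q) := by
    intro c
    have : ∀ a, ∑ b, ∫ d, k (c a) (d b) * Real.log (codebookMean k c d)
        ∂(Measure.pi fun _ : κ => q) = ∫ d, ∑ b, k (c a) (d b) * Real.log (codebookMean k c d)
        ∂(Measure.pi fun _ : κ => q) := fun a => (integral_finsetSum _ fun _ _ => hJ _).symm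
    simp_rw [this]
    rw [← integral_finsetSum _ fun _ _ => hJ _, ← integral_const_mul]
    congr 1
    funext d
    simp_rw [← Finset.sum_mul]
    rw [← mul_assoc]
    rfl
  simp_rw [e]
  rw [integral_const_mul, integral_finsetSum _ fun _ _ => hI _]
  have : ∀ a, ∫ c, ∑ b, ∫ d, k (c a) (d b) * Real.log (codebookMean k c d)
        ∂(Measure.pi fun _ : κ => q) ∂(Measure.pi fun _ : ι => p)
      = ∑ b, ∫ c, ∫ d, k (c a) (d b) * Real.log (codebookMean k c d)
        ∂(Measure.pi fun _ : κ => q) ∂(Measure.pi fun _ : ι => p) :=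
    fun a => integral_finsetSum _ fun _ _ => hI _
  simp_rw [this]
  rw [inv_mul_le_iff₀ hN0]
  refine (Finset.sum_le_sum fun a _ => Finset.sum_le_sum fun b _ => key a b).trans ?_
  simp [hN, mul_assoc]

lemma log_one_add_le_rpow_div {x s : ℝ} (hx : 0 ≤ x) (hs : 0 < s) (hs1 : s ≤ 1) :
    Real.log (1 + x) ≤ x ^ s / s := by
  rw [le_div_iff₀ hs, mul_comm, ← Real.log_rpow (by positivity)]
  have h : (1 + x) ^ s ≤ 1 + x ^ s := by
    have := Real.rpow_add_le_add_rpow zero_le_one hx hs.le hs1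
    simpa using this
  calc Real.log ((1 + x) ^ s) ≤ Real.log (1 + x ^ s) := Real.log_le_log (by positivity) h
    _ ≤ x ^ s := by
      have := Real.log_le_sub_one_of_pos (x := 1 + x ^ s) (by positivity)
      linarith

lemma log_one_add_three_le {x y w s : ℝ} (hx : 0 ≤ x) (hy : 0 ≤ y) (hw : 0 ≤ w) (hs : 0 < s)
    (hs1 : s ≤ 1) :
    Real.log (1 + x + y + w) ≤ (x ^ s + y ^ s + w ^ s) / s := by
  have h : Real.log (1 + x + y + w) ≤ Real.log ((1 + x) * (1 + y) * (1 + w)) := by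
    apply Real.log_le_log (by positivity)
    have := mul_nonneg hx hy
    have := mul_nonneg hx hw
    have := mul_nonneg hy hw
    have := mul_nonneg (mul_nonneg hx hy) hw
    nlinarith
  rw [Real.log_mul (by positivity) (by positivity), Real.log_mul (by positivity) (by positivity)]
    at h
  have := log_one_add_le_rpow_div hx hs hs1
  have := log_one_add_le_rpow_div hy hs hs1
  have := log_one_add_le_rpow_div hw hs hs1
  rw [add_div, add_div]
  linarith

end Resolvability

section ResolvabilityMeasure

open InformationTheory

variable {U V ι κ Z : Type*} [Finite U] [MeasurableSpace U] [MeasurableSingletonClass U]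
  [Finite V] [MeasurableSpace V] [MeasurableSingletonClass V] [Fintype ι] [Fintype κ]
  [MeasurableSpace Z]

lemma klDiv_withDensity_ofReal (Q : Measure Z) [IsFiniteMeasure Q] {g : Z → ℝ}
    (hg : Measurable g) (hg0 : ∀ z, 0 ≤ g z)
    [IsFiniteMeasure (Q.withDensity fun z => ENNReal.ofReal (g z))] :
    klDiv (Q.withDensity fun z => ENNReal.ofReal (g z)) Q
      = ∫⁻ z, ENNReal.ofReal (klFun (g z)) ∂Q := by
  rw [klDiv_eq_lintegral_klFun_of_ac (withDensity_absolutelyContinuous _ _)]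
  refine lintegral_congr_ae ?_
  filter_upwards [Q.rnDeriv_withDensity (f := fun z => ENNReal.ofReal (g z)) (by fun_prop)]
    with z hz
  rw [hz, ENNReal.toReal_ofReal (hg0 z)]

/-- The uniform mixture of the measures `μ (c a) (d b)` over all pairs of codewords. -/
noncomputable def codebookMixture (μ : U → V → Measure Z) (c : ι → U) (d : κ → V) : Measure Z :=
  ((Fintype.card ι : ℝ≥0∞) * Fintype.card κ)⁻¹ • ∑ a, ∑ b, μ (c a) (d b)

instance [Nonempty ι] [Nonempty κ] (μ : U → V → Measure Z) [∀ u v, IsProbabilityMeasure (μ u v)]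
    (c : ι → U) (d : κ → V) : IsProbabilityMeasure (codebookMixture μ c d) := by
  refine ⟨?_⟩
  simp only [codebookMixture, Measure.smul_apply, Measure.finsetSum_apply, measure_univ,
    Finset.sum_const, Finset.card_univ, smul_eq_mul, nsmul_eq_mul, mul_one]
  apply ENNReal.inv_mul_cancel
  · simp
  · exact ENNReal.mul_ne_top (ENNReal.natCast_ne_top _) (ENNReal.natCast_ne_top _)

lemma codebookMixture_eq_withDensity (Q : Measure Z) (μ : U → V → Measure Z)
    (k : U → V → Z → ℝ) (hk : ∀ u v, Measurable (k u v)) (hk0 : ∀ u v z, 0 ≤ k u v z)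
    (c : ι → U) (d : κ → V)
    (h : ∀ a b, μ (c a) (d b) = Q.withDensity fun z => ENNReal.ofReal (k (c a) (d b) z))
    [Nonempty ι] [Nonempty κ] :
    codebookMixture μ c d
      = Q.withDensity fun z => ENNReal.ofReal (codebookMean (fun u v => k u v z) c d) := by
  have hκ : (0 : ℝ) < Fintype.card κ := by exact_mod_cast Fintype.card_pos
  have hι : (0 : ℝ) < Fintype.card ι := by exact_mod_cast Fintype.card_pos
  ext s hs
  simp only [codebookMixture, Measure.smul_apply, Measure.finsetSum_apply, h,
    withDensity_apply _ hs, smul_eq_mul]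
  have : ∀ z, ENNReal.ofReal (codebookMean (fun u v => k u v z) c d)
      = ((Fintype.card ι : ℝ≥0∞) * Fintype.card κ)⁻¹ *
        ∑ a, ∑ b, ENNReal.ofReal (k (c a) (d b) z) := by
    intro z
    rw [codebookMean, ENNReal.ofReal_mul (by positivity), ENNReal.ofReal_inv_of_pos (by positivity),
      ENNReal.ofReal_mul hι.le, ENNReal.ofReal_natCast, ENNReal.ofReal_natCast,
      ENNReal.ofReal_sum_of_nonneg fun a _ => Finset.sum_nonneg fun b _ => hk0 _ _ _]
    congr 1
    exact Finset.sum_congr rfl fun a _ => ENNReal.ofReal_sum_of_nonneg fun b _ => hk0 _ _ _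
  simp_rw [this]
  have hm : ∀ a b, Measurable fun z => ENNReal.ofReal (k (c a) (d b) z) :=
    fun a b => (hk _ _).ennreal_ofReal
  rw [lintegral_const_mul _ (Finset.measurable_fun_sum _ fun a _ =>
      Finset.measurable_fun_sum _ fun b _ => hm a b),
    lintegral_finsetSum _ fun a _ => Finset.measurable_fun_sum _ fun b _ => hm a b]
  congr 1
  exact Finset.sum_congr rfl fun a _ => (lintegral_finsetSum _ fun b _ => hm a b).symm

lemma ae_measure_singleton_ne_zero (p : Measure U) : ∀ᵐ u ∂p, p {u} ≠ 0 := by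
  rw [ae_iff]
  simp only [not_not]
  rw [← Set.biUnion_of_singleton {u | p {u} = 0}]
  exact (measure_biUnion_null_iff (Set.to_countable _)).2 fun u hu => hu

lemma integral_le_mul_integral {p p₀ : Measure U} [IsFiniteMeasure p₀] {β : ℝ≥0} (h : p ≤ β • p₀)
    {F : U → ℝ} (hF : ∀ u, 0 ≤ F u) : ∫ u, F u ∂p ≤ β * ∫ u, F u ∂p₀ := by
  refine (integral_mono_measure h (ae_of_all _ hF) Integrable.of_finite).trans ?_
  rw [integral_smul_nnreal_measure]
  rfl

end ResolvabilityMeasure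

section ResolvabilityBound

variable {U V : Type*} [Finite U] [MeasurableSpace U] [MeasurableSingletonClass U]
  [Finite V] [MeasurableSpace V] [MeasurableSingletonClass V]

/-- The Rényi-type sum that controls the resolution of the channel density `k` by codebooks of
sizes `A` and `B`. -/
noncomputable def resolvTerm (p : Measure U) (q : Measure V) (k : U → V → ℝ) (A B s : ℝ) : ℝ :=
  ∫ u, ∫ v, k u v * ((k u v / (A * B)) ^ s + ((∫ v', k u v' ∂q) / A) ^ s
    + ((∫ u', k u' v ∂p) / B) ^ s) ∂q ∂p

lemma integral_mul_log_localMean_le {ι κ : Type*} [Fintype ι] [Fintype κ] [Nonempty ι] [Nonempty κ]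
    {p p₀ : Measure U} [IsProbabilityMeasure p] [IsProbabilityMeasure p₀] {q q₀ : Measure V}
    [IsProbabilityMeasure q] [IsProbabilityMeasure q₀] {β : ℝ≥0} (hβ : 1 ≤ β)
    (hp : p ≤ β • p₀) (hq : q ≤ β • q₀) {d k : U → V → ℝ} (hd : ∀ u v, 0 ≤ d u v)
    (hdk : ∀ u v, d u v ≤ β * k u v) (hk1 : ∫ u, ∫ v, k u v ∂q₀ ∂p₀ ≤ 1) {s : ℝ} (hs : 0 < s)
    (hs1 : s ≤ 1) :
    ∫ u, ∫ v, d u v * Real.log (localMean ι κ p q d u v) ∂q ∂p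
      ≤ 3 * Real.log β * ∫ u, ∫ v, d u v ∂q ∂p
        + β ^ 3 / s * resolvTerm p₀ q₀ k (Fintype.card ι) (Fintype.card κ) s := by
  have hκ : (0 : ℝ) < Fintype.card κ := by exact_mod_cast Fintype.card_pos
  have hι : (0 : ℝ) < Fintype.card ι := by exact_mod_cast Fintype.card_pos
  set A : ℝ := (Fintype.card ι : ℝ)
  set B : ℝ := (Fintype.card κ : ℝ)
  have hβ1 : (1 : ℝ) ≤ β := by exact_mod_cast hβ
  have hβ0 : (0 : ℝ) < β := by linarith
  have hk : ∀ u v, 0 ≤ k u v := fun u v => by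
    have := (hd u v).trans (hdk u v)
    exact nonneg_of_mul_nonneg_right this hβ0
  have hIu : ∀ (P : Measure U) [IsProbabilityMeasure P] (F : U → ℝ), Integrable F P :=
    fun P _ F => Integrable.of_finite
  have hJv : ∀ (P : Measure V) [IsProbabilityMeasure P] (F : V → ℝ), Integrable F P :=
    fun P _ F => Integrable.of_finite
  have k1 : ∀ u, 0 ≤ ∫ v', k u v' ∂q₀ := fun u => integral_nonneg (hk u)
  have k2 : ∀ v, 0 ≤ ∫ u', k u' v ∂p₀ := fun v => integral_nonneg fun u => hk u v
  have b1 : ∀ u, ∫ v', d u v' ∂q ≤ β ^ 2 * ∫ v', k u v' ∂q₀ := by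
    intro u
    refine (integral_le_mul_integral hq (hd u)).trans ?_
    have : ∫ v', d u v' ∂q₀ ≤ β * ∫ v', k u v' ∂q₀ := by
      rw [← integral_const_mul]
      exact integral_mono (hJv _ _) (hJv _ _) (hdk u)
    nlinarith
  have b2 : ∀ v, ∫ u', d u' v ∂p ≤ β ^ 2 * ∫ u', k u' v ∂p₀ := by
    intro v
    refine (integral_le_mul_integral hp fun u => hd u v).trans ?_
    have : ∫ u', d u' v ∂p₀ ≤ β * ∫ u', k u' v ∂p₀ := by
      rw [← integral_const_mul]
      exact integral_mono (hIu _ _) (hIu _ _) fun u => hdk u v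
    nlinarith
  have b0 : ∫ u', ∫ v', d u' v' ∂q ∂p ≤ β ^ 3 := by
    have h1 : ∫ u', ∫ v', d u' v' ∂q ∂p ≤ ∫ u', β ^ 2 * ∫ v', k u' v' ∂q₀ ∂p :=
      integral_mono (hIu _ _) (hIu _ _) b1
    have h2 := integral_le_mul_integral hp (F := fun u' => (β : ℝ) ^ 2 * ∫ v', k u' v' ∂q₀)
      (fun u => by have := k1 u; positivity)
    have h3 : (β : ℝ) * (β ^ 2 * ∫ u, ∫ v, k u v ∂q₀ ∂p₀) ≤ β * (β ^ 2 * 1) := by gcongr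
    rw [integral_const_mul (μ := p₀)] at h2
    refine h1.trans (h2.trans (h3.trans (le_of_eq (by ring))))
  have hpt : ∀ u v, d u v * Real.log (localMean ι κ p q d u v) ≤ 3 * Real.log β * d u v
      + β / s * (k u v * ((k u v / (A * B)) ^ s + ((∫ v', k u v' ∂q₀) / A) ^ s
        + ((∫ u', k u' v ∂p₀) / B) ^ s)) := by
    intro u v
    have hk1u := k1 u
    have hk2v := k2 v
    have hkuv := hk u v
    set S := (k u v / (A * B)) ^ s + ((∫ v', k u v' ∂q₀) / A) ^ s + ((∫ u', k u' v ∂p₀) / B) ^ s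
      with hS
    have hS0 : 0 ≤ S := by positivity
    rcases (hd u v).eq_or_lt with h0 | h0
    · rw [← h0]
      simp only [zero_mul, mul_zero, zero_add]
      positivity
    have hle : localMean ι κ p q d u v ≤ β ^ 3 * (1 + k u v / (A * B)
        + (∫ v', k u v' ∂q₀) / A + (∫ u', k u' v ∂p₀) / B) := by
      have c1 : (A * B)⁻¹ * d u v ≤ β ^ 3 * (k u v / (A * B)) := by
        rw [div_eq_inv_mul, mul_left_comm]
        gcongr
        refine (hdk u v).trans ?_
        gcongr
        exact le_self_pow₀ hβ1 (by norm_num)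
      have hβ23 : (β : ℝ) ^ 2 ≤ β ^ 3 := pow_le_pow_right₀ hβ1 (by norm_num)
      have c2 : A⁻¹ * ∫ v', d u v' ∂q ≤ β ^ 3 * ((∫ v', k u v' ∂q₀) / A) := by
        rw [div_eq_inv_mul, mul_left_comm]
        gcongr
        exact (b1 u).trans (by gcongr)
      have c3 : B⁻¹ * ∫ u', d u' v ∂p ≤ β ^ 3 * ((∫ u', k u' v ∂p₀) / B) := by
        rw [div_eq_inv_mul, mul_left_comm]
        gcongr
        exact (b2 v).trans (by gcongr)
      simp only [localMean]
      linarith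
    have hpos : 0 < localMean ι κ p q d u v := by
      have h1 : 0 ≤ ∫ v', d u v' ∂q := integral_nonneg (hd u)
      have h2 : 0 ≤ ∫ u', d u' v ∂p := integral_nonneg fun u' => hd u' v
      have h3 : 0 ≤ ∫ u', ∫ v', d u' v' ∂q ∂p :=
        integral_nonneg fun u' => integral_nonneg (hd u')
      simp only [localMean]
      have : 0 < (A * B)⁻¹ * d u v := by positivity
      have h4 : 0 ≤ A⁻¹ * ∫ v', d u v' ∂q := by positivity
      have h5 : 0 ≤ B⁻¹ * ∫ u', d u' v ∂p := by positivity
      linarith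
    have hlog : Real.log (localMean ι κ p q d u v) ≤ 3 * Real.log β + S / s := by
      refine (Real.log_le_log hpos hle).trans ?_
      rw [Real.log_mul (by positivity) (by positivity), Real.log_pow]
      have := log_one_add_three_le (x := k u v / (A * B)) (y := (∫ v', k u v' ∂q₀) / A)
        (w := (∫ u', k u' v ∂p₀) / B) (by positivity) (by positivity) (by positivity) hs hs1
      push_cast
      linarith
    calc d u v * Real.log (localMean ι κ p q d u v) ≤ d u v * (3 * Real.log β + S / s) := by gcongr
      _ = 3 * Real.log β * d u v + d u v * (S / s) := by ring
      _ ≤ 3 * Real.log β * d u v + β * k u v * (S / s) := by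
        gcongr
        exact hdk u v
      _ = _ := by ring
  set T : U → V → ℝ := fun u v => k u v * ((k u v / (A * B)) ^ s + ((∫ v', k u v' ∂q₀) / A) ^ s
        + ((∫ u', k u' v ∂p₀) / B) ^ s) with hT
  have hT0 : ∀ u v, 0 ≤ T u v := fun u v => by
    have hk1u := k1 u
    have hk2v := k2 v
    have hkuv := hk u v
    simp only [hT]
    positivity
  have h1 : ∫ u, ∫ v, d u v * Real.log (localMean ι κ p q d u v) ∂q ∂p
      ≤ ∫ u, ∫ v, (3 * Real.log β * d u v + β / s * T u v) ∂q ∂p :=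
    integral_mono (hIu _ _) (hIu _ _) fun u => integral_mono (hJv _ _) (hJv _ _) (hpt u)
  refine h1.trans ?_
  have e1 : ∫ u, ∫ v, (3 * Real.log β * d u v + β / s * T u v) ∂q ∂p
      = 3 * Real.log β * ∫ u, ∫ v, d u v ∂q ∂p + β / s * ∫ u, ∫ v, T u v ∂q ∂p := by
    have : ∀ u, ∫ v, (3 * Real.log β * d u v + β / s * T u v) ∂q
      = 3 * Real.log β * ∫ v, d u v ∂q + β / s * ∫ v, T u v ∂q := fun u => by
      rw [integral_add (hJv _ _) (hJv _ _), integral_const_mul, integral_const_mul]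
    simp_rw [this]
    rw [integral_add (hIu _ _) (hIu _ _), integral_const_mul, integral_const_mul]
  rw [e1]
  have h2 : ∫ u, ∫ v, T u v ∂q ∂p ≤ β ^ 2 * ∫ u, ∫ v, T u v ∂q₀ ∂p₀ := by
    have h3 : ∫ u, ∫ v, T u v ∂q ∂p ≤ ∫ u, β * ∫ v, T u v ∂q₀ ∂p :=
      integral_mono (hIu _ _) (hIu _ _) fun u => integral_le_mul_integral hq (hT0 u)
    refine h3.trans ?_
    refine (integral_le_mul_integral hp fun u => ?_).trans ?_
    · have : 0 ≤ ∫ v, T u v ∂q₀ := integral_nonneg (hT0 u)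
      positivity
    · rw [integral_const_mul]
      exact le_of_eq (by ring)
  have h4 : β / s * ∫ u, ∫ v, T u v ∂q ∂p ≤ β ^ 3 / s * ∫ u, ∫ v, T u v ∂q₀ ∂p₀ := by
    calc β / s * ∫ u, ∫ v, T u v ∂q ∂p ≤ β / s * (β ^ 2 * ∫ u, ∫ v, T u v ∂q₀ ∂p₀) := by gcongr
      _ = _ := by ring
  have h5 : resolvTerm p₀ q₀ k A B s = ∫ u, ∫ v, T u v ∂q₀ ∂p₀ := rfl
  rw [h5]
  linarith

end ResolvabilityBound

section ResolvabilityTheorem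

open InformationTheory

variable {U V ι κ Z : Type*} [Finite U] [MeasurableSpace U] [MeasurableSingletonClass U]
  [Finite V] [MeasurableSpace V] [MeasurableSingletonClass V] [Fintype ι] [Fintype κ]
  [MeasurableSpace Z]

/-- Soft covering by two independent random codebooks. The codeword laws `p`, `q` and the channel
`μ` need only be dominated, up to the factor `β`, by the laws `p₀`, `q₀` and the channel with
density `k` with respect to `Q`. -/
theorem lintegral_klDiv_codebookMixture_le [Nonempty ι] [Nonempty κ]
    {p p₀ : Measure U} [IsProbabilityMeasure p] [IsProbabilityMeasure p₀] {q q₀ : Measure V}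
    [IsProbabilityMeasure q] [IsProbabilityMeasure q₀] {β : ℝ≥0} (hβ : 1 ≤ β)
    (hp : p ≤ β • p₀) (hq : q ≤ β • q₀) (Q : Measure Z) [IsProbabilityMeasure Q]
    (μ : U → V → Measure Z) [∀ u v, IsProbabilityMeasure (μ u v)] {k : U → V → Z → ℝ}
    (hk : ∀ u v, Measurable (k u v)) (hk0 : ∀ u v z, 0 ≤ k u v z)
    (hμ : ∀ u v, p {u} ≠ 0 → q {v} ≠ 0 →
      μ u v ≤ β • Q.withDensity fun z => ENNReal.ofReal (k u v z))
    (hk1 : ∀ᵐ z ∂Q, ∫ u, ∫ v, k u v z ∂q₀ ∂p₀ ≤ 1) {s : ℝ} (hs : 0 < s) (hs1 : s ≤ 1) :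
    ∫⁻ c, ∫⁻ d, klDiv (codebookMixture μ c d) Q ∂(Measure.pi fun _ : κ => q)
        ∂(Measure.pi fun _ : ι => p)
      ≤ ENNReal.ofReal (3 * Real.log β) + ENNReal.ofReal (β ^ 3 / s) *
        ∫⁻ z, ENNReal.ofReal (resolvTerm p₀ q₀ (fun u v => k u v z) (Fintype.card ι)
          (Fintype.card κ) s) ∂Q := by
  classical
  have hβ1 : (1 : ℝ) ≤ β := by exact_mod_cast hβ
  have hβ0 : (0 : ℝ) < β := by linarith
  set f : U → V → Z → ℝ := fun u v z =>
    if p {u} = 0 ∨ q {v} = 0 then 0 else ((μ u v).rnDeriv Q z).toReal with hf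
  have hf0 : ∀ u v z, 0 ≤ f u v z := by
    intro u v z
    simp only [hf]
    split_ifs <;> simp
  have hfm : ∀ u v, Measurable (f u v) := by
    intro u v
    simp only [hf]
    split_ifs
    · exact measurable_const
    · exact (Measure.measurable_rnDeriv _ _).ennreal_toReal
  have hfμ : ∀ u v, p {u} ≠ 0 → q {v} ≠ 0 →
      μ u v = Q.withDensity fun z => ENNReal.ofReal (f u v z) := by
    intro u v hu hv
    have hac : μ u v ≪ Q := (Measure.absolutelyContinuous_of_le_smul (c := β) (hμ u v hu hv)).trans
      (withDensity_absolutelyContinuous _ _)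
    conv_lhs => rw [← Measure.withDensity_rnDeriv_eq _ _ hac]
    refine withDensity_congr_ae ?_
    filter_upwards [Measure.rnDeriv_ne_top (μ u v) Q] with z hz
    simp [hf, hu, hv, ENNReal.ofReal_toReal hz]
  have hfk : ∀ᵐ z ∂Q, ∀ u v, f u v z ≤ β * k u v z := by
    rw [ae_all_iff]; intro u
    rw [ae_all_iff]; intro v
    by_cases h : p {u} = 0 ∨ q {v} = 0
    · refine ae_of_all _ fun z => ?_
      simp only [hf, h, if_true]
      exact mul_nonneg hβ0.le (hk0 u v z)
    · push Not at h
      have h1 : (fun z => ENNReal.ofReal (f u v z)) ≤ᵐ[Q]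
          fun z => β * ENNReal.ofReal (k u v z) := by
        refine ae_le_of_forall_setLIntegral_le_of_sigmaFinite (hfm u v).ennreal_ofReal ?_
        intro S hS _
        rw [← withDensity_apply _ hS, ← hfμ u v h.1 h.2,
          lintegral_const_mul _ (hk u v).ennreal_ofReal, ← withDensity_apply _ hS]
        exact hμ u v h.1 h.2 S
      filter_upwards [h1] with z hz
      rw [← ENNReal.ofReal_coe_nnreal, ← ENNReal.ofReal_mul hβ0.le] at hz
      exact (ENNReal.ofReal_le_ofReal_iff (mul_nonneg hβ0.le (hk0 u v z))).1 hz
  set P := Measure.pi fun _ : ι => p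
  set ρ := Measure.pi fun _ : κ => q
  have hsupp : ∀ᵐ c ∂P, ∀ a, p {c a} ≠ 0 :=
    ae_all_iff.2 fun a => (Measure.tendsto_eval_ae_ae (μ := fun _ : ι => p) (i := a)).eventually
      (ae_measure_singleton_ne_zero p)
  have hsupq : ∀ᵐ d ∂ρ, ∀ b, q {d b} ≠ 0 :=
    ae_all_iff.2 fun a => (Measure.tendsto_eval_ae_ae (μ := fun _ : κ => q) (i := a)).eventually
      (ae_measure_singleton_ne_zero q)
  set F : (ι → U) → (κ → V) → Z → ℝ := fun c d z => codebookMean (fun u v => f u v z) c d with hF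
  have hFm : ∀ c d, Measurable (F c d) := by
    intro c d
    simp only [hF, codebookMean]
    exact (Finset.measurable_fun_sum _ fun a _ => Finset.measurable_fun_sum _
      fun b _ => hfm _ _).const_mul _
  have hF0 : ∀ c d z, 0 ≤ F c d z := fun c d z => mul_nonneg (by positivity)
    (Finset.sum_nonneg fun a _ => Finset.sum_nonneg fun b _ => hf0 _ _ _)
  have hKm : ∀ c d, Measurable fun z => ENNReal.ofReal (klFun (F c d z)) :=
    fun c d => (measurable_klFun.comp (hFm c d)).ennreal_ofReal
  have hI : ∀ (G : (ι → U) → ℝ), Integrable G P := fun G => Integrable.of_finite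
  have hJ : ∀ (G : (κ → V) → ℝ), Integrable G ρ := fun G => Integrable.of_finite
  have step1 : ∫⁻ c, ∫⁻ d, klDiv (codebookMixture μ c d) Q ∂ρ ∂P
      = ∫⁻ c, ∫⁻ d, ∫⁻ z, ENNReal.ofReal (klFun (F c d z)) ∂Q ∂ρ ∂P := by
    refine lintegral_congr_ae ?_
    filter_upwards [hsupp] with c hc
    refine lintegral_congr_ae ?_
    filter_upwards [hsupq] with d hd
    have e := codebookMixture_eq_withDensity Q μ f hfm hf0 c d fun a b => hfμ _ _ (hc a) (hd b)
    have : IsFiniteMeasure (Q.withDensity fun z => ENNReal.ofReal (F c d z)) := by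
      rw [← e]; infer_instance
    rw [e]
    exact klDiv_withDensity_ofReal Q (hFm c d) (hF0 c d)
  have step2 : ∫⁻ c, ∫⁻ d, ∫⁻ z, ENNReal.ofReal (klFun (F c d z)) ∂Q ∂ρ ∂P
      = ∫⁻ z, ENNReal.ofReal (∫ c, ∫ d, klFun (F c d z) ∂ρ ∂P) ∂Q := by
    have e1 : ∀ c, ∫⁻ d, ∫⁻ z, ENNReal.ofReal (klFun (F c d z)) ∂Q ∂ρ
        = ∫⁻ z, ∫⁻ d, ENNReal.ofReal (klFun (F c d z)) ∂ρ ∂Q := fun c =>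
      lintegral_lintegral_swap (measurable_from_prod_countable_right fun d => hKm c d).aemeasurable
    simp_rw [e1]
    rw [lintegral_lintegral_swap]
    · refine lintegral_congr fun z => ?_
      rw [ofReal_integral_eq_lintegral_ofReal (hI _)
        (ae_of_all _ fun c => integral_nonneg fun d => klFun_nonneg (hF0 c d z))]
      refine lintegral_congr fun c => ?_
      rw [ofReal_integral_eq_lintegral_ofReal (hJ _)
        (ae_of_all _ fun d => klFun_nonneg (hF0 c d z))]
    · refine (measurable_from_prod_countable_right fun c => ?_).aemeasurable
      exact Measurable.lintegral_prod_right'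
        (f := fun x : Z × (κ → V) => ENNReal.ofReal (klFun (F c x.2 x.1)))
        (measurable_from_prod_countable_left fun d => hKm c d)
  rw [step1, step2]
  set D : Z → ℝ := fun z => ∫ u, ∫ v, f u v z ∂q ∂p with hD
  have hD0 : ∀ z, 0 ≤ D z := fun z => integral_nonneg fun u => integral_nonneg fun v => hf0 u v z
  have step3 : ∫⁻ z, ENNReal.ofReal (D z) ∂Q = 1 := by
    have e1 : ∀ z, ENNReal.ofReal (D z) = ∫⁻ u, ∫⁻ v, ENNReal.ofReal (f u v z) ∂q ∂p := by
      intro z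
      rw [ofReal_integral_eq_lintegral_ofReal Integrable.of_finite
        (ae_of_all _ fun u => integral_nonneg fun v => hf0 u v z)]
      refine lintegral_congr fun u => ?_
      rw [ofReal_integral_eq_lintegral_ofReal Integrable.of_finite
        (ae_of_all _ fun v => hf0 u v z)]
    simp_rw [e1]
    rw [lintegral_lintegral_swap]
    · have e2 : ∀ᵐ u ∂p, ∫⁻ z, ∫⁻ v, ENNReal.ofReal (f u v z) ∂q ∂Q = 1 := by
        filter_upwards [ae_measure_singleton_ne_zero p] with u hu
        rw [lintegral_lintegral_swap (measurable_from_prod_countable_left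
          fun v => (hfm u v).ennreal_ofReal).aemeasurable]
        have e3 : ∀ᵐ v ∂q, ∫⁻ z, ENNReal.ofReal (f u v z) ∂Q = 1 := by
          filter_upwards [ae_measure_singleton_ne_zero q] with v hv
          have := congrArg (fun m => m Set.univ) (hfμ u v hu hv)
          simp only [measure_univ, withDensity_apply _ MeasurableSet.univ,
            Measure.restrict_univ] at this
          exact this.symm
        rw [lintegral_congr_ae e3]
        simp
      rw [lintegral_congr_ae e2]
      simp
    · refine (measurable_from_prod_countable_left fun u => ?_).aemeasurable
      exact Measurable.lintegral_prod_right'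
        (f := fun x : Z × V => ENNReal.ofReal (f u x.2 x.1))
        (measurable_from_prod_countable_left fun v => (hfm u v).ennreal_ofReal)
  have hlogβ : 0 ≤ 3 * Real.log β := by have := Real.log_nonneg hβ1; positivity
  have key : ∀ᵐ z ∂Q, ENNReal.ofReal (∫ c, ∫ d, klFun (F c d z) ∂ρ ∂P) + ENNReal.ofReal (D z)
      ≤ 1 + ENNReal.ofReal (3 * Real.log β) * ENNReal.ofReal (D z)
        + ENNReal.ofReal (β ^ 3 / s) * ENNReal.ofReal (resolvTerm p₀ q₀ (fun u v => k u v z)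
          (Fintype.card ι) (Fintype.card κ) s) := by
    filter_upwards [hfk, hk1] with z hz hz1
    have r0 : 0 ≤ resolvTerm p₀ q₀ (fun u v => k u v z) (Fintype.card ι) (Fintype.card κ) s := by
      refine integral_nonneg fun u => integral_nonneg fun v => mul_nonneg (hk0 u v z) ?_
      have a1 : 0 ≤ ∫ v', k u v' z ∂q₀ := integral_nonneg fun v => hk0 u v z
      have a2 : 0 ≤ ∫ u', k u' v z ∂p₀ := integral_nonneg fun u => hk0 u v z
      have a3 := hk0 u v z
      dsimp only
      positivity
    rw [← ENNReal.ofReal_add (integral_nonneg fun c => integral_nonneg fun d =>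
      klFun_nonneg (hF0 c d z)) (hD0 z), ← ENNReal.ofReal_mul hlogβ,
      ← ENNReal.ofReal_mul (by positivity), ← ENNReal.ofReal_one,
      ← ENNReal.ofReal_add zero_le_one (mul_nonneg hlogβ (hD0 z)),
      ← ENNReal.ofReal_add (add_nonneg zero_le_one (mul_nonneg hlogβ (hD0 z))) (by positivity)]
    refine ENNReal.ofReal_le_ofReal ?_
    have h1 := integral_mul_log_localMean_le (ι := ι) (κ := κ) hβ hp hq
      (fun u v => hf0 u v z) hz hz1 hs hs1
    have h2 := integral_codebookMean_mul_log_le (ι := ι) (κ := κ) (p := p) (q := q)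
      (fun u v => f u v z) (fun u v => hf0 u v z)
    have h3 := integral_codebookMean (ι := ι) (κ := κ) (p := p) (q := q) (fun u v => f u v z)
    have e : ∫ c, ∫ d, klFun (F c d z) ∂ρ ∂P
        = ∫ c, ∫ d, F c d z * Real.log (F c d z) ∂ρ ∂P + 1 - ∫ c, ∫ d, F c d z ∂ρ ∂P := by
      have e0 : ∀ c, ∫ d, klFun (F c d z) ∂ρ
          = ∫ d, F c d z * Real.log (F c d z) ∂ρ + 1 - ∫ d, F c d z ∂ρ := by
        intro c
        simp only [klFun_apply]
        rw [integral_sub (hJ _) (hJ _), integral_add (hJ _) (hJ _)]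
        simp
      simp_rw [e0]
      rw [integral_sub (hI _) (hI _), integral_add (hI _) (hI _)]
      simp
    have e' : ∫ c, ∫ d, F c d z ∂ρ ∂P = D z := h3
    rw [e, e']
    have h4 : ∫ c, ∫ d, F c d z * Real.log (F c d z) ∂ρ ∂P ≤ _ := h2.trans h1
    have h5 : ∫ u, ∫ v, f u v z ∂q ∂p = D z := rfl
    rw [h5] at h4
    linarith
  have hDm : Measurable fun z => ENNReal.ofReal (D z) := by
    refine Measurable.ennreal_ofReal ?_
    simp only [hD]
    have := Fintype.ofFinite U
    have := Fintype.ofFinite V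
    simp_rw [integral_fintype (μ := q) Integrable.of_finite,
      integral_fintype (μ := p) Integrable.of_finite, smul_eq_mul]
    exact Finset.measurable_fun_sum _ fun u _ =>
      (Finset.measurable_fun_sum _ fun v _ => (hfm u v).const_mul _).const_mul _
  have h1 := lintegral_mono_ae key
  rw [lintegral_add_right _ hDm, step3, lintegral_add_left (by fun_prop),
    lintegral_add_left measurable_const, lintegral_const_mul _ hDm, step3,
    lintegral_const_mul' _ _ ENNReal.ofReal_ne_top] at h1
  simp only [lintegral_const, measure_univ, mul_one] at h1
  rw [add_assoc 1, add_comm 1] at h1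
  exact (ENNReal.add_le_add_iff_right ENNReal.one_ne_top).1 h1

end ResolvabilityTheorem

section MutualInfoBounds

open InformationTheory

variable {Ω A B : Type*} [MeasurableSpace Ω] [MeasurableSpace A] [MeasurableSpace B]

lemma klDiv_map_measurableEquiv (μ ν : Measure A) [IsFiniteMeasure μ] [IsFiniteMeasure ν]
    (e : A ≃ᵐ B) : klDiv (μ.map e) (ν.map e) = klDiv μ ν := by
  refine le_antisymm (klDiv_map_le μ ν e.measurable) ?_
  have := klDiv_map_le (μ.map e) (ν.map e) e.symm.measurable
  simpa [Measure.map_map e.symm.measurable e.measurable] using this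

lemma klDiv_prod_marginal_le [StandardBorelSpace A] [Nonempty A] (J : Measure (A × B))
    [IsProbabilityMeasure J] (Q : Measure B) [IsProbabilityMeasure Q] :
    klDiv J (J.fst.prod J.snd) ≤ klDiv J (J.fst.prod Q) := by
  rw [← klDiv_map_measurableEquiv J (J.fst.prod J.snd) MeasurableEquiv.prodComm,
    ← klDiv_map_measurableEquiv J (J.fst.prod Q) MeasurableEquiv.prodComm]
  have e1 : ∀ ν : Measure B, SFinite ν →
      (J.fst.prod ν).map MeasurableEquiv.prodComm = ν ⊗ₘ Kernel.const B J.fst := by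
    intro ν _
    rw [Measure.compProd_const]
    exact Measure.prod_swap
  rw [e1 _ inferInstance, e1 _ inferInstance]
  set J' := J.map MeasurableEquiv.prodComm with hJ'
  have : IsProbabilityMeasure J' :=
    Measure.isProbabilityMeasure_map MeasurableEquiv.prodComm.measurable.aemeasurable
  have e2 : J' = J.snd ⊗ₘ J'.condKernel := by
    have h : J'.fst = J.snd := by
      simp only [hJ', Measure.fst, Measure.snd]
      rw [Measure.map_map measurable_fst MeasurableEquiv.prodComm.measurable]
      rfl
    rw [← h]
    exact (J'.disintegrate J'.condKernel).symm
  rw [e2, klDiv_compProd_eq_add J.snd Q]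
  exact le_add_self

lemma mutualInfo_le_klDiv [StandardBorelSpace A] [Nonempty A] {f : Ω → A} {h : Ω → B}
    (hf : Measurable f) (hh : Measurable h) (μ : Measure Ω) [IsProbabilityMeasure μ]
    (Q : Measure B) [IsProbabilityMeasure Q] :
    mutualInfo f h μ ≤ klDiv (μ.map fun ω => (f ω, h ω)) ((μ.map f).prod Q) := by
  have : IsProbabilityMeasure (μ.map fun ω => (f ω, h ω)) :=
    Measure.isProbabilityMeasure_map (hf.prodMk hh).aemeasurable
  have := klDiv_prod_marginal_le (μ.map fun ω => (f ω, h ω)) Q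
  rwa [Measure.fst_map_prodMk hh, Measure.snd_map_prodMk hf] at this

lemma klDiv_compProd_prod_le [Finite A] [MeasurableSingletonClass A] (ν : Measure A)
    [IsProbabilityMeasure ν] (K : Kernel A B) [IsMarkovKernel K] (Q : Measure B)
    [IsProbabilityMeasure Q] :
    klDiv (ν ⊗ₘ K) (ν.prod Q) ≤ ∫⁻ a, klDiv (K a) Q ∂ν := by
  by_cases htop : ∫⁻ a, klDiv (K a) Q ∂ν = ∞
  · rw [htop]; exact le_top
  have hfin : ∀ᵐ a ∂ν, klDiv (K a) Q < ∞ :=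
    ae_lt_top (measurable_of_finite _) htop
  have hac : ∀ᵐ a ∂ν, K a ≪ Q := by
    filter_upwards [hfin] with a ha
    exact (klDiv_ne_top_iff.1 ha.ne).1
  set g : A × B → ℝ := fun x => ((K x.1).rnDeriv Q x.2).toReal with hg
  have hgm : Measurable g := measurable_from_prod_countable_right fun a =>
    (Measure.measurable_rnDeriv (K a) Q).ennreal_toReal
  have e : ν ⊗ₘ K = (ν.prod Q).withDensity fun x => ENNReal.ofReal (g x) := by
    ext s hs
    rw [Measure.compProd_apply hs, withDensity_apply _ hs, ← lintegral_indicator hs,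
      lintegral_prod _ ((hgm.ennreal_ofReal.indicator hs).aemeasurable)]
    refine lintegral_congr_ae ?_
    filter_upwards [hac] with a ha
    have hs' : MeasurableSet (Prod.mk a ⁻¹' s) := measurable_prodMk_left hs
    conv_lhs => rw [← Measure.withDensity_rnDeriv_eq _ _ ha, withDensity_apply _ hs',
      ← lintegral_indicator hs']
    refine lintegral_congr_ae ?_
    filter_upwards [Measure.rnDeriv_ne_top (K a) Q] with b hb
    by_cases h : (a, b) ∈ s
    · have h' : b ∈ Prod.mk a ⁻¹' s := h
      rw [Set.indicator_of_mem h, Set.indicator_of_mem h']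
      simp [hg, ENNReal.ofReal_toReal hb]
    · have h' : b ∉ Prod.mk a ⁻¹' s := h
      rw [Set.indicator_of_notMem h, Set.indicator_of_notMem h']
  have : IsFiniteMeasure ((ν.prod Q).withDensity fun x => ENNReal.ofReal (g x)) := by
    rw [← e]; infer_instance
  rw [e, klDiv_withDensity_ofReal _ hgm fun _ => ENNReal.toReal_nonneg,
    lintegral_prod (fun x => ENNReal.ofReal (klFun (g x)))
      (measurable_klFun.comp hgm).ennreal_ofReal.aemeasurable]
  refine lintegral_mono_ae ?_
  filter_upwards [hac] with a ha
  rw [klDiv_eq_lintegral_klFun_of_ac ha]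

end MutualInfoBounds

section Domination

variable {U V ι κ : Type*} [Finite U] [MeasurableSpace U] [MeasurableSingletonClass U]
  [Finite V] [MeasurableSpace V] [MeasurableSingletonClass V] [Fintype ι] [Fintype κ]

lemma lintegral_le_mul_lintegral {A : Type*} [MeasurableSpace A] {p p₀ : Measure A} {β : ℝ≥0}
    (h : p ≤ β • p₀) (F : A → ℝ≥0∞) : ∫⁻ u, F u ∂p ≤ β * ∫⁻ u, F u ∂p₀ := by
  refine (lintegral_mono' h le_rfl).trans (le_of_eq ?_)
  exact lintegral_smul_measure (β : ℝ≥0∞) F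

lemma lintegral_lintegral_le_mul {p p₀ : Measure U} {q q₀ : Measure V} {β : ℝ≥0}
    (hp : p ≤ β • p₀) (hq : q ≤ β • q₀) {G H : U → V → ℝ≥0∞} {C : ℝ≥0∞}
    (hG : ∀ u v, p {u} ≠ 0 → q {v} ≠ 0 → G u v ≤ C * H u v) :
    ∫⁻ u, ∫⁻ v, G u v ∂q ∂p ≤ β ^ 2 * C * ∫⁻ u, ∫⁻ v, H u v ∂q₀ ∂p₀ := by
  have h1 : ∀ᵐ u ∂p, ∫⁻ v, G u v ∂q ≤ β * C * ∫⁻ v, H u v ∂q₀ := by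
    filter_upwards [ae_measure_singleton_ne_zero p] with u hu
    have : ∫⁻ v, G u v ∂q ≤ ∫⁻ v, C * H u v ∂q := by
      refine lintegral_mono_ae ?_
      filter_upwards [ae_measure_singleton_ne_zero q] with v hv
      exact hG u v hu hv
    refine this.trans ?_
    rw [lintegral_const_mul _ (measurable_of_finite _), mul_comm (β : ℝ≥0∞) C, mul_assoc]
    gcongr
    exact lintegral_le_mul_lintegral hq _
  refine (lintegral_mono_ae h1).trans ?_
  rw [lintegral_const_mul _ (measurable_of_finite _)]
  calc _ ≤ β * C * (β * ∫⁻ u, ∫⁻ v, H u v ∂q₀ ∂p₀) := by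
        gcongr
        exact lintegral_le_mul_lintegral hp _
    _ = _ := by ring

end Domination

section Decoder

open Classical in
/-- The threshold decoder: outputs the message part of the unique index `i` with `ξ ∈ S (c i)`. -/
noncomputable def thresholdDecoder {U Ξ M L : Type*} [Nonempty M] (S : U → Set Ξ)
    (c : M × L → U) (ξ : Ξ) : M :=
  if h : ∃ i, ξ ∈ S (c i) ∧ ∀ j, j ≠ i → ξ ∉ S (c j) then h.choose.1 else Classical.arbitrary M

variable {U V Ξ M L κ : Type*} [Nonempty M]

lemma thresholdDecoder_eq {S : U → Set Ξ} {c : M × L → U} {ξ : Ξ} {i : M × L}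
    (hi : ξ ∈ S (c i)) (hj : ∀ j, j ≠ i → ξ ∉ S (c j)) : thresholdDecoder S c ξ = i.1 := by
  have h : ∃ i, ξ ∈ S (c i) ∧ ∀ j, j ≠ i → ξ ∉ S (c j) := ⟨i, hi, hj⟩
  rw [thresholdDecoder, dif_pos h]
  have h2 := h.choose_spec
  by_contra hne
  have : h.choose ≠ i := fun e => hne (by rw [e])
  exact hj _ this h2.1

lemma measurable_thresholdDecoder [MeasurableSpace Ξ] [Finite M] [Finite L] [MeasurableSpace M]
    {S : U → Set Ξ} (hS : ∀ u, MeasurableSet (S u)) (c : M × L → U) :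
    Measurable (thresholdDecoder S c) := by
  classical
  have h : thresholdDecoder S c = (fun b : M × L → Prop =>
      if h : ∃ i, b i ∧ ∀ j, j ≠ i → ¬ b j then h.choose.1 else Classical.arbitrary M) ∘
      fun ξ i => ξ ∈ S (c i) := rfl
  rw [h]
  exact (measurable_of_finite _).comp (measurable_pi_lambda _ fun i =>
    measurableSet_setOfPred.1 (hS (c i)))

lemma lintegral_decoding_error_le [Finite U] [MeasurableSpace U] [MeasurableSingletonClass U]
    [Finite V] [MeasurableSpace V] [MeasurableSingletonClass V] [Fintype M] [Fintype L] [Fintype κ]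
    {Ω : Type*} [MeasurableSpace Ω] {p p₀ : Measure U} [IsProbabilityMeasure p]
    {q q₀ : Measure V} [IsProbabilityMeasure q] {β : ℝ≥0}
    (hp : p ≤ β • p₀) (hq : q ≤ β • q₀) {T T₀ : U → V → Measure Ω}
    (hT : ∀ u v, p {u} ≠ 0 → q {v} ≠ 0 → T u v ≤ (β ^ 2) • T₀ u v) (ξ : Ω → Ξ)
    {S : U → Set Ξ} (i : M × L) (j : κ) :
    ∫⁻ c, ∫⁻ d, T (c i) (d j) {ω | thresholdDecoder S c (ξ ω) ≠ i.1}
        ∂(Measure.pi fun _ : κ => q) ∂(Measure.pi fun _ : M × L => p)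
      ≤ β ^ 4 * (∫⁻ u, ∫⁻ v, T₀ u v {ω | ξ ω ∉ S u} ∂q₀ ∂p₀)
        + (Fintype.card M * Fintype.card L : ℝ≥0∞) *
          (β ^ 5 * ∫⁻ u', ∫⁻ u, ∫⁻ v, T₀ u v {ω | ξ ω ∈ S u'} ∂q₀ ∂p₀ ∂p₀) := by
  classical
  have hTs : ∀ u v, p {u} ≠ 0 → q {v} ≠ 0 → ∀ s, T u v s ≤ (β ^ 2 : ℝ≥0∞) * T₀ u v s := by
    intro u v hu hv s
    refine (hT u v hu hv s).trans (le_of_eq ?_)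
    rw [Measure.smul_apply]
    change ((β ^ 2 : ℝ≥0) : ℝ≥0∞) * _ = _
    push_cast
    rfl
  have hsub : ∀ (c : M × L → U) (d : κ → V), T (c i) (d j)
      {ω | thresholdDecoder S c (ξ ω) ≠ i.1} ≤ T (c i) (d j) {ω | ξ ω ∉ S (c i)}
        + ∑ i' ∈ Finset.univ.erase i, T (c i) (d j) {ω | ξ ω ∈ S (c i')} := by
    intro c d
    have : {ω | thresholdDecoder S c (ξ ω) ≠ i.1} ⊆ {ω | ξ ω ∉ S (c i)} ∪
        ⋃ i' ∈ Finset.univ.erase i, {ω | ξ ω ∈ S (c i')} := by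
      intro ω hω
      by_contra hn
      simp only [Set.mem_union, Set.mem_ofPred_eq, Set.mem_iUnion, not_or, not_not, not_exists] at hn
      exact hω (thresholdDecoder_eq hn.1 fun j hj => hn.2 j (by simp [hj]))
    refine (measure_mono this).trans ((measure_union_le _ _).trans ?_)
    gcongr
    exact measure_biUnion_finset_le _ _
  refine (lintegral_mono fun c => lintegral_mono fun d => hsub c d).trans ?_
  have hmD : ∀ F : (κ → V) → ℝ≥0∞, Measurable F := fun F => measurable_of_finite F
  have hmC : ∀ F : (M × L → U) → ℝ≥0∞, Measurable F := fun F => measurable_of_finite F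
  simp_rw [lintegral_add_left (hmD _), lintegral_finsetSum _ fun _ _ => hmD _]
  rw [lintegral_add_left (hmC _), lintegral_finsetSum _ fun _ _ => hmC _]
  refine add_le_add ?_ ?_
  · have e1 : ∀ c : M × L → U, ∫⁻ d, T (c i) (d j) {ω | ξ ω ∉ S (c i)}
        ∂(Measure.pi fun _ : κ => q) = ∫⁻ v, T (c i) v {ω | ξ ω ∉ S (c i)} ∂q := fun c =>
      lintegral_pi_eval (fun v => T (c i) v {ω | ξ ω ∉ S (c i)}) j
    simp_rw [e1]
    rw [lintegral_pi_eval (fun u => ∫⁻ v, T u v {ω | ξ ω ∉ S u} ∂q) i]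
    refine (lintegral_lintegral_le_mul hp hq fun u v hu hv => hTs u v hu hv _).trans
      (le_of_eq (by ring))
  · have key : ∀ i' ∈ Finset.univ.erase i, ∫⁻ c, ∫⁻ d, T (c i) (d j) {ω | ξ ω ∈ S (c i')}
        ∂(Measure.pi fun _ : κ => q) ∂(Measure.pi fun _ : M × L => p)
        ≤ β ^ 5 * ∫⁻ u', ∫⁻ u, ∫⁻ v, T₀ u v {ω | ξ ω ∈ S u'} ∂q₀ ∂p₀ ∂p₀ := by
      intro i' hi'
      have e1 : ∀ c : M × L → U, ∫⁻ d, T (c i) (d j) {ω | ξ ω ∈ S (c i')}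
          ∂(Measure.pi fun _ : κ => q) = ∫⁻ v, T (c i) v {ω | ξ ω ∈ S (c i')} ∂q := fun c =>
        lintegral_pi_eval (fun v => T (c i) v {ω | ξ ω ∈ S (c i')}) j
      simp_rw [e1]
      rw [lintegral_pi_eval_pair (p := p)
        (fun u' u => ∫⁻ v, T u v {ω | ξ ω ∈ S u'} ∂q) (Finset.ne_of_mem_erase hi')]
      refine (lintegral_le_mul_lintegral hp _).trans ?_
      have : ∀ u', ∫⁻ u, ∫⁻ v, T u v {ω | ξ ω ∈ S u'} ∂q ∂p
          ≤ β ^ 2 * β ^ 2 * ∫⁻ u, ∫⁻ v, T₀ u v {ω | ξ ω ∈ S u'} ∂q₀ ∂p₀ := fun u' =>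
        lintegral_lintegral_le_mul hp hq fun u v hu hv => hTs u v hu hv _
      refine (mul_le_mul_right (lintegral_mono this) _).trans ?_
      rw [lintegral_const_mul _ (measurable_of_finite _)]
      exact le_of_eq (by ring)
    refine (Finset.sum_le_sum key).trans ?_
    rw [Finset.sum_const, nsmul_eq_mul]
    gcongr
    rw [Finset.card_erase_of_mem (Finset.mem_univ i), Finset.card_univ, Fintype.card_prod]
    exact_mod_cast Nat.sub_le _ _

end Decoder

section CodebookCode

open InformationTheory

variable {X₁ X₂ Y₁ Y₂ Z U V : Type*} [MeasurableSpace X₁] [MeasurableSpace X₂] [MeasurableSpace Y₁]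
  [MeasurableSpace Y₂] [MeasurableSpace Z] {n : ℕ}

lemma lintegral_uniformOn_univ {A : Type*} [Fintype A] [MeasurableSpace A]
    [MeasurableSingletonClass A] (f : A → ℝ≥0∞) :
    ∫⁻ a, f a ∂(uniformOn (Set.univ : Set A)) = (Fintype.card A : ℝ≥0∞)⁻¹ * ∑ a, f a := by
  rw [lintegral_fintype, Finset.mul_sum]
  refine Finset.sum_congr rfl fun a _ => ?_
  rw [uniformOn_univ, Measure.count_singleton, mul_comm, ENNReal.div_eq_inv_mul, mul_one]

instance {A : Type*} [Finite A] [Nonempty A] [MeasurableSpace A] [MeasurableSingletonClass A] :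
    IsProbabilityMeasure (uniformOn (Set.univ : Set A)) :=
  isProbabilityMeasure_uniformOn Set.finite_univ Set.univ_nonempty

lemma inv_mul_sum_const {A : Type*} [Fintype A] [Nonempty A] (a : ℝ≥0∞) :
    (Fintype.card A : ℝ≥0∞)⁻¹ * ∑ _x : A, a = a := by
  rw [Finset.sum_const, Finset.card_univ, nsmul_eq_mul, ← mul_assoc, ENNReal.inv_mul_cancel,
    one_mul]
  · simp
  · exact ENNReal.natCast_ne_top _

/-- The joint law of the input and output blocks for independent input laws. -/
noncomputable def blockLaw (W : Kernel (X₁ × X₂) (Y₁ × Y₂ × Z)) [IsMarkovKernel W]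
    (μ₁ : Measure (Fin n → X₁)) (μ₂ : Measure (Fin n → X₂)) :
    Measure (((Fin n → X₁) × (Fin n → X₂)) × (Fin n → Y₁ × Y₂ × Z)) :=
  (μ₁.prod μ₂) ⊗ₘ ((memoryless W n).comap
    (fun x : (Fin n → X₁) × (Fin n → X₂) => fun k => (x.1 k, x.2 k)) (by fun_prop))

instance (W : Kernel (X₁ × X₂) (Y₁ × Y₂ × Z)) [IsMarkovKernel W]
    (μ₁ : Measure (Fin n → X₁)) (μ₂ : Measure (Fin n → X₂)) [IsProbabilityMeasure μ₁]
    [IsProbabilityMeasure μ₂] : IsProbabilityMeasure (blockLaw W μ₁ μ₂) := by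
  unfold blockLaw; infer_instance

lemma lintegral_blockLaw (W : Kernel (X₁ × X₂) (Y₁ × Y₂ × Z)) [IsMarkovKernel W]
    (μ₁ : Measure (Fin n → X₁)) (μ₂ : Measure (Fin n → X₂)) [SFinite μ₁] [SFinite μ₂]
    {f : ((Fin n → X₁) × (Fin n → X₂)) × (Fin n → Y₁ × Y₂ × Z) → ℝ≥0∞} (hf : Measurable f) :
    ∫⁻ ω, f ω ∂(blockLaw W μ₁ μ₂) = ∫⁻ x₁, ∫⁻ x₂, ∫⁻ o, f ((x₁, x₂), o)
      ∂(Measure.pi fun k => W (x₁ k, x₂ k)) ∂μ₂ ∂μ₁ := by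
  rw [blockLaw, Measure.lintegral_compProd hf, lintegral_prod _ (by
    exact (Measurable.lintegral_kernel_prod_right' hf).aemeasurable)]
  rfl

lemma blockLaw_le (W : Kernel (X₁ × X₂) (Y₁ × Y₂ × Z)) [IsMarkovKernel W]
    {μ₁ ν₁ : Measure (Fin n → X₁)} {μ₂ ν₂ : Measure (Fin n → X₂)} [SFinite μ₁] [SFinite μ₂]
    [SFinite ν₁] [SFinite ν₂] {β : ℝ≥0} (h₁ : μ₁ ≤ β • ν₁) (h₂ : μ₂ ≤ β • ν₂) :
    blockLaw W μ₁ μ₂ ≤ (β ^ 2) • blockLaw W ν₁ ν₂ := by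
  refine Measure.le_iff.2 fun s hs => ?_
  rw [Measure.smul_apply, ← lintegral_indicator_one hs, ← lintegral_indicator_one hs,
    lintegral_blockLaw W _ _ (measurable_one.indicator hs),
    lintegral_blockLaw W _ _ (measurable_one.indicator hs)]
  refine (lintegral_le_mul_lintegral h₁ _).trans ?_
  have := lintegral_mono (μ := ν₁) fun x₁ => lintegral_le_mul_lintegral h₂ (fun x₂ => ∫⁻ o,
    s.indicator (1 : ((Fin n → X₁) × (Fin n → X₂)) × (Fin n → Y₁ × Y₂ × Z) → ℝ≥0∞) ((x₁, x₂), o) ∂(Measure.pi fun k => W (x₁ k, x₂ k)))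
  refine (mul_le_mul_right this _).trans ?_
  rw [lintegral_const_mul' _ _ ENNReal.coe_ne_top, ← mul_assoc]
  refine le_of_eq ?_
  change _ = ((β ^ 2 : ℝ≥0) : ℝ≥0∞) * _
  push_cast
  rw [sq]

variable {M₁ L₁ M₂ L₂ : ℕ}

/-- The encoder that picks uniformly one of the codewords of a message and passes it through the
prefix channel `κ`. -/
noncomputable def codebookEncoder {U X : Type*} [MeasurableSpace X] {M L : ℕ} (κ : U → Measure X)
    (c : Fin M × Fin L → U) : Kernel (Fin M) X :=
  Kernel.ofFunOfCountable fun m => (L : ℝ≥0∞)⁻¹ • ∑ l, κ (c (m, l))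

lemma codebookEncoder_apply {U X : Type*} [MeasurableSpace X] {M L : ℕ} (κ : U → Measure X)
    (c : Fin M × Fin L → U) (m : Fin M) :
    codebookEncoder κ c m = (L : ℝ≥0∞)⁻¹ • ∑ l, κ (c (m, l)) := rfl

lemma lintegral_codebookEncoder {U X : Type*} [MeasurableSpace X] {M L : ℕ} (κ : U → Measure X)
    (c : Fin M × Fin L → U) (m : Fin M) (f : X → ℝ≥0∞) :
    ∫⁻ x, f x ∂(codebookEncoder κ c m) = (L : ℝ≥0∞)⁻¹ * ∑ l, ∫⁻ x, f x ∂(κ (c (m, l))) := by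
  rw [codebookEncoder_apply, lintegral_smul_measure, lintegral_finsetSum_measure]
  rfl

lemma isMarkovKernel_codebookEncoder {U X : Type*} [MeasurableSpace X] {M L : ℕ} (hL : 0 < L)
    (κ : U → Measure X) [∀ u, IsProbabilityMeasure (κ u)]
    (c : Fin M × Fin L → U) : IsMarkovKernel (codebookEncoder κ c) := by
  refine ⟨fun m => ⟨?_⟩⟩
  have : Nonempty (Fin L) := ⟨⟨0, hL⟩⟩
  have h := lintegral_codebookEncoder κ c m (fun _ => 1)
  simp only [lintegral_const, measure_univ, mul_one, one_mul] at h
  rw [h]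
  have := inv_mul_sum_const (A := Fin L) 1
  rwa [Fintype.card_fin] at this

/-- The random-coding code given by two codebooks, prefix channels and threshold decoders. -/
noncomputable def codebookCode (hM₁ : 0 < M₁) (hL₁ : 0 < L₁) (hM₂ : 0 < M₂) (hL₂ : 0 < L₂)
    (κ₁ : U → Measure (Fin n → X₁)) [∀ u, IsProbabilityMeasure (κ₁ u)]
    (κ₂ : V → Measure (Fin n → X₂)) [∀ v, IsProbabilityMeasure (κ₂ v)]
    {S₁ : U → Set ((Fin n → X₂) × (Fin n → Y₂))} (hS₁ : ∀ u, MeasurableSet (S₁ u))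
    {S₂ : V → Set ((Fin n → X₁) × (Fin n → Y₁))} (hS₂ : ∀ v, MeasurableSet (S₂ v))
    (c : Fin M₁ × Fin L₁ → U) (d : Fin M₂ × Fin L₂ → V) : Code X₁ X₂ Y₁ Y₂ n :=
  have : Nonempty (Fin M₁) := ⟨⟨0, hM₁⟩⟩
  have : Nonempty (Fin M₂) := ⟨⟨0, hM₂⟩⟩
  { M₁ := M₁
    M₂ := M₂
    M₁_pos := hM₁
    M₂_pos := hM₂
    enc₁ := codebookEncoder κ₁ c
    enc₂ := codebookEncoder κ₂ d
    markov₁ := isMarkovKernel_codebookEncoder hL₁ κ₁ c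
    markov₂ := isMarkovKernel_codebookEncoder hL₂ κ₂ d
    dec₁ := thresholdDecoder S₂ d
    dec₂ := thresholdDecoder S₁ c
    measurable_dec₁ := measurable_thresholdDecoder hS₂ d
    measurable_dec₂ := measurable_thresholdDecoder hS₁ c }

lemma Code.lintegral_law (C : Code X₁ X₂ Y₁ Y₂ n) (W : Kernel (X₁ × X₂) (Y₁ × Y₂ × Z))
    [IsMarkovKernel W] {f : C.Sample Z → ℝ≥0∞} (hf : Measurable f) :
    ∫⁻ ω, f ω ∂(C.law W) = (C.M₁ : ℝ≥0∞)⁻¹ * ∑ m₁, (C.M₂ : ℝ≥0∞)⁻¹ * ∑ m₂,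
      ∫⁻ ω, f (((m₁, m₂), ω.1), ω.2) ∂(blockLaw W (C.enc₁ m₁) (C.enc₂ m₂)) := by
  have : Nonempty (Fin C.M₁) := ⟨⟨0, C.M₁_pos⟩⟩
  have : Nonempty (Fin C.M₂) := ⟨⟨0, C.M₂_pos⟩⟩
  rw [Code.law, Measure.lintegral_compProd hf,
    Measure.lintegral_compProd (Measurable.lintegral_kernel_prod_right' hf), lintegral_prod _
      (measurable_of_finite _).aemeasurable, lintegral_uniformOn_univ, Fintype.card_fin]
  congr 1
  refine Finset.sum_congr rfl fun m₁ _ => ?_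
  rw [lintegral_uniformOn_univ, Fintype.card_fin]
  congr 1
  refine Finset.sum_congr rfl fun m₂ _ => ?_
  rw [blockLaw, Measure.lintegral_compProd (by fun_prop), Kernel.parallelComp_apply]
  rfl

instance (C : Code X₁ X₂ Y₁ Y₂ n) (W : Kernel (X₁ × X₂) (Y₁ × Y₂ × Z)) [IsMarkovKernel W] :
    IsProbabilityMeasure (C.law W) := by
  have : Nonempty (Fin C.M₁) := ⟨⟨0, C.M₁_pos⟩⟩
  have : Nonempty (Fin C.M₂) := ⟨⟨0, C.M₂_pos⟩⟩
  unfold Code.law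
  infer_instance

lemma lintegral_blockLaw_codebookEncoder (W : Kernel (X₁ × X₂) (Y₁ × Y₂ × Z)) [IsMarkovKernel W]
    (hL₁ : 0 < L₁) (hL₂ : 0 < L₂)
    (κ₁ : U → Measure (Fin n → X₁)) [∀ u, IsProbabilityMeasure (κ₁ u)]
    (κ₂ : V → Measure (Fin n → X₂)) [∀ v, IsProbabilityMeasure (κ₂ v)]
    (c : Fin M₁ × Fin L₁ → U) (d : Fin M₂ × Fin L₂ → V) (m₁ : Fin M₁) (m₂ : Fin M₂)
    {f : ((Fin n → X₁) × (Fin n → X₂)) × (Fin n → Y₁ × Y₂ × Z) → ℝ≥0∞} (hf : Measurable f) :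
    ∫⁻ ω, f ω ∂(blockLaw W (codebookEncoder κ₁ c m₁) (codebookEncoder κ₂ d m₂))
      = (L₁ : ℝ≥0∞)⁻¹ * ∑ l₁, (L₂ : ℝ≥0∞)⁻¹ * ∑ l₂,
        ∫⁻ ω, f ω ∂(blockLaw W (κ₁ (c (m₁, l₁))) (κ₂ (d (m₂, l₂)))) := by
  have := isMarkovKernel_codebookEncoder hL₁ κ₁ c
  have := isMarkovKernel_codebookEncoder hL₂ κ₂ d
  rw [lintegral_blockLaw W _ _ hf, lintegral_codebookEncoder]
  congr 1
  refine Finset.sum_congr rfl fun l₁ _ => ?_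
  simp_rw [lintegral_codebookEncoder]
  have hm : ∀ l₂, Measurable fun x₁ => ∫⁻ x₂, ∫⁻ o, f ((x₁, x₂), o)
      ∂(Measure.pi fun k => W (x₁ k, x₂ k)) ∂(κ₂ (d (m₂, l₂))) := by
    intro l₂
    have h1 : Measurable fun x : (Fin n → X₁) × (Fin n → X₂) => ∫⁻ o, f (x, o)
        ∂(((memoryless W n).comap (fun x : (Fin n → X₁) × (Fin n → X₂) => fun k => (x.1 k, x.2 k))
          (by fun_prop)) x) := Measurable.lintegral_kernel_prod_right' hf
    exact h1.lintegral_prod_right'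
  rw [lintegral_const_mul _ (Finset.measurable_fun_sum _ fun l₂ _ => hm l₂),
    lintegral_finsetSum _ fun l₂ _ => hm l₂]
  simp_rw [lintegral_blockLaw W _ _ hf]

lemma lintegral_inv_mul_sum {A Ω : Type*} [Fintype A] [MeasurableSpace Ω] [Finite Ω]
    [MeasurableSingletonClass Ω] (μ : Measure Ω) (a : ℝ≥0∞) (F : A → Ω → ℝ≥0∞) :
    ∫⁻ ω, a * ∑ i, F i ω ∂μ = a * ∑ i, ∫⁻ ω, F i ω ∂μ := by
  rw [lintegral_const_mul _ (measurable_of_finite _),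
    lintegral_finsetSum _ fun _ _ => measurable_of_finite _]

lemma inv_mul_sum_le {M : ℕ} (hM : 0 < M) {F : Fin M → ℝ≥0∞} {b : ℝ≥0∞} (h : ∀ m, F m ≤ b) :
    (M : ℝ≥0∞)⁻¹ * ∑ m, F m ≤ b := by
  have : Nonempty (Fin M) := ⟨⟨0, hM⟩⟩
  have h2 := inv_mul_sum_const (A := Fin M) b
  rw [Fintype.card_fin] at h2
  exact (mul_le_mul_right (Finset.sum_le_sum fun m _ => h m) _).trans h2.le

lemma Code.errorProb_le (C : Code X₁ X₂ Y₁ Y₂ n) (W : Kernel (X₁ × X₂) (Y₁ × Y₂ × Z))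
    [IsMarkovKernel W] :
    C.errorProb W ≤ (C.M₁ : ℝ≥0∞)⁻¹ * ∑ m₁, (C.M₂ : ℝ≥0∞)⁻¹ * ∑ m₂,
      (blockLaw W (C.enc₁ m₁) (C.enc₂ m₂) {ω | C.dec₁ (ω.1.1, fun k => (ω.2 k).1) ≠ m₂}
        + blockLaw W (C.enc₁ m₁) (C.enc₂ m₂) {ω | C.dec₂ (ω.1.2, fun k => (ω.2 k).2.1) ≠ m₁}) := by
  have h1 : Measurable fun ω : C.Sample Z => C.dec₁ (ω.1.2.1, fun k => (ω.2 k).1) :=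
    C.measurable_dec₁.comp (by fun_prop)
  have h2 : Measurable fun ω : C.Sample Z => C.dec₂ (ω.1.2.2, fun k => (ω.2 k).2.1) :=
    C.measurable_dec₂.comp (by fun_prop)
  have hs : MeasurableSet {ω : C.Sample Z | C.dec₁ (ω.1.2.1, fun k => (ω.2 k).1) ≠ ω.1.1.2 ∨
      C.dec₂ (ω.1.2.2, fun k => (ω.2 k).2.1) ≠ ω.1.1.1} :=
    ((measurableSet_eq_fun h1 (by fun_prop)).compl).union
      ((measurableSet_eq_fun h2 (by fun_prop)).compl)
  rw [Code.errorProb, ← lintegral_indicator_one hs, C.lintegral_law W (measurable_one.indicator hs)]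
  gcongr with m₁ _ m₂ _
  refine le_trans (le_of_eq ?_) (measure_union_le _ _)
  rw [← lintegral_indicator_one]
  · rfl
  · exact hs.preimage (f := fun ω : ((Fin n → X₁) × (Fin n → X₂)) × (Fin n → Y₁ × Y₂ × Z) =>
      ((((m₁, m₂), ω.1), ω.2) : C.Sample Z)) (by fun_prop)

/-- The channel seen by the eavesdropper for given prefix inputs. -/
noncomputable def eveLaw (W : Kernel (X₁ × X₂) (Y₁ × Y₂ × Z)) [IsMarkovKernel W]
    (μ₁ : Measure (Fin n → X₁)) (μ₂ : Measure (Fin n → X₂)) : Measure (Fin n → Z) :=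
  (blockLaw W μ₁ μ₂).map fun ω k => (ω.2 k).2.2

instance (W : Kernel (X₁ × X₂) (Y₁ × Y₂ × Z)) [IsMarkovKernel W]
    (μ₁ : Measure (Fin n → X₁)) (μ₂ : Measure (Fin n → X₂)) [IsProbabilityMeasure μ₁]
    [IsProbabilityMeasure μ₂] : IsProbabilityMeasure (eveLaw W μ₁ μ₂) :=
  Measure.isProbabilityMeasure_map (by fun_prop)

lemma eveLaw_apply (W : Kernel (X₁ × X₂) (Y₁ × Y₂ × Z)) [IsMarkovKernel W]
    (μ₁ : Measure (Fin n → X₁)) (μ₂ : Measure (Fin n → X₂)) {s : Set (Fin n → Z)}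
    (hs : MeasurableSet s) :
    eveLaw W μ₁ μ₂ s = ∫⁻ ω, s.indicator 1 (fun k => (ω.2 k).2.2) ∂(blockLaw W μ₁ μ₂) := by
  rw [eveLaw, ← lintegral_indicator_one hs, lintegral_map (measurable_one.indicator hs)
    (by fun_prop)]

variable [Finite U] [MeasurableSpace U] [MeasurableSingletonClass U] [Finite V] [MeasurableSpace V]
  [MeasurableSingletonClass V] (W : Kernel (X₁ × X₂) (Y₁ × Y₂ × Z)) [IsMarkovKernel W]
  {κ₁ : U → Measure (Fin n → X₁)} [∀ u, IsProbabilityMeasure (κ₁ u)]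
  {κ₂ : V → Measure (Fin n → X₂)} [∀ v, IsProbabilityMeasure (κ₂ v)]
  {p p₀ : Measure U} [IsProbabilityMeasure p] {q q₀ : Measure V} [IsProbabilityMeasure q]
  {β : ℝ≥0} (hp : p ≤ β • p₀) (hq : q ≤ β • q₀)
  {κ₁' : U → Measure (Fin n → X₁)} [∀ u, IsProbabilityMeasure (κ₁' u)]
  {κ₂' : V → Measure (Fin n → X₂)} [∀ v, IsProbabilityMeasure (κ₂' v)]
  (hκ₁ : ∀ u, p {u} ≠ 0 → κ₁ u ≤ β • κ₁' u) (hκ₂ : ∀ v, q {v} ≠ 0 → κ₂ v ≤ β • κ₂' v)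
  (hM₁ : 0 < M₁) (hL₁ : 0 < L₁) (hM₂ : 0 < M₂) (hL₂ : 0 < L₂)
  {S₁ : U → Set ((Fin n → X₂) × (Fin n → Y₂))} (hS₁ : ∀ u, MeasurableSet (S₁ u))
  {S₂ : V → Set ((Fin n → X₁) × (Fin n → Y₁))} (hS₂ : ∀ v, MeasurableSet (S₂ v))

include hp hq hκ₁ hκ₂ in
lemma lintegral_codebook_dec₂_error_le (hM₁ : 0 < M₁) (η : ℝ≥0∞)
    (hη : M₁ = 1 ∨ β ^ 4 * (∫⁻ u, ∫⁻ v, blockLaw W (κ₁' u) (κ₂' v)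
        {ω | (ω.1.2, fun k => (ω.2 k).2.1) ∉ S₁ u} ∂q₀ ∂p₀)
        + ((M₁ : ℝ≥0∞) * L₁) * (β ^ 5 * ∫⁻ u', ∫⁻ u, ∫⁻ v, blockLaw W (κ₁' u) (κ₂' v)
          {ω | (ω.1.2, fun k => (ω.2 k).2.1) ∈ S₁ u'} ∂q₀ ∂p₀ ∂p₀) ≤ η)
    (i : Fin M₁ × Fin L₁) (j : Fin M₂ × Fin L₂) :
    have : Nonempty (Fin M₁) := ⟨⟨0, hM₁⟩⟩
    ∫⁻ c, ∫⁻ d, blockLaw W (κ₁ (c i)) (κ₂ (d j))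
        {ω | thresholdDecoder S₁ c (ω.1.2, fun k => (ω.2 k).2.1) ≠ i.1}
        ∂(Measure.pi fun _ : Fin M₂ × Fin L₂ => q) ∂(Measure.pi fun _ : Fin M₁ × Fin L₁ => p)
      ≤ η := by
  intro _
  rcases hη with rfl | hη
  · have : ∀ a b : Fin 1, ¬ (a ≠ b) := fun a b h => h (Subsingleton.elim a b)
    simp [this]
  · have h := lintegral_decoding_error_le (κ := Fin M₂ × Fin L₂) hp hq
      (T := fun u v => blockLaw W (κ₁ u) (κ₂ v)) (T₀ := fun u v => blockLaw W (κ₁' u) (κ₂' v))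
      (fun u v hu hv => blockLaw_le W (hκ₁ u hu) (hκ₂ v hv))
      (fun ω => (ω.1.2, fun k => (ω.2 k).2.1)) (S := S₁) i j
    rw [Fintype.card_fin, Fintype.card_fin] at h
    exact h.trans hη

include hp hq hκ₁ hκ₂ in
lemma lintegral_codebook_dec₁_error_le (hM₂ : 0 < M₂) (η : ℝ≥0∞)
    (hη : M₂ = 1 ∨ β ^ 4 * (∫⁻ v, ∫⁻ u, blockLaw W (κ₁' u) (κ₂' v)
        {ω | (ω.1.1, fun k => (ω.2 k).1) ∉ S₂ v} ∂p₀ ∂q₀)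
        + ((M₂ : ℝ≥0∞) * L₂) * (β ^ 5 * ∫⁻ v', ∫⁻ v, ∫⁻ u, blockLaw W (κ₁' u) (κ₂' v)
          {ω | (ω.1.1, fun k => (ω.2 k).1) ∈ S₂ v'} ∂p₀ ∂q₀ ∂q₀) ≤ η)
    (i : Fin M₁ × Fin L₁) (j : Fin M₂ × Fin L₂) :
    have : Nonempty (Fin M₂) := ⟨⟨0, hM₂⟩⟩
    ∫⁻ c, ∫⁻ d, blockLaw W (κ₁ (c i)) (κ₂ (d j))
        {ω | thresholdDecoder S₂ d (ω.1.1, fun k => (ω.2 k).1) ≠ j.1}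
        ∂(Measure.pi fun _ : Fin M₂ × Fin L₂ => q) ∂(Measure.pi fun _ : Fin M₁ × Fin L₁ => p)
      ≤ η := by
  intro _
  rw [lintegral_lintegral_swap (measurable_of_finite _).aemeasurable]
  rcases hη with rfl | hη
  · have : ∀ a b : Fin 1, ¬ (a ≠ b) := fun a b h => h (Subsingleton.elim a b)
    simp [this]
  · have h := lintegral_decoding_error_le (κ := Fin M₁ × Fin L₁) hq hp
      (T := fun v u => blockLaw W (κ₁ u) (κ₂ v)) (T₀ := fun v u => blockLaw W (κ₁' u) (κ₂' v))
      (fun v u hv hu => blockLaw_le W (hκ₁ u hu) (hκ₂ v hv))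
      (fun ω => (ω.1.1, fun k => (ω.2 k).1)) (S := S₂) j i
    rw [Fintype.card_fin, Fintype.card_fin] at h
    exact h.trans hη

include hp hq hκ₁ hκ₂ in
/-- Average error probability of the random code. -/
lemma lintegral_errorProb_codebookCode_le (η : ℝ≥0∞)
    (hη₁ : M₁ = 1 ∨ β ^ 4 * (∫⁻ u, ∫⁻ v, blockLaw W (κ₁' u) (κ₂' v)
        {ω | (ω.1.2, fun k => (ω.2 k).2.1) ∉ S₁ u} ∂q₀ ∂p₀)
        + ((M₁ : ℝ≥0∞) * L₁) * (β ^ 5 * ∫⁻ u', ∫⁻ u, ∫⁻ v, blockLaw W (κ₁' u) (κ₂' v)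
          {ω | (ω.1.2, fun k => (ω.2 k).2.1) ∈ S₁ u'} ∂q₀ ∂p₀ ∂p₀) ≤ η)
    (hη₂ : M₂ = 1 ∨ β ^ 4 * (∫⁻ v, ∫⁻ u, blockLaw W (κ₁' u) (κ₂' v)
        {ω | (ω.1.1, fun k => (ω.2 k).1) ∉ S₂ v} ∂p₀ ∂q₀)
        + ((M₂ : ℝ≥0∞) * L₂) * (β ^ 5 * ∫⁻ v', ∫⁻ v, ∫⁻ u, blockLaw W (κ₁' u) (κ₂' v)
          {ω | (ω.1.1, fun k => (ω.2 k).1) ∈ S₂ v'} ∂p₀ ∂q₀ ∂q₀) ≤ η) :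
    ∫⁻ c, ∫⁻ d, (codebookCode hM₁ hL₁ hM₂ hL₂ κ₁ κ₂ hS₁ hS₂ c d).errorProb W
        ∂(Measure.pi fun _ : Fin M₂ × Fin L₂ => q) ∂(Measure.pi fun _ : Fin M₁ × Fin L₁ => p)
      ≤ η + η := by
  have i1 : Nonempty (Fin M₁) := ⟨⟨0, hM₁⟩⟩
  have i2 : Nonempty (Fin M₂) := ⟨⟨0, hM₂⟩⟩
  set P := Measure.pi fun _ : Fin M₁ × Fin L₁ => p
  set ρ := Measure.pi fun _ : Fin M₂ × Fin L₂ => q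
  have hpt : ∀ c d, (codebookCode hM₁ hL₁ hM₂ hL₂ κ₁ κ₂ hS₁ hS₂ c d).errorProb W
      ≤ (M₁ : ℝ≥0∞)⁻¹ * ∑ m₁, (M₂ : ℝ≥0∞)⁻¹ * ∑ m₂, (L₁ : ℝ≥0∞)⁻¹ * ∑ l₁, (L₂ : ℝ≥0∞)⁻¹ * ∑ l₂,
        (blockLaw W (κ₁ (c (m₁, l₁))) (κ₂ (d (m₂, l₂)))
          {ω | thresholdDecoder S₂ d (ω.1.1, fun k => (ω.2 k).1) ≠ m₂}
        + blockLaw W (κ₁ (c (m₁, l₁))) (κ₂ (d (m₂, l₂)))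
          {ω | thresholdDecoder S₁ c (ω.1.2, fun k => (ω.2 k).2.1) ≠ m₁}) := by
    intro c d
    refine (Code.errorProb_le _ W).trans ?_
    change (M₁ : ℝ≥0∞)⁻¹ * ∑ m₁ : Fin M₁, (M₂ : ℝ≥0∞)⁻¹ * ∑ m₂ : Fin M₂,
      (blockLaw W (codebookEncoder κ₁ c m₁) (codebookEncoder κ₂ d m₂)
        {ω | thresholdDecoder S₂ d (ω.1.1, fun k => (ω.2 k).1) ≠ m₂}
        + blockLaw W (codebookEncoder κ₁ c m₁) (codebookEncoder κ₂ d m₂)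
        {ω | thresholdDecoder S₁ c (ω.1.2, fun k => (ω.2 k).2.1) ≠ m₁}) ≤ _
    gcongr with m₁ _ m₂ _
    have hs1 : MeasurableSet {ω : ((Fin n → X₁) × (Fin n → X₂)) × (Fin n → Y₁ × Y₂ × Z) |
        thresholdDecoder S₂ d (ω.1.1, fun k => (ω.2 k).1) ≠ m₂} :=
      (measurableSet_eq_fun ((measurable_thresholdDecoder hS₂ d).comp (by fun_prop))
        measurable_const).compl
    have hs2 : MeasurableSet {ω : ((Fin n → X₁) × (Fin n → X₂)) × (Fin n → Y₁ × Y₂ × Z) |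
        thresholdDecoder S₁ c (ω.1.2, fun k => (ω.2 k).2.1) ≠ m₁} :=
      (measurableSet_eq_fun ((measurable_thresholdDecoder hS₁ c).comp (by fun_prop))
        measurable_const).compl
    simp_rw [← lintegral_indicator_one hs1, ← lintegral_indicator_one hs2]
    rw [lintegral_blockLaw_codebookEncoder W hL₁ hL₂ κ₁ κ₂ c d m₁ m₂ (measurable_one.indicator hs1),
      lintegral_blockLaw_codebookEncoder W hL₁ hL₂ κ₁ κ₂ c d m₁ m₂ (measurable_one.indicator hs2)]
    simp_rw [Finset.sum_add_distrib, mul_add, Finset.sum_add_distrib, mul_add]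
    exact le_rfl
  refine (lintegral_mono fun c => lintegral_mono fun d => hpt c d).trans ?_
  simp_rw [lintegral_inv_mul_sum]
  refine inv_mul_sum_le hM₁ fun m₁ => inv_mul_sum_le hM₂ fun m₂ => inv_mul_sum_le hL₁ fun l₁ =>
    inv_mul_sum_le hL₂ fun l₂ => ?_
  simp_rw [lintegral_add_left (measurable_of_finite _)]
  exact add_le_add
    (lintegral_codebook_dec₁_error_le W hp hq hκ₁ hκ₂ hM₂ η hη₂ (m₁, l₁) (m₂, l₂))
    (lintegral_codebook_dec₂_error_le W hp hq hκ₁ hκ₂ hM₁ η hη₁ (m₁, l₁) (m₂, l₂))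

end CodebookCode

section Leakage

open InformationTheory

variable {X₁ X₂ Y₁ Y₂ Z U V : Type*} [MeasurableSpace X₁] [MeasurableSpace X₂] [MeasurableSpace Y₁]
  [MeasurableSpace Y₂] [MeasurableSpace Z] {n : ℕ}

lemma mutualInfo_le_of_map_eq_compProd {Ω A B : Type*} [MeasurableSpace Ω] [MeasurableSpace A]
    [MeasurableSpace B] [Finite A] [MeasurableSingletonClass A] [Nonempty A]
    [StandardBorelSpace A] {f : Ω → A} {h : Ω → B}
    (hf : Measurable f) (hh : Measurable h) (μ : Measure Ω) [IsProbabilityMeasure μ]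
    (ν : Measure A) [IsProbabilityMeasure ν] (K : Kernel A B) [IsMarkovKernel K]
    (e : μ.map (fun ω => (f ω, h ω)) = ν ⊗ₘ K) (Q : Measure B) [IsProbabilityMeasure Q] :
    mutualInfo f h μ ≤ ∫⁻ a, klDiv (K a) Q ∂ν := by
  refine (mutualInfo_le_klDiv hf hh μ Q).trans ?_
  have h1 : μ.map f = ν := by
    rw [← Measure.fst_map_prodMk (X := f) hh, e, Measure.fst_compProd]
  rw [e, h1]
  exact klDiv_compProd_prod_le ν K Q

lemma Code.leakage_le (C : Code X₁ X₂ Y₁ Y₂ n) (W : Kernel (X₁ × X₂) (Y₁ × Y₂ × Z))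
    [IsMarkovKernel W] (Q : Measure (Fin n → Z)) [IsProbabilityMeasure Q] :
    C.leakage W ≤ (C.M₁ : ℝ≥0∞)⁻¹ * ∑ m₁, (C.M₂ : ℝ≥0∞)⁻¹ * ∑ m₂,
      klDiv (eveLaw W (C.enc₁ m₁) (C.enc₂ m₂)) Q := by
  have i1 : Nonempty (Fin C.M₁) := ⟨⟨0, C.M₁_pos⟩⟩
  have i2 : Nonempty (Fin C.M₂) := ⟨⟨0, C.M₂_pos⟩⟩
  set K : Kernel (Fin C.M₁ × Fin C.M₂) (Fin n → Z) :=
    Kernel.ofFunOfCountable fun m => eveLaw W (C.enc₁ m.1) (C.enc₂ m.2) with hK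
  have hKa : ∀ m, K m = eveLaw W (C.enc₁ m.1) (C.enc₂ m.2) := fun m => rfl
  have : IsMarkovKernel K := ⟨fun m => by rw [hKa]; infer_instance⟩
  set ν := (uniformOn (Set.univ : Set (Fin C.M₁))).prod (uniformOn (Set.univ : Set (Fin C.M₂)))
  have e : (C.law W).map (fun ω => (ω.1.1, fun k => (ω.2 k).2.2)) = ν ⊗ₘ K := by
    ext s hs
    have hm : Measurable fun ω : C.Sample Z =>
        s.indicator (1 : _ × (Fin n → Z) → ℝ≥0∞) (ω.1.1, fun k => (ω.2 k).2.2) :=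
      (measurable_one.indicator hs).comp (by fun_prop)
    rw [Measure.compProd_apply hs, ← lintegral_indicator_one hs,
      lintegral_map (measurable_one.indicator hs) (by fun_prop),
      C.lintegral_law W hm,
      lintegral_prod _ (measurable_of_finite _).aemeasurable, lintegral_uniformOn_univ,
      Fintype.card_fin]
    congr 1
    refine Finset.sum_congr rfl fun m₁ _ => ?_
    rw [lintegral_uniformOn_univ, Fintype.card_fin]
    congr 1
    refine Finset.sum_congr rfl fun m₂ _ => ?_
    rw [hKa, eveLaw_apply W _ _ (measurable_prodMk_left hs)]
    rfl
  have h := mutualInfo_le_of_map_eq_compProd (by fun_prop) (by fun_prop) (C.law W) ν K e Q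
  refine h.trans (le_of_eq ?_)
  rw [lintegral_prod _ (measurable_of_finite _).aemeasurable, lintegral_uniformOn_univ]
  simp_rw [lintegral_uniformOn_univ, Fintype.card_fin]
  rfl

lemma Code.leakage₁_le (C : Code X₁ X₂ Y₁ Y₂ n) (W : Kernel (X₁ × X₂) (Y₁ × Y₂ × Z))
    [IsMarkovKernel W] (Q : Measure (Fin n → Z)) [IsProbabilityMeasure Q] :
    C.leakage₁ W ≤ (C.M₁ : ℝ≥0∞)⁻¹ * ∑ m₁,
      klDiv ((C.M₂ : ℝ≥0∞)⁻¹ • ∑ m₂, eveLaw W (C.enc₁ m₁) (C.enc₂ m₂)) Q := by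
  have i1 : Nonempty (Fin C.M₁) := ⟨⟨0, C.M₁_pos⟩⟩
  have i2 : Nonempty (Fin C.M₂) := ⟨⟨0, C.M₂_pos⟩⟩
  set K : Kernel (Fin C.M₁) (Fin n → Z) := Kernel.ofFunOfCountable fun m =>
    (C.M₂ : ℝ≥0∞)⁻¹ • ∑ m₂, eveLaw W (C.enc₁ m) (C.enc₂ m₂) with hK
  have hKa : ∀ m, K m = (C.M₂ : ℝ≥0∞)⁻¹ • ∑ m₂, eveLaw W (C.enc₁ m) (C.enc₂ m₂) := fun m => rfl
  have : IsMarkovKernel K := ⟨fun m => ⟨by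
    rw [hKa, Measure.smul_apply, Measure.finsetSum_apply]
    simp only [measure_univ]
    have := inv_mul_sum_const (A := Fin C.M₂) 1
    rwa [Fintype.card_fin] at this⟩⟩
  set ν := uniformOn (Set.univ : Set (Fin C.M₁))
  have e : (C.law W).map (fun ω => (ω.1.1.1, fun k => (ω.2 k).2.2)) = ν ⊗ₘ K := by
    ext s hs
    have hm : Measurable fun ω : C.Sample Z =>
        s.indicator (1 : _ × (Fin n → Z) → ℝ≥0∞) (ω.1.1.1, fun k => (ω.2 k).2.2) :=
      (measurable_one.indicator hs).comp (by fun_prop)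
    rw [Measure.compProd_apply hs, ← lintegral_indicator_one hs,
      lintegral_map (measurable_one.indicator hs) (by fun_prop),
      C.lintegral_law W hm,
      lintegral_uniformOn_univ, Fintype.card_fin]
    congr 1
    refine Finset.sum_congr rfl fun m₁ _ => ?_
    rw [hKa, Measure.smul_apply, Measure.finsetSum_apply]
    congr 1
    refine Finset.sum_congr rfl fun m₂ _ => ?_
    rw [eveLaw_apply W _ _ (measurable_prodMk_left hs)]
    rfl
  have h := mutualInfo_le_of_map_eq_compProd (by fun_prop) (by fun_prop) (C.law W) ν K e Q
  refine h.trans (le_of_eq ?_)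
  rw [lintegral_uniformOn_univ, Fintype.card_fin]
  rfl

lemma Code.leakage₂_le (C : Code X₁ X₂ Y₁ Y₂ n) (W : Kernel (X₁ × X₂) (Y₁ × Y₂ × Z))
    [IsMarkovKernel W] (Q : Measure (Fin n → Z)) [IsProbabilityMeasure Q] :
    C.leakage₂ W ≤ (C.M₂ : ℝ≥0∞)⁻¹ * ∑ m₂,
      klDiv ((C.M₁ : ℝ≥0∞)⁻¹ • ∑ m₁, eveLaw W (C.enc₁ m₁) (C.enc₂ m₂)) Q := by
  have i1 : Nonempty (Fin C.M₁) := ⟨⟨0, C.M₁_pos⟩⟩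
  have i2 : Nonempty (Fin C.M₂) := ⟨⟨0, C.M₂_pos⟩⟩
  set K : Kernel (Fin C.M₂) (Fin n → Z) := Kernel.ofFunOfCountable fun m =>
    (C.M₁ : ℝ≥0∞)⁻¹ • ∑ m₁, eveLaw W (C.enc₁ m₁) (C.enc₂ m) with hK
  have hKa : ∀ m, K m = (C.M₁ : ℝ≥0∞)⁻¹ • ∑ m₁, eveLaw W (C.enc₁ m₁) (C.enc₂ m) := fun m => rfl
  have : IsMarkovKernel K := ⟨fun m => ⟨by
    rw [hKa, Measure.smul_apply, Measure.finsetSum_apply]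
    simp only [measure_univ]
    have := inv_mul_sum_const (A := Fin C.M₁) 1
    rwa [Fintype.card_fin] at this⟩⟩
  set ν := uniformOn (Set.univ : Set (Fin C.M₂))
  have e : (C.law W).map (fun ω => (ω.1.1.2, fun k => (ω.2 k).2.2)) = ν ⊗ₘ K := by
    ext s hs
    have hm : Measurable fun ω : C.Sample Z =>
        s.indicator (1 : _ × (Fin n → Z) → ℝ≥0∞) (ω.1.1.2, fun k => (ω.2 k).2.2) :=
      (measurable_one.indicator hs).comp (by fun_prop)
    rw [Measure.compProd_apply hs, ← lintegral_indicator_one hs,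
      lintegral_map (measurable_one.indicator hs) (by fun_prop),
      C.lintegral_law W hm,
      lintegral_uniformOn_univ, Fintype.card_fin]
    simp_rw [← Finset.mul_sum]
    rw [mul_left_comm]
    congr 1
    rw [Finset.sum_comm, Finset.mul_sum]
    refine Finset.sum_congr rfl fun m₂ _ => ?_
    rw [hKa, Measure.smul_apply, Measure.finsetSum_apply, smul_eq_mul]
    congr 1
    refine Finset.sum_congr rfl fun m₁ _ => ?_
    rw [eveLaw_apply W _ _ (measurable_prodMk_left hs)]
    rfl
  have h := mutualInfo_le_of_map_eq_compProd (by fun_prop) (by fun_prop) (C.law W) ν K e Q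
  refine h.trans (le_of_eq ?_)
  rw [lintegral_uniformOn_univ, Fintype.card_fin]
  rfl

lemma lintegral_pi_comp_injective {ι ι' A : Type*} [Fintype ι] [Fintype ι'] [MeasurableSpace A]
    (p : Measure A) [IsProbabilityMeasure p] {e : ι' → ι} (he : Function.Injective e)
    {F : (ι' → A) → ℝ≥0∞} (hF : Measurable F) :
    ∫⁻ c, F (fun i => c (e i)) ∂(Measure.pi fun _ : ι => p)
      = ∫⁻ c, F c ∂(Measure.pi fun _ : ι' => p) := by
  classical
  have h : (Measure.pi fun _ : ι => p).map (fun c i => c (e i)) = Measure.pi fun _ : ι' => p := by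
    refine (Measure.pi_eq fun s hs => ?_).symm
    rw [Measure.map_apply (by fun_prop) (MeasurableSet.univ_pi hs)]
    have e1 : (fun c : ι → A => fun i => c (e i)) ⁻¹' (Set.univ.pi s)
        = Set.univ.pi fun j => if h : ∃ i, e i = j then s h.choose else Set.univ := by
      ext c
      simp only [Set.mem_preimage, Set.mem_pi, Set.mem_univ, true_imp_iff]
      constructor
      · intro h j
        split_ifs with hj
        · have := h hj.choose
          rwa [hj.choose_spec] at this
        · trivial
      · intro h i
        have hi : ∃ i', e i' = e i := ⟨i, rfl⟩
        have h2 := h (e i)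
        rw [dif_pos hi, he hi.choose_spec] at h2
        exact h2
    rw [e1, Measure.pi_pi]
    have e2 : ∀ i, (if h : ∃ i', e i' = e i then s h.choose else Set.univ) = s i := fun i => by
      have hi : ∃ i', e i' = e i := ⟨i, rfl⟩
      rw [dif_pos hi, he hi.choose_spec]
    rw [← Finset.prod_subset (Finset.subset_univ (Finset.univ.image e)),
      Finset.prod_image fun _ _ _ _ h => he h]
    · simp_rw [e2]
    · intro j _ hj
      have : ¬ ∃ i, e i = j := by simpa using hj
      rw [dif_neg this, measure_univ]
  rw [← h, lintegral_map hF (by fun_prop)]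

variable {M₁ L₁ M₂ L₂ : ℕ}

variable [Finite U] [MeasurableSpace U] [MeasurableSingletonClass U] [Finite V] [MeasurableSpace V]
  [MeasurableSingletonClass V] (W : Kernel (X₁ × X₂) (Y₁ × Y₂ × Z)) [IsMarkovKernel W]
  {κ₁ : U → Measure (Fin n → X₁)} [∀ u, IsProbabilityMeasure (κ₁ u)]
  {κ₂ : V → Measure (Fin n → X₂)} [∀ v, IsProbabilityMeasure (κ₂ v)]

lemma inv_natCast_mul_natCast (a b : ℕ) :
    ((a : ℝ≥0∞) * b)⁻¹ = (a : ℝ≥0∞)⁻¹ * (b : ℝ≥0∞)⁻¹ :=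
  ENNReal.mul_inv (Or.inr (ENNReal.natCast_ne_top _)) (Or.inl (ENNReal.natCast_ne_top _))

variable (κ₁ κ₂) in
lemma eveLaw_codebookEncoder (hL₁ : 0 < L₁) (hL₂ : 0 < L₂) (c : Fin M₁ × Fin L₁ → U)
    (d : Fin M₂ × Fin L₂ → V) (m₁ : Fin M₁) (m₂ : Fin M₂) :
    eveLaw W (codebookEncoder κ₁ c m₁) (codebookEncoder κ₂ d m₂)
      = codebookMixture (fun u v => eveLaw W (κ₁ u) (κ₂ v)) (fun l => c (m₁, l))
        (fun l => d (m₂, l)) := by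
  ext s hs
  have hm : Measurable fun ω : ((Fin n → X₁) × (Fin n → X₂)) × (Fin n → Y₁ × Y₂ × Z) =>
      s.indicator (1 : (Fin n → Z) → ℝ≥0∞) (fun k => (ω.2 k).2.2) :=
    (measurable_one.indicator hs).comp (by fun_prop)
  rw [eveLaw_apply W _ _ hs, lintegral_blockLaw_codebookEncoder W hL₁ hL₂ κ₁ κ₂ c d m₁ m₂ hm, codebookMixture, Measure.smul_apply,
    Measure.finsetSum_apply, Fintype.card_fin, Fintype.card_fin, inv_natCast_mul_natCast,
    smul_eq_mul, mul_assoc]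
  congr 1
  rw [Finset.mul_sum]
  refine Finset.sum_congr rfl fun l₁ _ => ?_
  rw [Measure.finsetSum_apply]
  congr 1
  refine Finset.sum_congr rfl fun l₂ _ => ?_
  rw [eveLaw_apply W _ _ hs]

variable (κ₁ κ₂) in
lemma eveLaw_codebookEncoder_sum_right (hL₁ : 0 < L₁) (hL₂ : 0 < L₂) (c : Fin M₁ × Fin L₁ → U)
    (d : Fin M₂ × Fin L₂ → V) (m₁ : Fin M₁) :
    (M₂ : ℝ≥0∞)⁻¹ • ∑ m₂, eveLaw W (codebookEncoder κ₁ c m₁) (codebookEncoder κ₂ d m₂)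
      = codebookMixture (fun u v => eveLaw W (κ₁ u) (κ₂ v)) (fun l => c (m₁, l)) d := by
  simp_rw [eveLaw_codebookEncoder W κ₁ κ₂ hL₁ hL₂]
  simp only [codebookMixture, Fintype.card_fin, Fintype.card_prod, Fintype.sum_prod_type]
  rw [← Finset.smul_sum, smul_smul, Finset.sum_comm]
  congr 1
  push_cast
  rw [inv_natCast_mul_natCast, ENNReal.mul_inv (Or.inr (by finiteness)) (Or.inl (by finiteness)),
    inv_natCast_mul_natCast]
  ring

variable (κ₁ κ₂) in
lemma eveLaw_codebookEncoder_sum_left (hL₁ : 0 < L₁) (hL₂ : 0 < L₂) (c : Fin M₁ × Fin L₁ → U)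
    (d : Fin M₂ × Fin L₂ → V) (m₂ : Fin M₂) :
    (M₁ : ℝ≥0∞)⁻¹ • ∑ m₁, eveLaw W (codebookEncoder κ₁ c m₁) (codebookEncoder κ₂ d m₂)
      = codebookMixture (fun u v => eveLaw W (κ₁ u) (κ₂ v)) c (fun l => d (m₂, l)) := by
  simp_rw [eveLaw_codebookEncoder W κ₁ κ₂ hL₁ hL₂]
  simp only [codebookMixture, Fintype.card_fin, Fintype.card_prod, Fintype.sum_prod_type]
  rw [← Finset.smul_sum, smul_smul]
  congr 1
  push_cast
  rw [inv_natCast_mul_natCast, ENNReal.mul_inv (Or.inr (by finiteness)) (Or.inl (by finiteness)),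
    inv_natCast_mul_natCast]
  ring

/-- The soft-covering bound on the divergence of the eavesdropper's law from `Q`, for codebooks of
sizes `A` and `B`. -/
noncomputable def leakBound (p₀ : Measure U) (q₀ : Measure V) (Q : Measure Z) (k : U → V → Z → ℝ)
    (β : ℝ≥0) (s A B : ℝ) : ℝ≥0∞ :=
  ENNReal.ofReal (3 * Real.log β) + ENNReal.ofReal (β ^ 3 / s) *
    ∫⁻ z, ENNReal.ofReal (resolvTerm p₀ q₀ (fun u v => k u v z) A B s) ∂Q

variable {p p₀ : Measure U} [IsProbabilityMeasure p] [IsProbabilityMeasure p₀]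
  {q q₀ : Measure V} [IsProbabilityMeasure q] [IsProbabilityMeasure q₀]
  {β : ℝ≥0} (hβ : 1 ≤ β) (hp : p ≤ β • p₀) (hq : q ≤ β • q₀)
  (Q : Measure (Fin n → Z)) [IsProbabilityMeasure Q] {k : U → V → (Fin n → Z) → ℝ}
  (hk : ∀ u v, Measurable (k u v)) (hk0 : ∀ u v z, 0 ≤ k u v z)
  (hμ : ∀ u v, p {u} ≠ 0 → q {v} ≠ 0 →
    eveLaw W (κ₁ u) (κ₂ v) ≤ β • Q.withDensity fun z => ENNReal.ofReal (k u v z))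
  (hk1 : ∀ᵐ z ∂Q, ∫ u, ∫ v, k u v z ∂q₀ ∂p₀ ≤ 1) {s : ℝ} (hs : 0 < s) (hs1 : s ≤ 1)
  (hM₁ : 0 < M₁) (hL₁ : 0 < L₁) (hM₂ : 0 < M₂) (hL₂ : 0 < L₂)
  {S₁ : U → Set ((Fin n → X₂) × (Fin n → Y₂))} (hS₁ : ∀ u, MeasurableSet (S₁ u))
  {S₂ : V → Set ((Fin n → X₁) × (Fin n → Y₁))} (hS₂ : ∀ v, MeasurableSet (S₂ v))

include hβ hp hq hk hk0 hμ hk1 hs hs1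

lemma lintegral_leakage_codebookCode_le :
    ∫⁻ c, ∫⁻ d, (codebookCode hM₁ hL₁ hM₂ hL₂ κ₁ κ₂ hS₁ hS₂ c d).leakage W
        ∂(Measure.pi fun _ : Fin M₂ × Fin L₂ => q) ∂(Measure.pi fun _ : Fin M₁ × Fin L₁ => p)
      ≤ leakBound p₀ q₀ Q k β s L₁ L₂ := by
  have j1 : Nonempty (Fin L₁) := ⟨⟨0, hL₁⟩⟩
  have j2 : Nonempty (Fin L₂) := ⟨⟨0, hL₂⟩⟩
  have hpt : ∀ c d, (codebookCode hM₁ hL₁ hM₂ hL₂ κ₁ κ₂ hS₁ hS₂ c d).leakage W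
      ≤ (M₁ : ℝ≥0∞)⁻¹ * ∑ m₁, (M₂ : ℝ≥0∞)⁻¹ * ∑ m₂, klDiv (codebookMixture
        (fun u v => eveLaw W (κ₁ u) (κ₂ v)) (fun l => c (m₁, l)) (fun l => d (m₂, l))) Q := by
    intro c d
    refine (Code.leakage_le _ W Q).trans (le_of_eq ?_)
    change (M₁ : ℝ≥0∞)⁻¹ * ∑ m₁ : Fin M₁, (M₂ : ℝ≥0∞)⁻¹ * ∑ m₂ : Fin M₂,
      klDiv (eveLaw W (codebookEncoder κ₁ c m₁) (codebookEncoder κ₂ d m₂)) Q = _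
    simp_rw [eveLaw_codebookEncoder W κ₁ κ₂ hL₁ hL₂]
  refine (lintegral_mono fun c => lintegral_mono fun d => hpt c d).trans ?_
  simp_rw [lintegral_inv_mul_sum]
  refine inv_mul_sum_le hM₁ fun m₁ => inv_mul_sum_le hM₂ fun m₂ => ?_
  have e1 : ∀ c : Fin M₁ × Fin L₁ → U, ∫⁻ d, klDiv (codebookMixture
        (fun u v => eveLaw W (κ₁ u) (κ₂ v)) (fun l => c (m₁, l)) (fun l => d (m₂, l))) Q
          ∂(Measure.pi fun _ : Fin M₂ × Fin L₂ => q)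
      = ∫⁻ d, klDiv (codebookMixture
        (fun u v => eveLaw W (κ₁ u) (κ₂ v)) (fun l => c (m₁, l)) d) Q
          ∂(Measure.pi fun _ : Fin L₂ => q) := fun c =>
    lintegral_pi_comp_injective q (F := fun d => klDiv (codebookMixture
        (fun u v => eveLaw W (κ₁ u) (κ₂ v)) (fun l => c (m₁, l)) d) Q)
      (Prod.mk_right_injective m₂) (measurable_of_finite _)
  simp_rw [e1]
  rw [lintegral_pi_comp_injective p (F := fun c => ∫⁻ d, klDiv (codebookMixture
        (fun u v => eveLaw W (κ₁ u) (κ₂ v)) c d) Q ∂(Measure.pi fun _ : Fin L₂ => q))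
      (Prod.mk_right_injective m₁) (measurable_of_finite _)]
  have h := lintegral_klDiv_codebookMixture_le (ι := Fin L₁) (κ := Fin L₂) hβ hp hq Q
    (fun u v => eveLaw W (κ₁ u) (κ₂ v)) hk hk0 hμ hk1 hs hs1
  rw [Fintype.card_fin, Fintype.card_fin] at h
  exact h

lemma lintegral_leakage₁_codebookCode_le :
    ∫⁻ c, ∫⁻ d, (codebookCode hM₁ hL₁ hM₂ hL₂ κ₁ κ₂ hS₁ hS₂ c d).leakage₁ W
        ∂(Measure.pi fun _ : Fin M₂ × Fin L₂ => q) ∂(Measure.pi fun _ : Fin M₁ × Fin L₁ => p)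
      ≤ leakBound p₀ q₀ Q k β s L₁ (M₂ * L₂) := by
  have j1 : Nonempty (Fin L₁) := ⟨⟨0, hL₁⟩⟩
  have j2 : Nonempty (Fin L₂) := ⟨⟨0, hL₂⟩⟩
  have j3 : Nonempty (Fin M₂) := ⟨⟨0, hM₂⟩⟩
  have hpt : ∀ c d, (codebookCode hM₁ hL₁ hM₂ hL₂ κ₁ κ₂ hS₁ hS₂ c d).leakage₁ W
      ≤ (M₁ : ℝ≥0∞)⁻¹ * ∑ m₁, klDiv (codebookMixture
        (fun u v => eveLaw W (κ₁ u) (κ₂ v)) (fun l => c (m₁, l)) d) Q := by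
    intro c d
    refine (Code.leakage₁_le _ W Q).trans (le_of_eq ?_)
    change (M₁ : ℝ≥0∞)⁻¹ * ∑ m₁ : Fin M₁, klDiv ((M₂ : ℝ≥0∞)⁻¹ • ∑ m₂ : Fin M₂,
      (eveLaw W (codebookEncoder κ₁ c m₁) (codebookEncoder κ₂ d m₂))) Q = _
    simp_rw [eveLaw_codebookEncoder_sum_right W κ₁ κ₂ hL₁ hL₂]
  refine (lintegral_mono fun c => lintegral_mono fun d => hpt c d).trans ?_
  simp_rw [lintegral_inv_mul_sum]
  refine inv_mul_sum_le hM₁ fun m₁ => ?_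
  rw [lintegral_pi_comp_injective p (F := fun c => ∫⁻ d, klDiv (codebookMixture
        (fun u v => eveLaw W (κ₁ u) (κ₂ v)) c d) Q ∂(Measure.pi fun _ : Fin M₂ × Fin L₂ => q))
      (Prod.mk_right_injective m₁) (measurable_of_finite _)]
  have h := lintegral_klDiv_codebookMixture_le (ι := Fin L₁) (κ := Fin M₂ × Fin L₂) hβ hp hq Q
    (fun u v => eveLaw W (κ₁ u) (κ₂ v)) hk hk0 hμ hk1 hs hs1
  rw [Fintype.card_fin, Fintype.card_prod, Fintype.card_fin, Fintype.card_fin, Nat.cast_mul] at h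
  exact h

lemma lintegral_leakage₂_codebookCode_le :
    ∫⁻ c, ∫⁻ d, (codebookCode hM₁ hL₁ hM₂ hL₂ κ₁ κ₂ hS₁ hS₂ c d).leakage₂ W
        ∂(Measure.pi fun _ : Fin M₂ × Fin L₂ => q) ∂(Measure.pi fun _ : Fin M₁ × Fin L₁ => p)
      ≤ leakBound p₀ q₀ Q k β s (M₁ * L₁) L₂ := by
  have j1 : Nonempty (Fin L₁) := ⟨⟨0, hL₁⟩⟩
  have j2 : Nonempty (Fin L₂) := ⟨⟨0, hL₂⟩⟩
  have j3 : Nonempty (Fin M₁) := ⟨⟨0, hM₁⟩⟩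
  have hpt : ∀ c d, (codebookCode hM₁ hL₁ hM₂ hL₂ κ₁ κ₂ hS₁ hS₂ c d).leakage₂ W
      ≤ (M₂ : ℝ≥0∞)⁻¹ * ∑ m₂, klDiv (codebookMixture
        (fun u v => eveLaw W (κ₁ u) (κ₂ v)) c (fun l => d (m₂, l))) Q := by
    intro c d
    refine (Code.leakage₂_le _ W Q).trans (le_of_eq ?_)
    change (M₂ : ℝ≥0∞)⁻¹ * ∑ m₂ : Fin M₂, klDiv ((M₁ : ℝ≥0∞)⁻¹ • ∑ m₁ : Fin M₁,
      (eveLaw W (codebookEncoder κ₁ c m₁) (codebookEncoder κ₂ d m₂))) Q = _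
    simp_rw [eveLaw_codebookEncoder_sum_left W κ₁ κ₂ hL₁ hL₂]
  refine (lintegral_mono fun c => lintegral_mono fun d => hpt c d).trans ?_
  simp_rw [lintegral_inv_mul_sum]
  refine inv_mul_sum_le hM₂ fun m₂ => ?_
  have e1 : ∀ c : Fin M₁ × Fin L₁ → U, ∫⁻ d, klDiv (codebookMixture
        (fun u v => eveLaw W (κ₁ u) (κ₂ v)) c (fun l => d (m₂, l))) Q
          ∂(Measure.pi fun _ : Fin M₂ × Fin L₂ => q)
      = ∫⁻ d, klDiv (codebookMixture (fun u v => eveLaw W (κ₁ u) (κ₂ v)) c d) Q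
          ∂(Measure.pi fun _ : Fin L₂ => q) := fun c =>
    lintegral_pi_comp_injective q (F := fun d => klDiv (codebookMixture
        (fun u v => eveLaw W (κ₁ u) (κ₂ v)) c d) Q)
      (Prod.mk_right_injective m₂) (measurable_of_finite _)
  simp_rw [e1]
  have h := lintegral_klDiv_codebookMixture_le (ι := Fin M₁ × Fin L₁) (κ := Fin L₂) hβ hp hq Q
    (fun u v => eveLaw W (κ₁ u) (κ₂ v)) hk hk0 hμ hk1 hs hs1
  rw [Fintype.card_fin, Fintype.card_prod, Fintype.card_fin, Fintype.card_fin, Nat.cast_mul] at h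
  exact h

end Leakage

section ProductLetters

open InformationTheory

variable {X₁ X₂ Y₁ Y₂ Z A B : Type*} [MeasurableSpace X₁] [MeasurableSpace X₂] [MeasurableSpace Y₁]
  [MeasurableSpace Y₂] [MeasurableSpace Z] {n : ℕ}

lemma lintegral_pi_prod {ι : Type*} [Fintype ι] {E : ι → Type*} [∀ i, MeasurableSpace (E i)]
    (μ : ∀ i, Measure (E i)) [∀ i, IsProbabilityMeasure (μ i)] {f : ∀ i, E i → ℝ≥0∞}
    (hf : ∀ i, Measurable (f i)) :
    ∫⁻ x, ∏ i, f i (x i) ∂(Measure.pi μ) = ∏ i, ∫⁻ x, f i x ∂(μ i) := by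
  have hi : iIndepFun (fun i (x : ∀ i, E i) => f i (x i)) (Measure.pi μ) :=
    iIndepFun_pi fun i => (hf i).aemeasurable
  rw [lintegral_prod_eq_prod_lintegral_of_indepFun Finset.univ _ hi
    fun i => (hf i).comp (measurable_pi_apply i)]
  refine Finset.prod_congr rfl fun i _ => ?_
  exact (measurePreserving_eval μ i).lintegral_comp (hf i)

lemma pi_withDensity {ι : Type*} [Fintype ι] {E : ι → Type*} [∀ i, MeasurableSpace (E i)]
    (μ : ∀ i, Measure (E i)) [∀ i, IsProbabilityMeasure (μ i)] {f : ∀ i, E i → ℝ≥0∞}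
    (hf : ∀ i, Measurable (f i)) [∀ i, IsProbabilityMeasure ((μ i).withDensity (f i))] :
    Measure.pi (fun i => (μ i).withDensity (f i))
      = (Measure.pi μ).withDensity fun x => ∏ i, f i (x i) := by
  refine (Measure.pi_eq fun s hs => ?_)
  rw [withDensity_apply _ (MeasurableSet.univ_pi hs), ← lintegral_indicator (.univ_pi hs)]
  have : ∀ x : ∀ i, E i, (Set.univ.pi s).indicator (fun x => ∏ i, f i (x i)) x
      = ∏ i, (s i).indicator (f i) (x i) := by
    intro x
    by_cases hx : x ∈ Set.univ.pi s
    · rw [Set.indicator_of_mem hx]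
      exact Finset.prod_congr rfl fun i _ => (Set.indicator_of_mem (hx i trivial) _).symm
    · rw [Set.indicator_of_notMem hx]
      simp only [Set.mem_univ_pi, not_forall] at hx
      obtain ⟨i, hi⟩ := hx
      exact (Finset.prod_eq_zero (Finset.mem_univ i) (Set.indicator_of_notMem hi _)).symm
  simp_rw [this]
  rw [lintegral_pi_prod μ fun i => (hf i).indicator (hs i)]
  refine Finset.prod_congr rfl fun i _ => ?_
  rw [withDensity_apply _ (hs i), lintegral_indicator (hs i)]

/-- The joint law of one channel input and output for independent inputs. -/
noncomputable def channelLaw (W : Kernel (X₁ × X₂) (Y₁ × Y₂ × Z)) (μ₁ : Measure X₁)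
    (μ₂ : Measure X₂) : Measure ((X₁ × X₂) × (Y₁ × Y₂ × Z)) :=
  (μ₁.prod μ₂) ⊗ₘ W

variable (W : Kernel (X₁ × X₂) (Y₁ × Y₂ × Z)) [IsMarkovKernel W]

instance (μ₁ : Measure X₁) (μ₂ : Measure X₂) [IsProbabilityMeasure μ₁]
    [IsProbabilityMeasure μ₂] : IsProbabilityMeasure (channelLaw W μ₁ μ₂) := by
  unfold channelLaw; infer_instance

lemma lintegral_channelLaw (μ₁ : Measure X₁) (μ₂ : Measure X₂) [SFinite μ₁] [SFinite μ₂]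
    {f : (X₁ × X₂) × (Y₁ × Y₂ × Z) → ℝ≥0∞} (hf : Measurable f) :
    ∫⁻ ω, f ω ∂(channelLaw W μ₁ μ₂)
      = ∫⁻ x₁, ∫⁻ x₂, ∫⁻ o, f ((x₁, x₂), o) ∂(W (x₁, x₂)) ∂μ₂ ∂μ₁ := by
  rw [channelLaw, Measure.lintegral_compProd hf, lintegral_prod _ (by
    exact (Measurable.lintegral_kernel_prod_right' hf).aemeasurable)]

lemma lintegral_blockLaw_pi_prod (μ₁ : Fin n → Measure X₁) (μ₂ : Fin n → Measure X₂)
    [∀ k, IsProbabilityMeasure (μ₁ k)] [∀ k, IsProbabilityMeasure (μ₂ k)]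
    {f : Fin n → (X₁ × X₂) × (Y₁ × Y₂ × Z) → ℝ≥0∞} (hf : ∀ k, Measurable (f k)) :
    ∫⁻ ω, ∏ k, f k ((ω.1.1 k, ω.1.2 k), ω.2 k) ∂(blockLaw W (Measure.pi μ₁) (Measure.pi μ₂))
      = ∏ k, ∫⁻ ω, f k ω ∂(channelLaw W (μ₁ k) (μ₂ k)) := by
  have hm : Measurable fun ω : ((Fin n → X₁) × (Fin n → X₂)) × (Fin n → Y₁ × Y₂ × Z) =>
      ∏ k, f k ((ω.1.1 k, ω.1.2 k), ω.2 k) :=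
    Finset.measurable_prod _ fun k _ => (hf k).comp (by fun_prop)
  rw [lintegral_blockLaw W _ _ hm]
  have h1 : ∀ k, Measurable fun x : X₁ × X₂ => ∫⁻ o, f k (x, o) ∂(W x) := fun k =>
    Measurable.lintegral_kernel_prod_right' (hf k)
  have h2 : ∀ k, Measurable fun x₁ : X₁ => ∫⁻ x₂, ∫⁻ o, f k ((x₁, x₂), o) ∂(W (x₁, x₂)) ∂(μ₂ k) :=
    fun k => (h1 k).lintegral_prod_right'
  have e1 : ∀ (x₁ : Fin n → X₁) (x₂ : Fin n → X₂), ∫⁻ o, ∏ k, f k ((x₁ k, x₂ k), o k)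
      ∂(Measure.pi fun k => W (x₁ k, x₂ k)) = ∏ k, ∫⁻ o, f k ((x₁ k, x₂ k), o) ∂(W (x₁ k, x₂ k)) :=
    fun x₁ x₂ => lintegral_pi_prod (fun k => W (x₁ k, x₂ k)) fun k => (hf k).comp (by fun_prop)
  simp_rw [e1]
  have e2 : ∀ x₁ : Fin n → X₁, ∫⁻ x₂, ∏ k, ∫⁻ o, f k ((x₁ k, x₂ k), o) ∂(W (x₁ k, x₂ k))
      ∂(Measure.pi μ₂) = ∏ k, ∫⁻ x₂, ∫⁻ o, f k ((x₁ k, x₂), o) ∂(W (x₁ k, x₂)) ∂(μ₂ k) :=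
    fun x₁ => lintegral_pi_prod μ₂ fun k => (h1 k).comp (by fun_prop)
  simp_rw [e2]
  rw [lintegral_pi_prod μ₁ h2]
  exact Finset.prod_congr rfl fun k _ => (lintegral_channelLaw W _ _ (hf k)).symm

lemma eveLaw_pi (μ₁ : Fin n → Measure X₁) (μ₂ : Fin n → Measure X₂)
    [∀ k, IsProbabilityMeasure (μ₁ k)] [∀ k, IsProbabilityMeasure (μ₂ k)] :
    eveLaw W (Measure.pi μ₁) (Measure.pi μ₂)
      = Measure.pi fun k => (channelLaw W (μ₁ k) (μ₂ k)).map fun ω => ω.2.2.2 := by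
  have hp : ∀ k, IsProbabilityMeasure ((channelLaw W (μ₁ k) (μ₂ k)).map fun ω => ω.2.2.2) :=
    fun k => Measure.isProbabilityMeasure_map (by fun_prop)
  refine (Measure.pi_eq fun s hs => ?_).symm
  rw [eveLaw_apply W _ _ (.univ_pi hs)]
  have : ∀ z : Fin n → Z, (Set.univ.pi s).indicator (1 : (Fin n → Z) → ℝ≥0∞) z
      = ∏ k, (s k).indicator (1 : Z → ℝ≥0∞) (z k) := by
    intro x
    by_cases hx : x ∈ Set.univ.pi s
    · rw [Set.indicator_of_mem hx]
      refine (Finset.prod_eq_one fun i _ => Set.indicator_of_mem (hx i trivial) _).symm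
    · rw [Set.indicator_of_notMem hx]
      simp only [Set.mem_univ_pi, not_forall] at hx
      obtain ⟨i, hi⟩ := hx
      exact (Finset.prod_eq_zero (Finset.mem_univ i) (Set.indicator_of_notMem hi _)).symm
  simp_rw [this]
  rw [lintegral_blockLaw_pi_prod W μ₁ μ₂ (f := fun k ω => (s k).indicator 1 ω.2.2.2)
    fun k => (measurable_one.indicator (hs k)).comp (by fun_prop)]
  refine Finset.prod_congr rfl fun k _ => ?_
  rw [← lintegral_indicator_one (hs k), lintegral_map (measurable_one.indicator (hs k))
    (by fun_prop)]

variable [Finite A] [MeasurableSpace A] [MeasurableSingletonClass A] [Finite B] [MeasurableSpace B]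
  [MeasurableSingletonClass B]

lemma lintegral_letterLaw_comp {A B : Type*} [MeasurableSpace A] [MeasurableSpace B]
    (P₁ : Input A X₁) (P₂ : Input B X₂)
    {f : A → B → (X₁ × X₂) × (Y₁ × Y₂ × Z) → ℝ≥0∞}
    (hf : Measurable fun ω : ((A × X₁) × (B × X₂)) × (Y₁ × Y₂ × Z) =>
      f ω.1.1.1 ω.1.2.1 ((ω.1.1.2, ω.1.2.2), ω.2)) :
    ∫⁻ ω, f ω.1.1.1 ω.1.2.1 ((ω.1.1.2, ω.1.2.2), ω.2) ∂(letterLaw W P₁ P₂)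
      = ∫⁻ a, ∫⁻ b, ∫⁻ ω, f a b ω ∂(channelLaw W (P₁.pre a) (P₂.pre b)) ∂P₂.pV ∂P₁.pV := by
  have hfab : ∀ a b, Measurable (f a b) := fun a b =>
    hf.comp (f := fun ω : (X₁ × X₂) × (Y₁ × Y₂ × Z) => (((a, ω.1.1), (b, ω.1.2)), ω.2))
      (by fun_prop)
  simp_rw [lintegral_channelLaw W _ _ (hfab _ _)]
  rw [letterLaw, Measure.lintegral_compProd hf]
  have h1 : Measurable fun p : (A × X₁) × (B × X₂) =>
      ∫⁻ o, f p.1.1 p.2.1 ((p.1.2, p.2.2), o) ∂(W (p.1.2, p.2.2)) := by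
    have := Measurable.lintegral_kernel_prod_right'
      (κ := W.comap (fun p : (A × X₁) × (B × X₂) => (p.1.2, p.2.2)) (by fun_prop)) hf
    exact this
  have e0 : ∫⁻ p, ∫⁻ o, f p.1.1 p.2.1 ((p.1.2, p.2.2), o)
      ∂((W.comap (fun p : (A × X₁) × (B × X₂) => (p.1.2, p.2.2)) (by fun_prop)) p)
      ∂(P₁.joint.prod P₂.joint) = ∫⁻ p, ∫⁻ o, f p.1.1 p.2.1 ((p.1.2, p.2.2), o)
      ∂(W (p.1.2, p.2.2)) ∂(P₁.joint.prod P₂.joint) := rfl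
  rw [e0, lintegral_prod _ h1.aemeasurable, Input.joint,
    Measure.lintegral_compProd h1.lintegral_prod_right']
  refine lintegral_congr fun a => ?_
  have e1 : ∀ x₁ : X₁, ∫⁻ y, ∫⁻ o, f a y.1 ((x₁, y.2), o) ∂(W (x₁, y.2)) ∂P₂.joint
      = ∫⁻ b, ∫⁻ x₂, ∫⁻ o, f a b ((x₁, x₂), o) ∂(W (x₁, x₂)) ∂(P₂.pre b) ∂P₂.pV := fun x₁ => by
    rw [Input.joint, Measure.lintegral_compProd (by
      exact h1.comp (f := fun y : B × X₂ => ((a, x₁), y)) (by fun_prop))]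
  simp_rw [e1]
  rw [lintegral_lintegral_swap]
  have h3 : Measurable fun q : (X₁ × B) × X₂ => ∫⁻ o, f a q.1.2 ((q.1.1, q.2), o) ∂(W (q.1.1, q.2)) :=
    h1.comp (f := fun q : (X₁ × B) × X₂ => ((a, q.1.1), (q.1.2, q.2))) (by fun_prop)
  exact (Measurable.lintegral_kernel_prod_right'
    (κ := P₂.pre.comap (fun q : X₁ × B => q.2) measurable_snd) h3).aemeasurable

variable (P₁ : Fin n → Input A X₁) (P₂ : Fin n → Input B X₂)

lemma lintegral_blockLaw_letterLaw_prod {f : Fin n → A → B → (X₁ × X₂) × (Y₁ × Y₂ × Z) → ℝ≥0∞}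
    (hf : ∀ k a b, Measurable (f k a b)) :
    ∫⁻ u, ∫⁻ v, ∫⁻ ω, ∏ k, f k (u k) (v k) ((ω.1.1 k, ω.1.2 k), ω.2 k)
        ∂(blockLaw W (Measure.pi fun k => (P₁ k).pre (u k)) (Measure.pi fun k => (P₂ k).pre (v k)))
        ∂(Measure.pi fun k => (P₂ k).pV) ∂(Measure.pi fun k => (P₁ k).pV)
      = ∏ k, ∫⁻ ω, f k ω.1.1.1 ω.1.2.1 ((ω.1.1.2, ω.1.2.2), ω.2) ∂(letterLaw W (P₁ k) (P₂ k)) := by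
  have e0 : ∀ (u : Fin n → A) (v : Fin n → B),
      ∫⁻ ω, ∏ k, f k (u k) (v k) ((ω.1.1 k, ω.1.2 k), ω.2 k)
        ∂(blockLaw W (Measure.pi fun k => (P₁ k).pre (u k)) (Measure.pi fun k => (P₂ k).pre (v k)))
      = ∏ k, ∫⁻ ω, f k (u k) (v k) ω ∂(channelLaw W ((P₁ k).pre (u k)) ((P₂ k).pre (v k))) :=
    fun u v => lintegral_blockLaw_pi_prod W _ _ fun k => hf k (u k) (v k)
  simp_rw [e0]
  have e1 : ∀ u : Fin n → A, ∫⁻ v, ∏ k, ∫⁻ ω, f k (u k) (v k) ω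
        ∂(channelLaw W ((P₁ k).pre (u k)) ((P₂ k).pre (v k))) ∂(Measure.pi fun k => (P₂ k).pV)
      = ∏ k, ∫⁻ b, ∫⁻ ω, f k (u k) b ω ∂(channelLaw W ((P₁ k).pre (u k)) ((P₂ k).pre b))
        ∂(P₂ k).pV := fun u => lintegral_pi_prod (fun k => (P₂ k).pV)
    (f := fun k b => ∫⁻ ω, f k (u k) b ω ∂(channelLaw W ((P₁ k).pre (u k)) ((P₂ k).pre b)))
    fun k => measurable_of_finite _
  simp_rw [e1]
  rw [lintegral_pi_prod (fun k => (P₁ k).pV)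
    (f := fun k a => ∫⁻ b, ∫⁻ ω, f k a b ω ∂(channelLaw W ((P₁ k).pre a) ((P₂ k).pre b)) ∂(P₂ k).pV)
    fun k => measurable_of_finite _]
  refine Finset.prod_congr rfl fun k _ => ?_
  rw [lintegral_letterLaw_comp]
  have : Measurable fun ω : (A × B) × ((X₁ × X₂) × (Y₁ × Y₂ × Z)) => f k ω.1.1 ω.1.2 ω.2 :=
    measurable_from_prod_countable_right fun p => hf k p.1 p.2
  exact this.comp (f := fun ω : ((A × X₁) × (B × X₂)) × (Y₁ × Y₂ × Z) =>
    ((ω.1.1.1, ω.1.2.1), ((ω.1.1.2, ω.1.2.2), ω.2))) (by fun_prop)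

end ProductLetters

section LetterBounds

variable {X₁ X₂ Y₁ Y₂ Z A B : Type*} [MeasurableSpace X₁] [MeasurableSpace X₂] [MeasurableSpace Y₁]
  [MeasurableSpace Y₂] [MeasurableSpace Z] {n : ℕ}
  [Finite A] [MeasurableSpace A] [MeasurableSingletonClass A] [Finite B] [MeasurableSpace B]
  [MeasurableSingletonClass B]

lemma measurable_integral_of_finite {S : Type*} [MeasurableSpace S] (p : Measure A)
    [IsFiniteMeasure p] {F : A → S → ℝ} (hF : ∀ a, Measurable (F a)) :
    Measurable fun z => ∫ a, F a z ∂p := by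
  have := Fintype.ofFinite A
  simp_rw [fun z => integral_fintype (μ := p) (f := fun a => F a z) Integrable.of_finite]
  exact Finset.measurable_sum _ fun a _ => by
    simpa using (hF a).const_mul (p.real {a})

lemma integral_integral_pi_prod (p : Fin n → Measure A) (q : Fin n → Measure B)
    [∀ i, IsProbabilityMeasure (p i)] [∀ i, IsProbabilityMeasure (q i)] (G : Fin n → A → B → ℝ) :
    ∫ u, ∫ v, ∏ i, G i (u i) (v i) ∂(Measure.pi q) ∂(Measure.pi p)
      = ∏ i, ∫ a, ∫ b, G i a b ∂(q i) ∂(p i) := by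
  have e : ∀ u : Fin n → A, ∫ v, ∏ i, G i (u i) (v i) ∂(Measure.pi q)
      = ∏ i, ∫ b, G i (u i) b ∂(q i) := fun u =>
    integral_fintype_prod_eq_prod (f := fun i b => G i (u i) b)
  simp_rw [e]
  exact integral_fintype_prod_eq_prod (f := fun i a => ∫ b, G i a b ∂(q i))

lemma resolvTerm_pi_prod (p : Fin n → Measure A) (q : Fin n → Measure B)
    [∀ i, IsProbabilityMeasure (p i)] [∀ i, IsProbabilityMeasure (q i)] {h : Fin n → A → B → ℝ}
    (hh : ∀ i a b, 0 ≤ h i a b) {a b : ℝ} (ha : 0 < a) (hb : 0 < b) (s : ℝ) :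
    resolvTerm (Measure.pi p) (Measure.pi q) (fun u v => ∏ i, h i (u i) (v i)) a b s
      = (a * b) ^ (-s) * ∏ i, ∫ x, ∫ y, h i x y * h i x y ^ s ∂(q i) ∂(p i)
        + a ^ (-s) * ∏ i, ∫ x, ∫ y, h i x y * (∫ y', h i x y' ∂(q i)) ^ s ∂(q i) ∂(p i)
        + b ^ (-s) * ∏ i, ∫ x, ∫ y, h i x y * (∫ x', h i x' y ∂(p i)) ^ s ∂(q i) ∂(p i) := by
  have e1 : ∀ u : Fin n → A, ∫ v, ∏ i, h i (u i) (v i) ∂(Measure.pi q)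
      = ∏ i, ∫ y, h i (u i) y ∂(q i) := fun u =>
    integral_fintype_prod_eq_prod (f := fun i b => h i (u i) b)
  have e2 : ∀ v : Fin n → B, ∫ u, ∏ i, h i (u i) (v i) ∂(Measure.pi p)
      = ∏ i, ∫ x, h i x (v i) ∂(p i) := fun v =>
    integral_fintype_prod_eq_prod (f := fun i x => h i x (v i))
  have n1 : ∀ i x, 0 ≤ ∫ y, h i x y ∂(q i) := fun i x => integral_nonneg (hh i x)
  have n2 : ∀ i y, 0 ≤ ∫ x, h i x y ∂(p i) := fun i y => integral_nonneg fun x => hh i x y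
  simp only [resolvTerm, e1, e2]
  have e3 : ∀ (u : Fin n → A) (v : Fin n → B), (∏ i, h i (u i) (v i)) *
      (((∏ i, h i (u i) (v i)) / (a * b)) ^ s + ((∏ i, ∫ y, h i (u i) y ∂(q i)) / a) ^ s
        + ((∏ i, ∫ x, h i x (v i) ∂(p i)) / b) ^ s)
      = (a * b) ^ (-s) * (∏ i, h i (u i) (v i) * h i (u i) (v i) ^ s)
        + a ^ (-s) * (∏ i, h i (u i) (v i) * (∫ y', h i (u i) y' ∂(q i)) ^ s)
        + b ^ (-s) * (∏ i, h i (u i) (v i) * (∫ x', h i x' (v i) ∂(p i)) ^ s) := by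
    intro u v
    rw [Real.div_rpow (Finset.prod_nonneg fun i _ => hh _ _ _) (by positivity),
      Real.div_rpow (Finset.prod_nonneg fun i _ => n1 _ _) (by positivity),
      Real.div_rpow (Finset.prod_nonneg fun i _ => n2 _ _) (by positivity),
      ← Real.finsetProd_rpow _ _ fun i _ => hh _ _ _, ← Real.finsetProd_rpow _ _ fun i _ => n1 _ _,
      ← Real.finsetProd_rpow _ _ fun i _ => n2 _ _, Finset.prod_mul_distrib,
      Finset.prod_mul_distrib, Finset.prod_mul_distrib, Real.rpow_neg (by positivity),
      Real.rpow_neg ha.le, Real.rpow_neg hb.le]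
    ring
  simp_rw [e3]
  have hIu : ∀ F : (Fin n → A) → ℝ, Integrable F (Measure.pi p) := fun F => Integrable.of_finite
  have hIv : ∀ F : (Fin n → B) → ℝ, Integrable F (Measure.pi q) := fun F => Integrable.of_finite
  simp_rw [integral_add (hIv _) (hIv _)]
  simp_rw [integral_const_mul]
  rw [integral_add (hIu _) (hIu _), integral_add (hIu _) (hIu _)]
  simp_rw [integral_const_mul]
  rw [integral_integral_pi_prod p q fun i x y => h i x y * h i x y ^ s,
    integral_integral_pi_prod p q fun i x y => h i x y * (∫ y', h i x y' ∂(q i)) ^ s,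
    integral_integral_pi_prod p q fun i x y => h i x y * (∫ x', h i x' y ∂(p i)) ^ s]

lemma lintegral_resolvTerm_pi_le (p : Fin n → Measure A) (q : Fin n → Measure B)
    [∀ i, IsProbabilityMeasure (p i)] [∀ i, IsProbabilityMeasure (q i)] (Q : Fin n → Measure Z)
    [∀ i, IsProbabilityMeasure (Q i)] {h : Fin n → A → B → Z → ℝ}
    (hm : ∀ i a b, Measurable (h i a b))
    (hh : ∀ i a b z, 0 ≤ h i a b z) {a b : ℝ} (ha : 0 < a) (hb : 0 < b) {s : ℝ}
    {e₁₂ e₁ e₂ : Fin n → ℝ≥0∞}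
    (h₁₂ : ∀ i, ∫⁻ z, ENNReal.ofReal (∫ x, ∫ y, h i x y z * h i x y z ^ s ∂(q i) ∂(p i)) ∂(Q i)
      ≤ e₁₂ i)
    (h₁ : ∀ i, ∫⁻ z, ENNReal.ofReal
      (∫ x, ∫ y, h i x y z * (∫ y', h i x y' z ∂(q i)) ^ s ∂(q i) ∂(p i)) ∂(Q i) ≤ e₁ i)
    (h₂ : ∀ i, ∫⁻ z, ENNReal.ofReal
      (∫ x, ∫ y, h i x y z * (∫ x', h i x' y z ∂(p i)) ^ s ∂(q i) ∂(p i)) ∂(Q i) ≤ e₂ i) :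
    ∫⁻ z, ENNReal.ofReal (resolvTerm (Measure.pi p) (Measure.pi q)
        (fun u v => ∏ i, h i (u i) (v i) (z i)) a b s) ∂(Measure.pi Q)
      ≤ ENNReal.ofReal ((a * b) ^ (-s)) * ∏ i, e₁₂ i + ENNReal.ofReal (a ^ (-s)) * ∏ i, e₁ i
        + ENNReal.ofReal (b ^ (-s)) * ∏ i, e₂ i := by
  have key : ∀ (G : Fin n → A → B → Z → ℝ) (hG : ∀ i x y, Measurable (G i x y))
      (hG0 : ∀ i x y z, 0 ≤ G i x y z) (e : Fin n → ℝ≥0∞)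
      (hGe : ∀ i, ∫⁻ z, ENNReal.ofReal (∫ x, ∫ y, G i x y z ∂(q i) ∂(p i)) ∂(Q i) ≤ e i) (c : ℝ)
      (hc : 0 ≤ c),
      Measurable (fun z : Fin n → Z =>
        ENNReal.ofReal (c * ∏ i, ∫ x, ∫ y, G i x y (z i) ∂(q i) ∂(p i))) ∧
      ∫⁻ z, ENNReal.ofReal (c * ∏ i, ∫ x, ∫ y, G i x y (z i) ∂(q i) ∂(p i)) ∂(Measure.pi Q)
        ≤ ENNReal.ofReal c * ∏ i, e i := by
    intro G hG hG0 e hGe c hc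
    have hm' : ∀ i, Measurable fun z => ∫ x, ∫ y, G i x y z ∂(q i) ∂(p i) := fun i =>
      measurable_integral_of_finite _ fun x => measurable_integral_of_finite _ fun y => hG i x y
    have hn : ∀ i z, 0 ≤ ∫ x, ∫ y, G i x y z ∂(q i) ∂(p i) := fun i z =>
      integral_nonneg fun x => integral_nonneg fun y => hG0 i x y z
    constructor
    · exact (Measurable.const_mul (Finset.measurable_prod _ fun i _ =>
        (hm' i).comp (measurable_pi_apply i)) c).ennreal_ofReal
    · simp_rw [ENNReal.ofReal_mul hc, ENNReal.ofReal_prod_of_nonneg fun i _ => hn i _]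
      rw [lintegral_const_mul' _ _ ENNReal.ofReal_ne_top,
        lintegral_pi_prod Q fun i => (hm' i).ennreal_ofReal]
      gcongr with i
      exact hGe i
  have hI : ∀ i x, Measurable fun z => ∫ y', h i x y' z ∂(q i) := fun i x =>
    measurable_integral_of_finite _ fun y => hm i x y
  have hJ : ∀ i y, Measurable fun z => ∫ x', h i x' y z ∂(p i) := fun i y =>
    measurable_integral_of_finite _ fun x => hm i x y
  have n1 : ∀ i x z, 0 ≤ ∫ y, h i x y z ∂(q i) := fun i x z => integral_nonneg fun y => hh i x y z
  have n2 : ∀ i y z, 0 ≤ ∫ x, h i x y z ∂(p i) := fun i y z => integral_nonneg fun x => hh i x y z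
  obtain ⟨m1, k1⟩ := key (fun i x y z => h i x y z * h i x y z ^ s)
    (fun i x y => (hm i x y).mul ((hm i x y).pow_const s))
    (fun i x y z => mul_nonneg (hh _ _ _ _) (Real.rpow_nonneg (hh _ _ _ _) _)) e₁₂ h₁₂
    ((a * b) ^ (-s)) (by positivity)
  obtain ⟨m2, k2⟩ := key (fun i x y z => h i x y z * (∫ y', h i x y' z ∂(q i)) ^ s)
    (fun i x y => (hm i x y).mul ((hI i x).pow_const s))
    (fun i x y z => mul_nonneg (hh _ _ _ _) (Real.rpow_nonneg (n1 _ _ _) _)) e₁ h₁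
    (a ^ (-s)) (by positivity)
  obtain ⟨m3, k3⟩ := key (fun i x y z => h i x y z * (∫ x', h i x' y z ∂(p i)) ^ s)
    (fun i x y => (hm i x y).mul ((hJ i y).pow_const s))
    (fun i x y z => mul_nonneg (hh _ _ _ _) (Real.rpow_nonneg (n2 _ _ _) _)) e₂ h₂
    (b ^ (-s)) (by positivity)
  have m12 : Measurable fun z : Fin n → Z => ENNReal.ofReal ((a * b) ^ (-s) *
        ∏ i, ∫ x, ∫ y, h i x y (z i) * h i x y (z i) ^ s ∂(q i) ∂(p i))
      + ENNReal.ofReal (a ^ (-s) *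
        ∏ i, ∫ x, ∫ y, h i x y (z i) * (∫ y', h i x y' (z i) ∂(q i)) ^ s ∂(q i) ∂(p i)) := m1.add m2
  have hsum := add_le_add (add_le_add k1 k2) k3
  rw [← lintegral_add_left m1, ← lintegral_add_left m12] at hsum
  refine (lintegral_mono fun z => ?_).trans hsum
  rw [resolvTerm_pi_prod p q (h := fun i x y => h i x y (z i)) (fun i x y => hh i x y (z i)) ha hb]
  exact ENNReal.ofReal_add_le.trans (add_le_add_left ENNReal.ofReal_add_le _)

variable (W : Kernel (X₁ × X₂) (Y₁ × Y₂ × Z)) [IsMarkovKernel W]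
  (P₁ : Fin n → Input A X₁) (P₂ : Fin n → Input B X₂)

lemma lintegral_blockLaw_prod_le_le {g : Fin n → A → B → (X₁ × X₂) × (Y₁ × Y₂ × Z) → ℝ≥0∞}
    (hg : ∀ k a b, Measurable (g k a b)) (hg' : ∀ k a b ω, g k a b ω ≠ ⊤) {γ : ℝ≥0∞} (hγ : γ ≠ 0)
    (hγ' : γ ≠ ⊤) {s : ℝ} (hs : 0 < s) :
    ∫⁻ u, ∫⁻ v, blockLaw W (Measure.pi fun k => (P₁ k).pre (u k))
          (Measure.pi fun k => (P₂ k).pre (v k))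
          {ω | ∏ k, g k (u k) (v k) ((ω.1.1 k, ω.1.2 k), ω.2 k) ≤ γ}
        ∂(Measure.pi fun k => (P₂ k).pV) ∂(Measure.pi fun k => (P₁ k).pV)
      ≤ γ ^ s * ∏ k, ∫⁻ ω, g k ω.1.1.1 ω.1.2.1 ((ω.1.1.2, ω.1.2.2), ω.2) ^ (-s)
        ∂(letterLaw W (P₁ k) (P₂ k)) := by
  rw [← lintegral_blockLaw_letterLaw_prod W P₁ P₂ (f := fun k a b ω => g k a b ω ^ (-s))
    fun k a b => (hg k a b).pow_const _]
  have hc : γ ^ s ≠ ⊤ := ENNReal.rpow_ne_top_of_nonneg hs.le hγ'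
  simp_rw [← lintegral_const_mul' _ _ hc]
  refine lintegral_mono fun u => lintegral_mono fun v => ?_
  have hms : Measurable fun ω : ((Fin n → X₁) × (Fin n → X₂)) × (Fin n → Y₁ × Y₂ × Z) =>
      ∏ k, g k (u k) (v k) ((ω.1.1 k, ω.1.2 k), ω.2 k) :=
    Finset.measurable_prod _ fun k _ => (hg k (u k) (v k)).comp (by fun_prop)
  rw [← lintegral_indicator_one (measurableSet_le hms measurable_const)]
  refine lintegral_mono fun ω => ?_
  refine Set.indicator_apply_le' (fun hω => ?_) (fun _ => bot_le)
  have hω' : ∏ k, g k (u k) (v k) ((ω.1.1 k, ω.1.2 k), ω.2 k) ≤ γ := hω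
  simp_rw [ENNReal.rpow_neg]
  rw [← ENNReal.prod_inv_distrib fun i _ j _ _ =>
      Or.inr (ENNReal.rpow_ne_top_of_nonneg hs.le (hg' _ _ _ _)),
    ENNReal.prod_rpow_of_ne_top fun i _ => hg' _ _ _ _]
  have h1 := ENNReal.inv_le_inv.2 (ENNReal.rpow_le_rpow hω' hs.le)
  calc (1 : ℝ≥0∞) = γ ^ s * (γ ^ s)⁻¹ :=
        (ENNReal.mul_inv_cancel (by simp [hγ, hγ', hs]) hc).symm
    _ ≤ _ := by gcongr

lemma lintegral_blockLaw_lt_prod_le {g : Fin n → A → B → (X₁ × X₂) × (Y₁ × Y₂ × Z) → ℝ≥0∞}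
    (hg : ∀ k a b, Measurable (g k a b)) {γ : ℝ≥0∞} (hγ : γ ≠ 0) :
    ∫⁻ u, ∫⁻ v, blockLaw W (Measure.pi fun k => (P₁ k).pre (u k))
          (Measure.pi fun k => (P₂ k).pre (v k))
          {ω | γ < ∏ k, g k (u k) (v k) ((ω.1.1 k, ω.1.2 k), ω.2 k)}
        ∂(Measure.pi fun k => (P₂ k).pV) ∂(Measure.pi fun k => (P₁ k).pV)
      ≤ γ⁻¹ * ∏ k, ∫⁻ ω, g k ω.1.1.1 ω.1.2.1 ((ω.1.1.2, ω.1.2.2), ω.2)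
        ∂(letterLaw W (P₁ k) (P₂ k)) := by
  rw [← lintegral_blockLaw_letterLaw_prod W P₁ P₂ hg]
  have hc : γ⁻¹ ≠ ⊤ := by simpa using hγ
  simp_rw [← lintegral_const_mul' _ _ hc]
  refine lintegral_mono fun u => lintegral_mono fun v => ?_
  have hms : Measurable fun ω : ((Fin n → X₁) × (Fin n → X₂)) × (Fin n → Y₁ × Y₂ × Z) =>
      ∏ k, g k (u k) (v k) ((ω.1.1 k, ω.1.2 k), ω.2 k) :=
    Finset.measurable_prod _ fun k _ => (hg k (u k) (v k)).comp (by fun_prop)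
  rw [← lintegral_indicator_one (measurableSet_lt measurable_const hms)]
  refine lintegral_mono fun ω => ?_
  refine Set.indicator_apply_le' (fun hω => ?_) (fun _ => bot_le)
  have hω' : γ < ∏ k, g k (u k) (v k) ((ω.1.1 k, ω.1.2 k), ω.2 k) := hω
  calc (1 : ℝ≥0∞) = γ⁻¹ * γ := (ENNReal.inv_mul_cancel hγ (hω'.trans_le le_top).ne).symm
    _ ≤ _ := by gcongr

/-- Exponential moment bounds for one letter: `resolv` controls the eavesdropper's channel, and
`decode₁`, `decode₂` control the decoding of the first and of the second user's codeword. -/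
structure LetterBounds (W : Kernel (X₁ × X₂) (Y₁ × Y₂ × Z)) [IsMarkovKernel W] (P₁ : Input A X₁)
    (P₂ : Input B X₂) (s r₁₂ r₁ r₂ t₁ t₂ : ℝ) : Prop where
  resolv : ∃ (Q : Measure Z) (k : A → B → Z → ℝ), IsProbabilityMeasure Q ∧
    (∀ a b, Measurable (k a b)) ∧ (∀ a b z, 0 ≤ k a b z) ∧
    (∀ a b, P₁.pV {a} ≠ 0 → P₂.pV {b} ≠ 0 →
      (channelLaw W (P₁.pre a) (P₂.pre b)).map (fun ω => ω.2.2.2)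
        = Q.withDensity fun z => ENNReal.ofReal (k a b z)) ∧
    (∀ᵐ z ∂Q, ∫ a, ∫ b, k a b z ∂P₂.pV ∂P₁.pV ≤ 1) ∧
    ∫⁻ z, ENNReal.ofReal (∫ a, ∫ b, k a b z * k a b z ^ s ∂P₂.pV ∂P₁.pV) ∂Q
      ≤ ENNReal.ofReal (Real.exp (s * r₁₂)) ∧
    ∫⁻ z, ENNReal.ofReal (∫ a, ∫ b, k a b z * (∫ b', k a b' z ∂P₂.pV) ^ s ∂P₂.pV ∂P₁.pV) ∂Q
      ≤ ENNReal.ofReal (Real.exp (s * r₁)) ∧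
    ∫⁻ z, ENNReal.ofReal (∫ a, ∫ b, k a b z * (∫ a', k a' b z ∂P₁.pV) ^ s ∂P₂.pV ∂P₁.pV) ∂Q
      ≤ ENNReal.ofReal (Real.exp (s * r₂))
  decode₁ : ∃ f : A → X₂ × Y₂ → ℝ≥0∞, (∀ a, Measurable (f a)) ∧ (∀ a ξ, f a ξ ≠ ⊤) ∧
    ∫⁻ ω, f ω.1.1.1 (ω.1.2.2, ω.2.2.1) ^ (-s) ∂(letterLaw W P₁ P₂)
      ≤ ENNReal.ofReal (Real.exp (-(s * t₁))) ∧
    ∫⁻ a, ∫⁻ ω, f a (ω.1.2.2, ω.2.2.1) ∂(letterLaw W P₁ P₂) ∂P₁.pV ≤ 1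
  decode₂ : ∃ f : B → X₁ × Y₁ → ℝ≥0∞, (∀ b, Measurable (f b)) ∧ (∀ b ξ, f b ξ ≠ ⊤) ∧
    ∫⁻ ω, f ω.1.2.1 (ω.1.1.2, ω.2.1) ^ (-s) ∂(letterLaw W P₁ P₂)
      ≤ ENNReal.ofReal (Real.exp (-(s * t₂))) ∧
    ∫⁻ b, ∫⁻ ω, f b (ω.1.1.2, ω.2.1) ∂(letterLaw W P₁ P₂) ∂P₂.pV ≤ 1

variable {s : ℝ} {r₁₂ r₁ r₂ t₁ t₂ : Fin n → ℝ}

lemma prod_ofReal_exp (s : ℝ) (r : Fin n → ℝ) :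
    ∏ k, ENNReal.ofReal (Real.exp (s * r k)) = ENNReal.ofReal (Real.exp (s * ∑ k, r k)) := by
  rw [← ENNReal.ofReal_prod_of_nonneg fun i _ => (Real.exp_pos _).le, ← Real.exp_sum,
    Finset.mul_sum]

lemma prod_ofReal_exp_neg (s : ℝ) (r : Fin n → ℝ) :
    ∏ k, ENNReal.ofReal (Real.exp (-(s * r k)))
      = ENNReal.ofReal (Real.exp (-(s * ∑ k, r k))) := by
  have := prod_ofReal_exp (-s) r
  simpa only [neg_mul] using this

lemma exists_decoding_sets₁ (h : ∀ k, LetterBounds W (P₁ k) (P₂ k) s (r₁₂ k) (r₁ k) (r₂ k)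
    (t₁ k) (t₂ k)) (hs : 0 < s) (τ : ℝ) :
    ∃ S : (Fin n → A) → Set ((Fin n → X₂) × (Fin n → Y₂)), (∀ u, MeasurableSet (S u)) ∧
      ∫⁻ u, ∫⁻ v, blockLaw W (Measure.pi fun k => (P₁ k).pre (u k))
          (Measure.pi fun k => (P₂ k).pre (v k)) {ω | (ω.1.2, fun k => (ω.2 k).2.1) ∉ S u}
          ∂(Measure.pi fun k => (P₂ k).pV) ∂(Measure.pi fun k => (P₁ k).pV)
        ≤ ENNReal.ofReal (Real.exp (s * (τ - ∑ k, t₁ k))) ∧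
      ∫⁻ u', ∫⁻ u, ∫⁻ v, blockLaw W (Measure.pi fun k => (P₁ k).pre (u k))
          (Measure.pi fun k => (P₂ k).pre (v k)) {ω | (ω.1.2, fun k => (ω.2 k).2.1) ∈ S u'}
          ∂(Measure.pi fun k => (P₂ k).pV) ∂(Measure.pi fun k => (P₁ k).pV)
          ∂(Measure.pi fun k => (P₁ k).pV)
        ≤ ENNReal.ofReal (Real.exp (-τ)) := by
  choose f hfm hft hmiss hcoll using fun k => (h k).decode₁
  set γ : ℝ≥0∞ := ENNReal.ofReal (Real.exp τ) with hγ
  have hγ0 : γ ≠ 0 := by simp [hγ, Real.exp_pos]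
  have hγt : γ ≠ ⊤ := ENNReal.ofReal_ne_top
  refine ⟨fun u => {ξ | γ < ∏ k, f k (u k) (ξ.1 k, ξ.2 k)}, fun u => ?_, ?_, ?_⟩
  · exact measurableSet_lt measurable_const
      (Finset.measurable_prod _ fun k _ => (hfm k (u k)).comp (by fun_prop))
  · have := lintegral_blockLaw_prod_le_le W P₁ P₂ (g := fun k a b ω => f k a (ω.1.2, ω.2.2.1))
      (fun k a b => (hfm k a).comp (by fun_prop)) (fun k a b ω => hft k a _) hγ0 hγt hs
    simp only [Set.mem_ofPred_eq, not_lt]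
    refine this.trans ((mul_le_mul_right (Finset.prod_le_prod' fun k _ => hmiss k) _).trans ?_)
    rw [prod_ofReal_exp_neg, hγ, ENNReal.ofReal_rpow_of_pos (Real.exp_pos _), ← Real.exp_mul,
      ← ENNReal.ofReal_mul (Real.exp_pos _).le, ← Real.exp_add]
    exact le_of_eq (by ring_nf)
  · have h1 : ∀ u' : Fin n → A, _ := fun u' => lintegral_blockLaw_lt_prod_le W P₁ P₂
      (g := fun k a b ω => f k (u' k) (ω.1.2, ω.2.2.1))
      (fun k a b => (hfm k (u' k)).comp (by fun_prop)) hγ0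
    simp only [Set.mem_ofPred_eq]
    refine (lintegral_mono h1).trans ?_
    rw [lintegral_const_mul' _ _ (by simpa using hγ0), lintegral_pi_prod (fun k => (P₁ k).pV)
      (f := fun k a => ∫⁻ ω, f k a (ω.1.2.2, ω.2.2.1) ∂(letterLaw W (P₁ k) (P₂ k)))
      fun k => measurable_of_finite _]
    refine (mul_le_mul_right (Finset.prod_le_one' fun k _ => hcoll k) _).trans ?_
    rw [mul_one, hγ, ← ENNReal.ofReal_inv_of_pos (Real.exp_pos _), Real.exp_neg]

lemma exists_decoding_sets₂ (h : ∀ k, LetterBounds W (P₁ k) (P₂ k) s (r₁₂ k) (r₁ k) (r₂ k)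
    (t₁ k) (t₂ k)) (hs : 0 < s) (τ : ℝ) :
    ∃ S : (Fin n → B) → Set ((Fin n → X₁) × (Fin n → Y₁)), (∀ v, MeasurableSet (S v)) ∧
      ∫⁻ v, ∫⁻ u, blockLaw W (Measure.pi fun k => (P₁ k).pre (u k))
          (Measure.pi fun k => (P₂ k).pre (v k)) {ω | (ω.1.1, fun k => (ω.2 k).1) ∉ S v}
          ∂(Measure.pi fun k => (P₁ k).pV) ∂(Measure.pi fun k => (P₂ k).pV)
        ≤ ENNReal.ofReal (Real.exp (s * (τ - ∑ k, t₂ k))) ∧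
      ∫⁻ v', ∫⁻ v, ∫⁻ u, blockLaw W (Measure.pi fun k => (P₁ k).pre (u k))
          (Measure.pi fun k => (P₂ k).pre (v k)) {ω | (ω.1.1, fun k => (ω.2 k).1) ∈ S v'}
          ∂(Measure.pi fun k => (P₁ k).pV) ∂(Measure.pi fun k => (P₂ k).pV)
          ∂(Measure.pi fun k => (P₂ k).pV)
        ≤ ENNReal.ofReal (Real.exp (-τ)) := by
  choose f hfm hft hmiss hcoll using fun k => (h k).decode₂
  set γ : ℝ≥0∞ := ENNReal.ofReal (Real.exp τ) with hγ
  have hγ0 : γ ≠ 0 := by simp [hγ, Real.exp_pos]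
  have hγt : γ ≠ ⊤ := ENNReal.ofReal_ne_top
  refine ⟨fun v => {ξ | γ < ∏ k, f k (v k) (ξ.1 k, ξ.2 k)}, fun v => ?_, ?_, ?_⟩
  · exact measurableSet_lt measurable_const
      (Finset.measurable_prod _ fun k _ => (hfm k (v k)).comp (by fun_prop))
  · have := lintegral_blockLaw_prod_le_le W P₁ P₂ (g := fun k a b ω => f k b (ω.1.1, ω.2.1))
      (fun k a b => (hfm k b).comp (by fun_prop)) (fun k a b ω => hft k b _) hγ0 hγt hs
    rw [lintegral_lintegral_swap (measurable_of_finite _).aemeasurable] at this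
    simp only [Set.mem_ofPred_eq, not_lt]
    refine this.trans ((mul_le_mul_right (Finset.prod_le_prod' fun k _ => hmiss k) _).trans ?_)
    rw [prod_ofReal_exp_neg, hγ, ENNReal.ofReal_rpow_of_pos (Real.exp_pos _), ← Real.exp_mul,
      ← ENNReal.ofReal_mul (Real.exp_pos _).le, ← Real.exp_add]
    exact le_of_eq (by ring_nf)
  · have h1 : ∀ v' : Fin n → B, _ := fun v' => lintegral_blockLaw_lt_prod_le W P₁ P₂
      (g := fun k a b ω => f k (v' k) (ω.1.1, ω.2.1))
      (fun k a b => (hfm k (v' k)).comp (by fun_prop)) hγ0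
    have h2 := fun v' => (le_of_eq (lintegral_lintegral_swap
      (measurable_of_finite _).aemeasurable)).trans (h1 v')
    simp only [Set.mem_ofPred_eq]
    refine (lintegral_mono h2).trans ?_
    rw [lintegral_const_mul' _ _ (by simpa using hγ0), lintegral_pi_prod (fun k => (P₂ k).pV)
      (f := fun k b => ∫⁻ ω, f k b (ω.1.1.2, ω.2.1) ∂(letterLaw W (P₁ k) (P₂ k)))
      fun k => measurable_of_finite _]
    refine (mul_le_mul_right (Finset.prod_le_one' fun k _ => hcoll k) _).trans ?_
    rw [mul_one, hγ, ← ENNReal.ofReal_inv_of_pos (Real.exp_pos _), Real.exp_neg]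

end LetterBounds

section OneShot

lemma cond_le_smul {X : Type*} [MeasurableSpace X] {μ : Measure X} [IsProbabilityMeasure μ]
    {F : Set X} (hF : MeasurableSet F) {ε : ℝ≥0} (hε : ε < 1) (h : μ Fᶜ ≤ ε) :
    IsProbabilityMeasure (cond μ F) ∧ cond μ F ≤ (1 - ε)⁻¹ • μ := by
  have h1 : ((1 - ε : ℝ≥0) : ℝ≥0∞) ≤ μ F := by
    have h2 := prob_compl_eq_one_sub (μ := μ) hF
    rw [h2] at h
    rw [ENNReal.coe_sub, ENNReal.coe_one]
    exact tsub_le_iff_tsub_le.1 h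
  have h0 : (1 - ε : ℝ≥0) ≠ 0 := (tsub_pos_of_lt hε).ne'
  have hμF : μ F ≠ 0 := fun h2 => h0 (by
    rw [h2, nonpos_iff_eq_zero, ENNReal.coe_eq_zero] at h1
    exact h1)
  refine ⟨cond_isProbabilityMeasure hμF, Measure.le_iff.2 fun t ht => ?_⟩
  rw [cond_apply hF, Measure.smul_apply, ENNReal.smul_def, smul_eq_mul, ENNReal.coe_inv h0]
  gcongr
  exact Set.inter_subset_right

/-- Conditioning a randomly prefixed input law on a likely constraint set. -/
lemma exists_constrained_law {U X : Type*} [Finite U] [MeasurableSpace U]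
    [MeasurableSingletonClass U] [MeasurableSpace X] (p₀ : Measure U) [IsProbabilityMeasure p₀]
    (κ₀ : U → Measure X) [∀ u, IsProbabilityMeasure (κ₀ u)] {F : Set X} (hF : MeasurableSet F)
    (hne : F.Nonempty) {ε : ℝ≥0} (hε0 : 0 < ε) (hε : ε < 1)
    (h : ∫⁻ u, κ₀ u Fᶜ ∂p₀ ≤ (ε ^ 2 : ℝ≥0)) :
    ∃ (p : Measure U) (κ : U → Measure X), IsProbabilityMeasure p ∧
      (∀ u, IsProbabilityMeasure (κ u)) ∧ p ≤ (1 - ε)⁻¹ • p₀ ∧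
      (∀ u, p {u} ≠ 0 → κ u ≤ (1 - ε)⁻¹ • κ₀ u) ∧ ∀ u, κ u Fᶜ = 0 := by
  classical
  obtain ⟨x₀, hx₀⟩ := hne
  set G : Set U := {u | κ₀ u Fᶜ ≤ ε} with hG
  have hGm : MeasurableSet G := G.toFinite.measurableSet
  have hGc : p₀ Gᶜ ≤ ε := by
    have hsub : Gᶜ ⊆ {u | (ε : ℝ≥0∞) ≤ κ₀ u Fᶜ} := fun u hu => by
      simp only [hG, Set.mem_compl_iff, Set.mem_ofPred_eq, not_le] at hu
      exact hu.le
    have h1 := (mul_meas_ge_le_lintegral (μ := p₀) (f := fun u => κ₀ u Fᶜ)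
      (measurable_of_finite _) ε).trans h
    have h2 := (mul_le_mul_right (measure_mono hsub) (ε : ℝ≥0∞)).trans h1
    rw [sq, ENNReal.coe_mul] at h2
    exact (ENNReal.mul_le_mul_iff_right (by simpa using hε0.ne') ENNReal.coe_ne_top).1 h2
  obtain ⟨hp1, hp2⟩ := cond_le_smul hGm hε hGc
  refine ⟨cond p₀ G, fun u => if u ∈ G then cond (κ₀ u) F else Measure.dirac x₀, hp1, fun u => ?_,
    hp2, fun u hu => ?_, fun u => ?_⟩
  · by_cases hu : u ∈ G
    · simp only [hu, if_true]
      exact (cond_le_smul hF hε hu).1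
    · simp only [hu, if_false]
      infer_instance
  · have huG : u ∈ G := by
      by_contra hc
      apply hu
      rw [cond_apply hGm, Set.inter_singleton_eq_empty.2 hc, measure_empty, mul_zero]
    simp only [huG, if_true]
    exact (cond_le_smul hF hε huG).2
  · by_cases hu : u ∈ G
    · simp only [hu, if_true]
      rw [cond_apply hF, Set.inter_compl_self, measure_empty, mul_zero]
    · simp only [hu, if_false]
      rw [Measure.dirac_apply' _ hF.compl]
      simp [hx₀]

variable {X₁ X₂ Y₁ Y₂ Z A B : Type*} [MeasurableSpace X₁] [MeasurableSpace X₂] [MeasurableSpace Y₁]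
  [MeasurableSpace Y₂] [MeasurableSpace Z] {n : ℕ}
  [Finite A] [MeasurableSpace A] [MeasurableSingletonClass A] [Finite B] [MeasurableSpace B]
  [MeasurableSingletonClass B]

/-- The leakage bound obtained from exponents `r₁₂`, `r₁`, `r₂` for codebooks of sizes `a`, `b`. -/
noncomputable def leakExponentBound (β s r₁₂ r₁ r₂ a b : ℝ) : ℝ :=
  3 * Real.log β + β ^ 3 / s * ((a * b) ^ (-s) * Real.exp (s * r₁₂) + a ^ (-s) * Real.exp (s * r₁)
    + b ^ (-s) * Real.exp (s * r₂))

lemma exists_le_of_lintegral_lintegral_le {C D : Type*} [Finite C] [MeasurableSpace C]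
    [MeasurableSingletonClass C] [Finite D] [MeasurableSpace D] [MeasurableSingletonClass D]
    (P : Measure C) [IsProbabilityMeasure P] (ρ : Measure D) [IsProbabilityMeasure ρ]
    (f : C → D → ℝ≥0∞) {b : ℝ≥0∞} (h : ∫⁻ c, ∫⁻ d, f c d ∂ρ ∂P ≤ b) : ∃ c d, f c d ≤ b := by
  obtain ⟨c, hc⟩ := exists_le_lintegral (μ := P) (f := fun c => ∫⁻ d, f c d ∂ρ)
    (measurable_of_finite _).aemeasurable
  obtain ⟨d, hd⟩ := exists_le_lintegral (μ := ρ) (f := f c) (measurable_of_finite _).aemeasurable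
  exact ⟨c, d, hd.trans (hc.trans h)⟩

variable (W : Kernel (X₁ × X₂) (Y₁ × Y₂ × Z)) [IsMarkovKernel W]
  (P₁ : Fin n → Input A X₁) (P₂ : Fin n → Input B X₂)
  {s : ℝ} {r₁₂ r₁ r₂ t₁ t₂ : Fin n → ℝ}

lemma pi_singleton_ne_zero_of_le (p' : Fin n → Measure A) [∀ i, IsProbabilityMeasure (p' i)]
    {b : ℝ≥0} {μ : Measure (Fin n → A)} (hμ : μ ≤ b • Measure.pi p') {u : Fin n → A}
    (hu : μ {u} ≠ 0) (i : Fin n) : p' i {u i} ≠ 0 := by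
  intro hi
  apply hu
  refine le_antisymm ((hμ {u}).trans ?_) zero_le
  rw [Measure.smul_apply, ← Set.univ_pi_singleton, Measure.pi_pi,
    Finset.prod_eq_zero (Finset.mem_univ i) hi, smul_zero]

/-- One-shot random coding: existence of codes for a block of independent letters, with inputs
constrained to the sets `F₁`, `F₂`. -/
theorem exists_code_of_letterBounds
    (h : ∀ k, LetterBounds W (P₁ k) (P₂ k) s (r₁₂ k) (r₁ k) (r₂ k) (t₁ k) (t₂ k))
    (hs : 0 < s) (hs1 : s ≤ 1) {F₁ : Set (Fin n → X₁)} {F₂ : Set (Fin n → X₂)}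
    (hF₁ : MeasurableSet F₁) (hF₂ : MeasurableSet F₂) (hne₁ : F₁.Nonempty) (hne₂ : F₂.Nonempty)
    {ε : ℝ≥0} (hε0 : 0 < ε) (hε : ε < 1)
    (hc₁ : ∫⁻ u, Measure.pi (fun k => (P₁ k).pre (u k)) F₁ᶜ ∂(Measure.pi fun k => (P₁ k).pV)
      ≤ (ε ^ 2 : ℝ≥0))
    (hc₂ : ∫⁻ v, Measure.pi (fun k => (P₂ k).pre (v k)) F₂ᶜ ∂(Measure.pi fun k => (P₂ k).pV)
      ≤ (ε ^ 2 : ℝ≥0))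
    {M₁ L₁ M₂ L₂ : ℕ} (hM₁ : 0 < M₁) (hL₁ : 0 < L₁) (hM₂ : 0 < M₂) (hL₂ : 0 < L₂) {τ₁ τ₂ : ℝ}
    {β η : ℝ} (hβ : β = (1 - ε)⁻¹)
    (hη₁ : M₁ = 1 ∨ β ^ 4 * Real.exp (s * (τ₁ - ∑ k, t₁ k))
      + (M₁ * L₁) * (β ^ 5 * Real.exp (-τ₁)) ≤ η)
    (hη₂ : M₂ = 1 ∨ β ^ 4 * Real.exp (s * (τ₂ - ∑ k, t₂ k))
      + (M₂ * L₂) * (β ^ 5 * Real.exp (-τ₂)) ≤ η) :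
    (∃ C : Code X₁ X₂ Y₁ Y₂ n, C.M₁ = M₁ ∧ C.M₂ = M₂ ∧ (∀ m, ∀ᵐ x ∂(C.enc₁ m), x ∈ F₁) ∧
      (∀ m, ∀ᵐ x ∂(C.enc₂ m), x ∈ F₂) ∧
      C.errorProb W + C.leakage W ≤ ENNReal.ofReal η + ENNReal.ofReal η + ENNReal.ofReal
        (leakExponentBound (β ^ 2) s (∑ k, r₁₂ k) (∑ k, r₁ k) (∑ k, r₂ k) L₁ L₂)) ∧
    (∃ C : Code X₁ X₂ Y₁ Y₂ n, C.M₁ = M₁ ∧ C.M₂ = M₂ ∧ (∀ m, ∀ᵐ x ∂(C.enc₁ m), x ∈ F₁) ∧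
      (∀ m, ∀ᵐ x ∂(C.enc₂ m), x ∈ F₂) ∧
      C.errorProb W + (C.leakage₁ W + C.leakage₂ W) ≤ ENNReal.ofReal η + ENNReal.ofReal η +
        (ENNReal.ofReal
          (leakExponentBound (β ^ 2) s (∑ k, r₁₂ k) (∑ k, r₁ k) (∑ k, r₂ k) L₁ (M₂ * L₂))
        + ENNReal.ofReal
          (leakExponentBound (β ^ 2) s (∑ k, r₁₂ k) (∑ k, r₁ k) (∑ k, r₂ k) (M₁ * L₁) L₂))) := by
  set b : ℝ≥0 := (1 - ε)⁻¹ with hb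
  have hbβ : (b : ℝ) = β := by
    rw [hβ]
  have hb1 : 1 ≤ b := by
    rw [hb]; exact one_le_inv_iff₀.2 ⟨tsub_pos_of_lt hε, tsub_le_self⟩
  have hβ0 : 0 ≤ β := hbβ ▸ b.2
  obtain ⟨p, κ₁, ip, iκ₁, hp, hκ₁, hF₁0⟩ := exists_constrained_law (Measure.pi fun k => (P₁ k).pV)
    (fun u : Fin n → A => Measure.pi (fun k => (P₁ k).pre (u k))) hF₁ hne₁ hε0 hε hc₁
  obtain ⟨q, κ₂, iq, iκ₂, hq, hκ₂, hF₂0⟩ := exists_constrained_law (Measure.pi fun k => (P₂ k).pV)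
    (fun u : Fin n → B => Measure.pi (fun k => (P₂ k).pre (u k))) hF₂ hne₂ hε0 hε hc₂
  obtain ⟨S₁, hS₁, hmiss₁, hcoll₁⟩ := exists_decoding_sets₁ W P₁ P₂ h hs τ₁
  obtain ⟨S₂, hS₂, hmiss₂, hcoll₂⟩ := exists_decoding_sets₂ W P₁ P₂ h hs τ₂
  choose Q k iQ hkm hk0 hkQ hk1 hr₁₂ hr₁ hr₂ using fun k => (h k).resolv
  have hcoe : ∀ j : ℕ, (b : ℝ≥0∞) ^ j = ENNReal.ofReal (β ^ j) := fun j => by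
    rw [← hbβ, ENNReal.ofReal_pow b.coe_nonneg, ENNReal.ofReal_coe_nnreal]
  have herr : ∀ (M L : ℕ) (τ T : ℝ) (x y : ℝ≥0∞), x ≤ ENNReal.ofReal (Real.exp (s * (τ - T))) →
      y ≤ ENNReal.ofReal (Real.exp (-τ)) →
      (M = 1 ∨ β ^ 4 * Real.exp (s * (τ - T)) + (M * L) * (β ^ 5 * Real.exp (-τ)) ≤ η) →
      (M = 1 ∨ (b : ℝ≥0∞) ^ 4 * x + ((M : ℝ≥0∞) * L) * ((b : ℝ≥0∞) ^ 5 * y) ≤ ENNReal.ofReal η) := by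
    intro M L τ T x y hx hy hη
    refine hη.imp_right fun hη => le_trans ?_ (ENNReal.ofReal_le_ofReal hη)
    rw [ENNReal.ofReal_add (by positivity) (by positivity), ENNReal.ofReal_mul (by positivity),
      ENNReal.ofReal_mul (by positivity), ENNReal.ofReal_mul (by positivity),
      ENNReal.ofReal_mul (by positivity), hcoe, hcoe, ENNReal.ofReal_natCast,
      ENNReal.ofReal_natCast]
    gcongr
  have hE := lintegral_errorProb_codebookCode_le W hp hq hκ₁ hκ₂ hM₁ hL₁ hM₂ hL₂ hS₁ hS₂
    (ENNReal.ofReal η) (herr _ _ _ _ _ _ hmiss₁ hcoll₁ hη₁) (herr _ _ _ _ _ _ hmiss₂ hcoll₂ hη₂)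
  have hb2 : 1 ≤ b ^ 2 := one_le_pow₀ hb1
  have hbb : b ≤ b ^ 2 := by simpa [sq] using mul_le_mul_right hb1 b
  have hp' : p ≤ (b ^ 2) • Measure.pi fun k => (P₁ k).pV :=
    hp.trans (by gcongr)
  have hq' : q ≤ (b ^ 2) • Measure.pi fun k => (P₂ k).pV :=
    hq.trans (by gcongr)
  have hμ : ∀ u v, p {u} ≠ 0 → q {v} ≠ 0 → eveLaw W (κ₁ u) (κ₂ v)
      ≤ (b ^ 2) • (Measure.pi Q).withDensity
        fun z => ENNReal.ofReal (∏ i, k i (u i) (v i) (z i)) := by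
    intro u v hu hv
    have e := eveLaw_pi W (fun i => (P₁ i).pre (u i)) (fun i => (P₂ i).pre (v i))
    have hQ : ∀ i, (channelLaw W ((P₁ i).pre (u i)) ((P₂ i).pre (v i))).map (fun ω => ω.2.2.2)
        = (Q i).withDensity fun z => ENNReal.ofReal (k i (u i) (v i) z) := fun i =>
      hkQ i _ _ (pi_singleton_ne_zero_of_le _ hp hu i)
      (pi_singleton_ne_zero_of_le _ hq hv i)
    simp_rw [hQ] at e
    have iQ' : ∀ i, IsProbabilityMeasure
        ((Q i).withDensity fun z => ENNReal.ofReal (k i (u i) (v i) z)) := fun i => by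
      rw [← hQ i]
      exact Measure.isProbabilityMeasure_map (by fun_prop)
    rw [pi_withDensity Q fun i => (hkm i _ _).ennreal_ofReal] at e
    simp_rw [ENNReal.ofReal_prod_of_nonneg fun i _ => hk0 _ _ _ _]
    rw [← e]
    refine Measure.le_iff.2 fun t ht => ?_
    have hle := Measure.le_iff.1 (blockLaw_le W (hκ₁ u hu) (hκ₂ v hv)) _
      (ht.preimage (f := fun (ω : ((Fin n → X₁) × (Fin n → X₂)) × (Fin n → Y₁ × Y₂ × Z)) k =>
        (ω.2 k).2.2) (by fun_prop))
    rw [eveLaw, eveLaw, Measure.smul_apply, Measure.map_apply (by fun_prop) ht,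
      Measure.map_apply (by fun_prop) ht]
    rwa [Measure.smul_apply] at hle
  have hkm' : ∀ (u : Fin n → A) (v : Fin n → B),
      Measurable fun z : Fin n → Z => ∏ i, k i (u i) (v i) (z i) := fun u v =>
    Finset.measurable_prod _ fun i _ => (hkm i _ _).comp (measurable_pi_apply i)
  have hk0' : ∀ (u : Fin n → A) (v : Fin n → B) (z : Fin n → Z), 0 ≤ ∏ i, k i (u i) (v i) (z i) :=
    fun u v z => Finset.prod_nonneg fun i _ => hk0 i _ _ _
  have hk1' : ∀ᵐ z ∂(Measure.pi Q), ∫ u, ∫ v, ∏ i, k i (u i) (v i) (z i)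
      ∂(Measure.pi fun i => (P₂ i).pV) ∂(Measure.pi fun i => (P₁ i).pV) ≤ 1 := by
    have : ∀ᵐ z ∂(Measure.pi Q), ∀ i, ∫ a, ∫ b, k i a b (z i) ∂(P₂ i).pV ∂(P₁ i).pV ≤ 1 :=
      ae_all_iff.2 fun i => (Measure.quasiMeasurePreserving_eval Q i).ae (hk1 i)
    filter_upwards [this] with z hz
    rw [integral_integral_pi_prod (fun i => (P₁ i).pV) (fun i => (P₂ i).pV)
      fun i a b => k i a b (z i)]
    exact Finset.prod_le_one (fun i _ => integral_nonneg fun a => integral_nonneg fun b =>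
      hk0 i a b _) fun i _ => hz i
  have hleak : ∀ {x y : ℝ}, 0 < x → 0 < y →
      leakBound (Measure.pi fun i => (P₁ i).pV) (Measure.pi fun i => (P₂ i).pV) (Measure.pi Q)
        (fun u v z => ∏ i, k i (u i) (v i) (z i)) (b ^ 2) s x y
      ≤ ENNReal.ofReal (leakExponentBound (β ^ 2) s (∑ k, r₁₂ k) (∑ k, r₁ k) (∑ k, r₂ k) x y) := by
    intro x y hx hy
    have hx0 := hx.le
    have hy0 := hy.le
    have h1 := lintegral_resolvTerm_pi_le (fun i => (P₁ i).pV) (fun i => (P₂ i).pV) Q hkm hk0 hx hy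
      hr₁₂ hr₁ hr₂
    rw [prod_ofReal_exp, prod_ofReal_exp, prod_ofReal_exp] at h1
    have hlog : 0 ≤ Real.log (β ^ 2) := by
      rw [← hbβ]; exact Real.log_nonneg (by exact_mod_cast hb2)
    rw [leakBound, leakExponentBound, ENNReal.ofReal_add (by positivity) (by positivity),
      ENNReal.ofReal_mul (q := _ + _ + _) (by positivity), ENNReal.ofReal_add (by positivity) (by positivity),
      ENNReal.ofReal_add (by positivity) (by positivity), ENNReal.ofReal_mul (p := (x * y) ^ (-s)) (by positivity),
      ENNReal.ofReal_mul (p := x ^ (-s)) (by positivity), ENNReal.ofReal_mul (p := y ^ (-s)) (by positivity),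
      NNReal.coe_pow, hbβ]
    gcongr
  have hcost₁ : ∀ c d m, ∀ᵐ x ∂((codebookCode hM₁ hL₁ hM₂ hL₂ κ₁ κ₂ hS₁ hS₂ c d).enc₁ m), x ∈ F₁ := by
    have : ∀ c (m : Fin M₁), codebookEncoder (L := L₁) κ₁ c m F₁ᶜ = 0 := fun c m => by
      rw [codebookEncoder_apply, Measure.smul_apply, Measure.finsetSum_apply]
      simp [hF₁0]
    exact fun c d m => this c m
  have hcost₂ : ∀ c d m, ∀ᵐ x ∂((codebookCode hM₁ hL₁ hM₂ hL₂ κ₁ κ₂ hS₁ hS₂ c d).enc₂ m), x ∈ F₂ := by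
    have : ∀ c (m : Fin M₂), codebookEncoder (L := L₂) κ₂ c m F₂ᶜ = 0 := fun c m => by
      rw [codebookEncoder_apply, Measure.smul_apply, Measure.finsetSum_apply]
      simp [hF₂0]
    exact fun c d m => this d m
  have hL₁' : (0 : ℝ) < L₁ := by exact_mod_cast hL₁
  have hL₂' : (0 : ℝ) < L₂ := by exact_mod_cast hL₂
  have hM₁' : (0 : ℝ) < M₁ := by exact_mod_cast hM₁
  have hM₂' : (0 : ℝ) < M₂ := by exact_mod_cast hM₂
  have hJ := (lintegral_leakage_codebookCode_le W hb2 hp' hq' (Measure.pi Q) hkm' hk0' hμ hk1' hs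
    hs1 hM₁ hL₁ hM₂ hL₂ hS₁ hS₂).trans (hleak hL₁' hL₂')
  have hI₁ := (lintegral_leakage₁_codebookCode_le W hb2 hp' hq' (Measure.pi Q) hkm' hk0' hμ hk1' hs
    hs1 hM₁ hL₁ hM₂ hL₂ hS₁ hS₂).trans (hleak hL₁' (mul_pos hM₂' hL₂'))
  have hI₂ := (lintegral_leakage₂_codebookCode_le W hb2 hp' hq' (Measure.pi Q) hkm' hk0' hμ hk1' hs
    hs1 hM₁ hL₁ hM₂ hL₂ hS₁ hS₂).trans (hleak (mul_pos hM₁' hL₁') hL₂')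
  constructor
  · have := add_le_add hE hJ
    simp_rw [← lintegral_add_left (measurable_of_finite _)] at this
    obtain ⟨c, d, hcd⟩ := exists_le_of_lintegral_lintegral_le _ _ _ this
    exact ⟨_, rfl, rfl, hcost₁ c d, hcost₂ c d, hcd⟩
  · have := add_le_add hE (add_le_add hI₁ hI₂)
    simp_rw [← lintegral_add_left (measurable_of_finite _)] at this
    obtain ⟨c, d, hcd⟩ := exists_le_of_lintegral_lintegral_le _ _ _ this
    exact ⟨_, rfl, rfl, hcost₁ c d, hcost₂ c d, hcd⟩

end OneShot

section Chernoff

open InformationTheory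

variable {S : Type*} [MeasurableSpace S]

lemma exp_mul_sub_one_div_le {s x : ℝ} (hs : 0 < s) (hs1 : s ≤ 1) :
    |(Real.exp (s * x) - 1) / s| ≤ |x| + Real.exp x + 1 := by
  have h1 : x ≤ (Real.exp (s * x) - 1) / s := by
    rw [le_div_iff₀ hs]
    have := Real.add_one_le_exp (s * x)
    linarith
  have h2 : (Real.exp (s * x) - 1) / s ≤ Real.exp x - 1 := by
    rw [div_le_iff₀ hs]
    have := convexOn_exp.2 (Set.mem_univ x) (Set.mem_univ 0) hs.le (sub_nonneg.2 hs1)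
      (by ring : s + (1 - s) = 1)
    simp only [smul_eq_mul, mul_zero, add_zero, Real.exp_zero, mul_one] at this
    linarith
  have := Real.exp_pos x
  rw [abs_le]
  constructor
  · have := neg_abs_le x; linarith
  · have := abs_nonneg x; linarith

lemma tendsto_exp_mul_sub_one_div (x : ℝ) :
    Tendsto (fun s : ℝ => (Real.exp (s * x) - 1) / s) (𝓝[>] 0) (𝓝 x) := by
  have h : HasDerivAt (fun s : ℝ => Real.exp (s * x)) x 0 := by
    have := ((hasDerivAt_id (0 : ℝ)).mul_const x).exp
    simpa using this
  have h2 := h.tendsto_slope_zero_right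
  simp only [zero_add, zero_mul, Real.exp_zero, smul_eq_mul] at h2
  refine h2.congr fun s => ?_
  rw [inv_mul_eq_div]

lemma eventually_integral_exp_mul_le (P : Measure S) [IsProbabilityMeasure P] {i : S → ℝ}
    (him : Measurable i) (hi : Integrable i P) (he : Integrable (fun x => Real.exp (i x)) P) {r : ℝ}
    (hr : ∫ x, i x ∂P < r) :
    ∀ᶠ s in 𝓝[>] (0 : ℝ), ∫⁻ x, ENNReal.ofReal (Real.exp (s * i x)) ∂P
      ≤ ENNReal.ofReal (Real.exp (s * r)) := by
  have hT : Tendsto (fun s : ℝ => ∫ x, (Real.exp (s * i x) - 1) / s ∂P) (𝓝[>] 0)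
      (𝓝 (∫ x, i x ∂P)) := by
    refine tendsto_integral_filter_of_dominated_convergence
      (fun x => |i x| + Real.exp (i x) + 1) ?_ ?_ ((hi.abs.add he).add (integrable_const 1)) ?_
    · exact Eventually.of_forall fun s => (by fun_prop : Measurable fun x =>
        (Real.exp (s * i x) - 1) / s).aestronglyMeasurable
    · filter_upwards [Ioc_mem_nhdsGT (zero_lt_one' ℝ)] with s hs
      exact ae_of_all _ fun x => exp_mul_sub_one_div_le hs.1 hs.2
    · exact ae_of_all _ fun x => tendsto_exp_mul_sub_one_div (i x)
  filter_upwards [hT.eventually (gt_mem_nhds hr), Ioc_mem_nhdsGT (zero_lt_one' ℝ)] with s hs hs01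
  have hint : Integrable (fun x => Real.exp (s * i x)) P := by
    refine (he.add (integrable_const (1 : ℝ))).mono' (by fun_prop) (ae_of_all _ fun x => ?_)
    rw [Real.norm_eq_abs, abs_of_pos (Real.exp_pos _)]
    have := convexOn_exp.2 (Set.mem_univ (i x)) (Set.mem_univ 0) hs01.1.le (sub_nonneg.2 hs01.2)
      (by ring : s + (1 - s) = 1)
    simp only [smul_eq_mul, mul_zero, add_zero, Real.exp_zero, mul_one] at this
    have h0 := Real.exp_pos (i x)
    have h1 := hs01.1
    have h2 := hs01.2
    simp only [Pi.add_apply]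
    nlinarith
  rw [← ofReal_integral_eq_lintegral_ofReal hint (ae_of_all _ fun x => (Real.exp_pos _).le)]
  refine ENNReal.ofReal_le_ofReal ?_
  rw [integral_div, integral_sub hint (integrable_const _), div_lt_iff₀ hs01.1] at hs
  simp only [integral_const, probReal_univ, smul_eq_mul, mul_one] at hs
  have := Real.add_one_le_exp (s * r)
  linarith

variable {μ ν : Measure S} [IsProbabilityMeasure μ] [IsProbabilityMeasure ν] {f : S → ℝ} {C : ℝ}

lemma ae_pos_of_eq_withDensity (hf : Measurable f)
    (h : μ = ν.withDensity fun x => ENNReal.ofReal (f x)) : ∀ᵐ x ∂μ, 0 < f x := by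
  rw [h, ae_withDensity_iff (by fun_prop)]
  exact ae_of_all _ fun x hx => by simpa using hx

lemma integrable_exp_neg_log (hf : Measurable f)
    (h : μ = ν.withDensity fun x => ENNReal.ofReal (f x)) :
    Integrable (fun x => Real.exp (-Real.log (f x))) μ := by
  refine ⟨hf.log.neg.exp.aestronglyMeasurable, ?_⟩
  rw [hasFiniteIntegral_iff_ofReal (ae_of_all _ fun x => (Real.exp_pos _).le)]
  refine lt_of_le_of_lt ?_ ENNReal.one_lt_top
  have hpos := ae_pos_of_eq_withDensity hf h
  rw [h, lintegral_withDensity_eq_lintegral_mul _ (by fun_prop) (by fun_prop)]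
  calc ∫⁻ x, ((fun x => ENNReal.ofReal (f x)) * fun x => ENNReal.ofReal
        (Real.exp (-Real.log (f x)))) x ∂ν ≤ ∫⁻ _, 1 ∂ν := by
        refine lintegral_mono fun x => ?_
        simp only [Pi.mul_apply]
        rcases le_or_gt (f x) 0 with h0 | h0
        · simp [ENNReal.ofReal_of_nonpos h0]
        · rw [← ENNReal.ofReal_mul h0.le, Real.exp_neg, Real.exp_log h0, mul_inv_cancel₀ h0.ne']
          simp
    _ = 1 := by simp

lemma integrable_exp_log (hf : Measurable f) (hC : ∀ x, f x ≤ C)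
    (h : μ = ν.withDensity fun x => ENNReal.ofReal (f x)) :
    Integrable (fun x => Real.exp (Real.log (f x))) μ := by
  refine (integrable_const C).mono' hf.log.exp.aestronglyMeasurable ?_
  filter_upwards [ae_pos_of_eq_withDensity hf h] with x hx
  rw [Real.norm_eq_abs, abs_of_pos (Real.exp_pos _), Real.exp_log hx]
  exact hC x

lemma integrable_log_density (hf : Measurable f) (hC : ∀ x, f x ≤ C)
    (h : μ = ν.withDensity fun x => ENNReal.ofReal (f x)) :
    Integrable (fun x => Real.log (f x)) μ := by
  refine ((integrable_exp_log hf hC h).add (integrable_exp_neg_log hf h)).mono'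
    hf.log.aestronglyMeasurable
    (ae_of_all _ fun x => ?_)
  have h1 := Real.add_one_le_exp (Real.log (f x))
  have h2 := Real.add_one_le_exp (-Real.log (f x))
  have h3 := Real.exp_pos (Real.log (f x))
  have h4 := Real.exp_pos (-Real.log (f x))
  rw [Real.norm_eq_abs, abs_le]
  simp only [Pi.add_apply]
  constructor <;> linarith

lemma klDiv_of_bounded_density (hf : Measurable f) (hf0 : ∀ x, 0 ≤ f x) (hC : ∀ x, f x ≤ C)
    (h : μ = ν.withDensity fun x => ENNReal.ofReal (f x)) :
    klDiv μ ν ≠ ⊤ ∧ (klDiv μ ν).toReal = ∫ x, Real.log (f x) ∂μ := by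
  have hac : μ ≪ ν := h ▸ withDensity_absolutelyContinuous _ _
  have hllr : llr μ ν =ᵐ[μ] fun x => Real.log (f x) := by
    have h1 : μ.rnDeriv ν =ᵐ[ν] fun x => ENNReal.ofReal (f x) := by
      rw [h]; exact Measure.rnDeriv_withDensity ν (by fun_prop)
    filter_upwards [hac.ae_le h1] with x hx
    rw [llr, hx, ENNReal.toReal_ofReal (hf0 x)]
  constructor
  · rw [klDiv_ne_top_iff]
    exact ⟨hac, (integrable_congr hllr).2 (integrable_log_density hf hC h)⟩
  · rw [toReal_klDiv_of_measure_eq hac (by simp), integral_congr_ae hllr]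

lemma eventually_lintegral_density_rpow_le (hf : Measurable f) (hf0 : ∀ x, 0 ≤ f x)
    (hC : ∀ x, f x ≤ C) (h : μ = ν.withDensity fun x => ENNReal.ofReal (f x)) {r : ℝ}
    (hr : (klDiv μ ν).toReal < r) :
    ∀ᶠ s in 𝓝[>] (0 : ℝ), ∫⁻ x, ENNReal.ofReal (f x ^ s) ∂μ
      ≤ ENNReal.ofReal (Real.exp (s * r)) := by
  rw [(klDiv_of_bounded_density hf hf0 hC h).2] at hr
  filter_upwards [eventually_integral_exp_mul_le μ (i := fun x => Real.log (f x)) (by fun_prop)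
    (integrable_log_density hf hC h) (integrable_exp_log hf hC h) hr] with s hs
  refine le_trans (le_of_eq ?_) hs
  refine lintegral_congr_ae ?_
  filter_upwards [ae_pos_of_eq_withDensity hf h] with x hx
  rw [Real.rpow_def_of_pos hx, mul_comm]

lemma eventually_lintegral_density_rpow_neg_le (hf : Measurable f) (hf0 : ∀ x, 0 ≤ f x)
    (hC : ∀ x, f x ≤ C) (h : μ = ν.withDensity fun x => ENNReal.ofReal (f x)) {t : ℝ}
    (ht : t < (klDiv μ ν).toReal) :
    ∀ᶠ s in 𝓝[>] (0 : ℝ), ∫⁻ x, ENNReal.ofReal (f x) ^ (-s) ∂μ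
      ≤ ENNReal.ofReal (Real.exp (-(s * t))) := by
  rw [(klDiv_of_bounded_density hf hf0 hC h).2] at ht
  have ht' : ∫ x, -Real.log (f x) ∂μ < -t := by rw [integral_neg]; linarith
  filter_upwards [eventually_integral_exp_mul_le μ (i := fun x => -Real.log (f x)) (by fun_prop)
    (integrable_log_density hf hC h).neg (integrable_exp_neg_log hf h) ht'] with s hs
  rw [mul_neg] at hs
  refine le_trans (le_of_eq ?_) hs
  refine lintegral_congr_ae ?_
  filter_upwards [ae_pos_of_eq_withDensity hf h] with x hx
  rw [ENNReal.ofReal_rpow_of_pos hx, Real.rpow_def_of_pos hx]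
  ring_nf

/-- A joint law with one finite marginal has a bounded density with respect to the product of its
marginals. -/
lemma exists_bounded_density {A : Type*} [Finite A] [MeasurableSpace A] [MeasurableSingletonClass A]
    (J : Measure (A × S)) [IsProbabilityMeasure J] :
    ∃ (f : A × S → ℝ) (C : ℝ), Measurable f ∧ (∀ x, 0 ≤ f x) ∧ (∀ x, f x ≤ C) ∧
      J = (J.fst.prod J.snd).withDensity fun x => ENNReal.ofReal (f x) := by
  classical
  have := Fintype.ofFinite A
  set w : A → ℝ≥0∞ := fun a => if J.fst {a} = 0 then 0 else (J.fst {a})⁻¹ with hw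
  have hwt : ∀ a, w a ≠ ⊤ := fun a => by
    simp only [hw]; split_ifs with h <;> simp [h]
  have hcell : ∀ a, ∀ t : Set S, MeasurableSet t →
      J ({a} ×ˢ t) ≤ w a * (J.fst.prod J.snd) ({a} ×ˢ t) := by
    intro a t ht
    rw [Measure.prod_prod]
    have h1 : J ({a} ×ˢ t) ≤ J.fst {a} := by
      rw [Measure.fst_apply (measurableSet_singleton a)]
      exact measure_mono fun x hx => hx.1
    have h2 : J ({a} ×ˢ t) ≤ J.snd t := by
      rw [Measure.snd_apply ht]
      exact measure_mono fun x hx => hx.2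
    by_cases h0 : J.fst {a} = 0
    · rw [h0] at h1; exact h1.trans zero_le
    · simp only [hw, h0, if_false]
      rw [← mul_assoc, ENNReal.inv_mul_cancel h0 (measure_ne_top _ _), one_mul]
      exact h2
  set c : ℝ≥0∞ := ∑ a, w a with hc
  have hct : c ≠ ⊤ := ENNReal.sum_ne_top.2 fun a _ => hwt a
  have hle : J ≤ c • (J.fst.prod J.snd) := by
    refine Measure.le_iff.2 fun t ht => ?_
    have hcov : t ⊆ ⋃ a, {a} ×ˢ (Prod.mk a ⁻¹' t) := fun x hx =>
      Set.mem_iUnion.2 ⟨x.1, ⟨rfl, by simpa using hx⟩⟩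
    refine (measure_mono hcov).trans ((measure_iUnion_fintype_le _ _).trans ?_)
    rw [Measure.smul_apply, smul_eq_mul, hc, Finset.sum_mul]
    refine Finset.sum_le_sum fun a _ => (hcell a _ (ht.preimage measurable_prodMk_left)).trans ?_
    gcongr
    rintro ⟨a', z⟩ ⟨rfl, hz⟩
    exact hz
  have hac : J ≪ J.fst.prod J.snd :=
    (Measure.absolutelyContinuous_of_le hle).trans (Measure.smul_absolutelyContinuous)
  have hb : ∀ᵐ x ∂(J.fst.prod J.snd), J.rnDeriv (J.fst.prod J.snd) x ≤ c := by
    refine ae_le_of_forall_setLIntegral_le_of_sigmaFinite (Measure.measurable_rnDeriv _ _)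
      fun t ht _ => ?_
    rw [Measure.setLIntegral_rnDeriv hac, setLIntegral_const]
    exact hle t
  refine ⟨fun x => (min (J.rnDeriv (J.fst.prod J.snd) x) c).toReal, c.toReal,
    by fun_prop, fun x => ENNReal.toReal_nonneg,
    fun x => ENNReal.toReal_mono hct (min_le_right _ _), ?_⟩
  conv_lhs => rw [← Measure.withDensity_rnDeriv_eq _ _ hac]
  refine withDensity_congr_ae ?_
  filter_upwards [hb] with x hx
  rw [ENNReal.ofReal_toReal (ne_top_of_le_ne_top hct (min_le_right _ _)), min_eq_left hx]

end Chernoff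

section FiniteLetters

open InformationTheory

lemma mutualInfo_comm {Ω A B : Type*} [MeasurableSpace Ω] [MeasurableSpace A] [MeasurableSpace B]
    {f : Ω → A} {h : Ω → B} (hf : Measurable f) (hh : Measurable h) (μ : Measure Ω)
    [IsProbabilityMeasure μ] : mutualInfo f h μ = mutualInfo h f μ := by
  have := Measure.isProbabilityMeasure_map (μ := μ) hf.aemeasurable
  have := Measure.isProbabilityMeasure_map (μ := μ) hh.aemeasurable
  have := Measure.isProbabilityMeasure_map (μ := μ) (hf.prodMk hh).aemeasurable
  rw [mutualInfo, mutualInfo, ← klDiv_map_measurableEquiv _ _ MeasurableEquiv.prodComm,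
    Measure.map_map MeasurableEquiv.prodComm.measurable (hf.prodMk hh)]
  congr 1
  exact Measure.prod_swap

section Density

variable {A B S : Type*} [Finite A] [MeasurableSpace A] [MeasurableSingletonClass A]
  [Finite B] [MeasurableSpace B] [MeasurableSingletonClass B] [MeasurableSpace S]
  {P : Measure A} [IsProbabilityMeasure P] {Q : Measure S} [IsProbabilityMeasure Q]
  {f : A × S → ℝ}

lemma lintegral_moment_eq {J : Measure (A × S)} (hf : Measurable f) (hf0 : ∀ x, 0 ≤ f x)
    (hJ : J = (P.prod Q).withDensity fun x => ENNReal.ofReal (f x)) (s : ℝ) :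
    ∫⁻ z, ENNReal.ofReal (∫ a, f (a, z) * f (a, z) ^ s ∂P) ∂Q
      = ∫⁻ x, ENNReal.ofReal (f x ^ s) ∂J := by
  rw [hJ, lintegral_withDensity_eq_lintegral_mul _ (by fun_prop) (by fun_prop),
    lintegral_prod_symm _ (by fun_prop)]
  refine lintegral_congr fun z => ?_
  rw [ofReal_integral_eq_lintegral_ofReal Integrable.of_finite
    (ae_of_all _ fun a => mul_nonneg (hf0 _) (Real.rpow_nonneg (hf0 _) _))]
  refine lintegral_congr fun a => ?_
  rw [ENNReal.ofReal_mul (hf0 _)]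
  rfl

lemma ae_integral_density_le_one {J : Measure (A × S)} (hf : Measurable f) (hf0 : ∀ x, 0 ≤ f x)
    (hJ : J = (P.prod Q).withDensity fun x => ENNReal.ofReal (f x)) (hQ : J.snd = Q) :
    ∀ᵐ z ∂Q, ∫ a, f (a, z) ∂P ≤ 1 := by
  have h : ∀ᵐ z ∂Q, ∫⁻ a, ENNReal.ofReal (f (a, z)) ∂P ≤ 1 := by
    refine ae_le_of_forall_setLIntegral_le_of_sigmaFinite
      (Measurable.lintegral_prod_left' (f := fun x => ENNReal.ofReal (f x)) (by fun_prop))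
      fun t ht _ => ?_
    rw [setLIntegral_one, ← hQ, Measure.snd_apply ht]
    have : (Prod.snd ⁻¹' t : Set (A × S)) = Set.univ ×ˢ t := by ext; simp
    rw [this, hQ, hJ, withDensity_apply _ (MeasurableSet.univ.prod ht), ← Measure.prod_restrict,
      Measure.restrict_univ, lintegral_prod_symm _ (by fun_prop)]
  filter_upwards [h] with z hz
  rw [← ofReal_integral_eq_lintegral_ofReal Integrable.of_finite (ae_of_all _ fun a => hf0 _),
    ENNReal.ofReal_le_one] at hz
  exact hz

lemma map_fst_withDensity {q : Measure B} [IsProbabilityMeasure q] {f : (A × B) × S → ℝ}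
    {J : Measure ((A × B) × S)} (hf : Measurable f) (hf0 : ∀ x, 0 ≤ f x)
    (hJ : J = ((P.prod q).prod Q).withDensity fun x => ENNReal.ofReal (f x)) :
    J.map (fun x => (x.1.1, x.2))
      = (P.prod Q).withDensity fun x => ENNReal.ofReal (∫ b, f ((x.1, b), x.2) ∂q) := by
  have hm : Measurable fun x : A × S => ∫ b, f ((x.1, b), x.2) ∂q :=
    measurable_integral_of_finite q fun b => by fun_prop
  ext t ht
  have hind : Measurable (t.indicator (1 : A × S → ℝ≥0∞)) := measurable_one.indicator ht
  have hL : J.map (fun x => (x.1.1, x.2)) t = ∫⁻ x, t.indicator 1 (x.1.1, x.2) ∂J := by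
    rw [← lintegral_indicator_one ht, lintegral_map hind (by fun_prop)]
  have hR : (P.prod Q).withDensity (fun x => ENNReal.ofReal (∫ b, f ((x.1, b), x.2) ∂q)) t
      = ∫⁻ x, ENNReal.ofReal (∫ b, f ((x.1, b), x.2) ∂q) * t.indicator 1 x ∂(P.prod Q) := by
    rw [← lintegral_indicator_one ht, lintegral_withDensity_eq_lintegral_mul _ (by fun_prop) hind]
    rfl
  have hind' : Measurable fun x : (A × B) × S => t.indicator (1 : A × S → ℝ≥0∞) (x.1.1, x.2) :=
    hind.comp (f := fun x : (A × B) × S => (x.1.1, x.2)) (by fun_prop)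
  rw [hL, hR, hJ, lintegral_withDensity_eq_lintegral_mul _ (by fun_prop) hind']
  have hm1 : Measurable ((fun x : (A × B) × S => ENNReal.ofReal (f x))
      * fun x => t.indicator (1 : A × S → ℝ≥0∞) (x.1.1, x.2)) :=
    Measurable.mul (by fun_prop) hind'
  have hm2 : Measurable fun x : A × S =>
      ENNReal.ofReal (∫ b, f ((x.1, b), x.2) ∂q) * t.indicator 1 x := Measurable.mul (by fun_prop) hind
  rw [lintegral_prod_symm _ hm1.aemeasurable,
    lintegral_prod_symm _ hm2.aemeasurable]
  refine lintegral_congr fun z => ?_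
  rw [lintegral_prod _ (measurable_of_finite _).aemeasurable]
  refine lintegral_congr fun a => ?_
  simp only [Pi.mul_apply]
  rw [lintegral_mul_const _ (measurable_of_finite _),
    ofReal_integral_eq_lintegral_ofReal Integrable.of_finite (ae_of_all _ fun b => hf0 _)]

lemma map_snd_withDensity {q : Measure B} [IsProbabilityMeasure q] {f : (A × B) × S → ℝ}
    {J : Measure ((A × B) × S)} (hf : Measurable f) (hf0 : ∀ x, 0 ≤ f x)
    (hJ : J = ((P.prod q).prod Q).withDensity fun x => ENNReal.ofReal (f x)) :
    J.map (fun x => (x.1.2, x.2))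
      = (q.prod Q).withDensity fun x => ENNReal.ofReal (∫ a, f ((a, x.1), x.2) ∂P) := by
  have hm : Measurable fun x : B × S => ∫ a, f ((a, x.1), x.2) ∂P :=
    measurable_integral_of_finite P fun b => by fun_prop
  ext t ht
  have hind : Measurable (t.indicator (1 : B × S → ℝ≥0∞)) := measurable_one.indicator ht
  have hL : J.map (fun x => (x.1.2, x.2)) t = ∫⁻ x, t.indicator 1 (x.1.2, x.2) ∂J := by
    rw [← lintegral_indicator_one ht, lintegral_map hind (by fun_prop)]
  have hR : (q.prod Q).withDensity (fun x => ENNReal.ofReal (∫ a, f ((a, x.1), x.2) ∂P)) t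
      = ∫⁻ x, ENNReal.ofReal (∫ a, f ((a, x.1), x.2) ∂P) * t.indicator 1 x ∂(q.prod Q) := by
    rw [← lintegral_indicator_one ht, lintegral_withDensity_eq_lintegral_mul _ (by fun_prop) hind]
    rfl
  have hind' : Measurable fun x : (A × B) × S => t.indicator (1 : B × S → ℝ≥0∞) (x.1.2, x.2) :=
    hind.comp (f := fun x : (A × B) × S => (x.1.2, x.2)) (by fun_prop)
  rw [hL, hR, hJ, lintegral_withDensity_eq_lintegral_mul _ (by fun_prop) hind']
  have hm1 : Measurable ((fun x : (A × B) × S => ENNReal.ofReal (f x))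
      * fun x => t.indicator (1 : B × S → ℝ≥0∞) (x.1.2, x.2)) :=
    Measurable.mul (by fun_prop) hind'
  have hm2 : Measurable fun x : B × S =>
      ENNReal.ofReal (∫ a, f ((a, x.1), x.2) ∂P) * t.indicator 1 x := Measurable.mul (by fun_prop) hind
  rw [lintegral_prod_symm _ hm1.aemeasurable,
    lintegral_prod_symm _ hm2.aemeasurable]
  refine lintegral_congr fun z => ?_
  rw [lintegral_prod_symm _ (measurable_of_finite _).aemeasurable]
  refine lintegral_congr fun b => ?_
  simp only [Pi.mul_apply]
  rw [lintegral_mul_const _ (measurable_of_finite _),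
    ofReal_integral_eq_lintegral_ofReal Integrable.of_finite (ae_of_all _ fun a => hf0 _)]

lemma withDensity_prod_singleton {J : Measure (A × S)} (hf : Measurable f)
    (hJ : J = (P.prod Q).withDensity fun x => ENNReal.ofReal (f x)) (a : A) {t : Set S}
    (ht : MeasurableSet t) :
    J ({a} ×ˢ t) = P {a} * Q.withDensity (fun z => ENNReal.ofReal (f (a, z))) t := by
  rw [hJ, withDensity_apply _ ((measurableSet_singleton a).prod ht), ← Measure.prod_restrict,
    lintegral_prod _ (by fun_prop), Measure.restrict_singleton, lintegral_smul_measure,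
    lintegral_dirac, withDensity_apply _ ht, smul_eq_mul]

end Density

end FiniteLetters

section LetterLaw

variable {X₁ X₂ Y₁ Y₂ Z V₁ V₂ : Type*} [MeasurableSpace X₁] [MeasurableSpace X₂]
  [MeasurableSpace Y₁] [MeasurableSpace Y₂] [MeasurableSpace Z] [MeasurableSpace V₁]
  [MeasurableSpace V₂] (W : Kernel (X₁ × X₂) (Y₁ × Y₂ × Z)) [IsMarkovKernel W]
  (P₁ : Input V₁ X₁) (P₂ : Input V₂ X₂)

lemma map_fst_letterLaw : (letterLaw W P₁ P₂).map Prod.fst = P₁.joint.prod P₂.joint := by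
  rw [letterLaw]
  exact Measure.fst_compProd _ _

lemma map_fst_joint (P : Input V₁ X₁) : P.joint.map Prod.fst = P.pV := Measure.fst_compProd _ _

lemma map_letterLaw_prefixes :
    (letterLaw W P₁ P₂).map (fun ω => (ω.1.1.1, ω.1.2.1)) = P₁.pV.prod P₂.pV := by
  have : (fun ω : ((V₁ × X₁) × (V₂ × X₂)) × (Y₁ × Y₂ × Z) => (ω.1.1.1, ω.1.2.1))
      = Prod.map Prod.fst Prod.fst ∘ Prod.fst := rfl
  rw [this, ← Measure.map_map (by fun_prop) (by fun_prop), map_fst_letterLaw,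
    ← Measure.map_prod_map _ _ (by fun_prop) (by fun_prop), map_fst_joint, map_fst_joint]

lemma map_letterLaw_prefix₁ : (letterLaw W P₁ P₂).map (fun ω => ω.1.1.1) = P₁.pV := by
  have h := congrArg Measure.fst (map_letterLaw_prefixes W P₁ P₂)
  rwa [Measure.fst_map_prodMk (by fun_prop), Measure.fst_prod] at h

lemma map_letterLaw_prefix₂ : (letterLaw W P₁ P₂).map (fun ω => ω.1.2.1) = P₂.pV := by
  have h := congrArg Measure.snd (map_letterLaw_prefixes W P₁ P₂)
  rwa [Measure.snd_map_prodMk (by fun_prop), Measure.snd_prod] at h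

end LetterLaw

section FiniteLetterBounds

open InformationTheory

variable {X₁ X₂ Y₁ Y₂ Z A B : Type*} [MeasurableSpace X₁] [MeasurableSpace X₂] [MeasurableSpace Y₁]
  [MeasurableSpace Y₂] [MeasurableSpace Z]
  [Finite A] [MeasurableSpace A] [MeasurableSingletonClass A] [Finite B] [MeasurableSpace B]
  [MeasurableSingletonClass B] (W : Kernel (X₁ × X₂) (Y₁ × Y₂ × Z)) [IsMarkovKernel W]
  (P₁ : Input A X₁) (P₂ : Input B X₂)

lemma mutualInfo_ne_top_of_finite {Ω S : Type*} [MeasurableSpace Ω] [MeasurableSpace S] {f : Ω → A}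
    {h : Ω → S} (hf : Measurable f) (hh : Measurable h) (μ : Measure Ω) [IsProbabilityMeasure μ] :
    mutualInfo f h μ ≠ ⊤ := by
  have := Measure.isProbabilityMeasure_map (μ := μ) hf.aemeasurable
  have := Measure.isProbabilityMeasure_map (μ := μ) hh.aemeasurable
  have := Measure.isProbabilityMeasure_map (μ := μ) (hf.prodMk hh).aemeasurable
  obtain ⟨g, C, hg, hg0, hC, hJ⟩ := exists_bounded_density (μ.map fun ω => (f ω, h ω))
  rw [Measure.fst_map_prodMk hh, Measure.snd_map_prodMk hf] at hJ
  exact (klDiv_of_bounded_density hg hg0 hC hJ).1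

lemma exists_decoding_density {Ω S : Type*} [MeasurableSpace Ω] [MeasurableSpace S] {f : Ω → A}
    {h : Ω → S} (hf : Measurable f) (hh : Measurable h) (μ : Measure Ω) [IsProbabilityMeasure μ]
    {t : ℝ} (ht : t < (mutualInfo f h μ).toReal) :
    ∀ᶠ s in 𝓝[>] (0 : ℝ), ∃ g : A → S → ℝ≥0∞, (∀ a, Measurable (g a)) ∧ (∀ a ξ, g a ξ ≠ ⊤) ∧
      ∫⁻ ω, g (f ω) (h ω) ^ (-s) ∂μ ≤ ENNReal.ofReal (Real.exp (-(s * t))) ∧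
      ∫⁻ a, ∫⁻ ω, g a (h ω) ∂μ ∂(μ.map f) ≤ 1 := by
  have := Measure.isProbabilityMeasure_map (μ := μ) hf.aemeasurable
  have := Measure.isProbabilityMeasure_map (μ := μ) hh.aemeasurable
  have := Measure.isProbabilityMeasure_map (μ := μ) (hf.prodMk hh).aemeasurable
  obtain ⟨g, C, hg, hg0, hC, hJ⟩ := exists_bounded_density (μ.map fun ω => (f ω, h ω))
  rw [Measure.fst_map_prodMk hh, Measure.snd_map_prodMk hf] at hJ
  filter_upwards [eventually_lintegral_density_rpow_neg_le hg hg0 hC hJ ht] with s hs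
  refine ⟨fun a ξ => ENNReal.ofReal (g (a, ξ)), fun a => by fun_prop,
    fun a ξ => ENNReal.ofReal_ne_top, ?_, ?_⟩
  · rwa [lintegral_map (by fun_prop) (by fun_prop)] at hs
  · have e : ∀ a, ∫⁻ ω, ENNReal.ofReal (g (a, h ω)) ∂μ
        = ∫⁻ ξ, ENNReal.ofReal (g (a, ξ)) ∂(μ.map h) := fun a =>
      (lintegral_map (f := fun ξ => ENNReal.ofReal (g (a, ξ))) (by fun_prop) hh).symm
    simp_rw [e]
    rw [← lintegral_prod (fun x => ENNReal.ofReal (g x)) (by fun_prop)]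
    have hu : ((μ.map f).prod (μ.map h)).withDensity (fun x => ENNReal.ofReal (g x)) Set.univ = 1 := by
      rw [← hJ, measure_univ]
    rw [withDensity_apply _ MeasurableSet.univ, Measure.restrict_univ] at hu
    exact hu.le

/-- For finite prefix alphabets, all exponential moment bounds hold for small exponents. -/
theorem eventually_letterBounds {r₁₂ r₁ r₂ t₁ t₂ : ℝ} (h₁₂ : (infoZ W P₁ P₂).toReal < r₁₂)
    (h₁ : (infoZ₁ W P₁ P₂).toReal < r₁) (h₂ : (infoZ₂ W P₁ P₂).toReal < r₂)
    (ht₁ : t₁ < (mutualInfo (fun ω => ω.1.1.1) (fun ω => (ω.1.2.2, ω.2.2.1))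
      (letterLaw W P₁ P₂)).toReal)
    (ht₂ : t₂ < (mutualInfo (fun ω => ω.1.2.1) (fun ω => (ω.1.1.2, ω.2.1))
      (letterLaw W P₁ P₂)).toReal) :
    ∀ᶠ s in 𝓝[>] (0 : ℝ), LetterBounds W P₁ P₂ s r₁₂ r₁ r₂ t₁ t₂ := by
  set μ := letterLaw W P₁ P₂ with hμ
  set J := μ.map (fun ω => ((ω.1.1.1, ω.1.2.1), ω.2.2.2)) with hJdef
  set Q := μ.map (fun ω => ω.2.2.2) with hQdef
  have iJ : IsProbabilityMeasure J := Measure.isProbabilityMeasure_map (by fun_prop)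
  have iQ : IsProbabilityMeasure Q := Measure.isProbabilityMeasure_map (by fun_prop)
  have hfst : J.fst = P₁.pV.prod P₂.pV := by
    rw [hJdef, Measure.fst_map_prodMk (by fun_prop), hμ, map_letterLaw_prefixes]
  have hsnd : J.snd = Q := by rw [hJdef, Measure.snd_map_prodMk (by fun_prop)]
  obtain ⟨f, C, hf, hf0, hC, hJ⟩ := exists_bounded_density J
  rw [hfst, hsnd] at hJ
  have hC0 : 0 ≤ C := (hf0 _).trans (hC (Classical.choice (nonempty_of_isProbabilityMeasure J)))
  have hJ1 := map_fst_withDensity hf hf0 hJ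
  have hJ2 := map_snd_withDensity hf hf0 hJ
  have hb1 : ∀ a z, 0 ≤ ∫ b, f ((a, b), z) ∂P₂.pV ∧ ∫ b, f ((a, b), z) ∂P₂.pV ≤ C := fun a z =>
    ⟨integral_nonneg fun b => hf0 _, by
      have := integral_mono (μ := P₂.pV) (f := fun b => f ((a, b), z)) (g := fun _ => C)
        Integrable.of_finite Integrable.of_finite fun b => hC _
      simpa using this⟩
  have hb2 : ∀ b z, 0 ≤ ∫ a, f ((a, b), z) ∂P₁.pV ∧ ∫ a, f ((a, b), z) ∂P₁.pV ≤ C := fun b z =>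
    ⟨integral_nonneg fun a => hf0 _, by
      have := integral_mono (μ := P₁.pV) (f := fun a => f ((a, b), z)) (g := fun _ => C)
        Integrable.of_finite Integrable.of_finite fun b => hC _
      simpa using this⟩
  have hm1 : Measurable fun x : A × Z => ∫ b, f ((x.1, b), x.2) ∂P₂.pV :=
    measurable_integral_of_finite _ fun b => by fun_prop
  have hm2 : Measurable fun x : B × Z => ∫ a, f ((a, x.1), x.2) ∂P₁.pV :=
    measurable_integral_of_finite _ fun b => by fun_prop
  have hJ1' : J.map (fun x => (x.1.1, x.2)) = μ.map (fun ω => (ω.1.1.1, ω.2.2.2)) := by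
    rw [hJdef, Measure.map_map (by fun_prop) (by fun_prop)]; rfl
  have hJ2' : J.map (fun x => (x.1.2, x.2)) = μ.map (fun ω => (ω.1.2.1, ω.2.2.2)) := by
    rw [hJdef, Measure.map_map (by fun_prop) (by fun_prop)]; rfl
  rw [hJ1'] at hJ1
  rw [hJ2'] at hJ2
  have iJ1 : IsProbabilityMeasure (μ.map fun ω => (ω.1.1.1, ω.2.2.2)) :=
    Measure.isProbabilityMeasure_map (by fun_prop)
  have iJ2 : IsProbabilityMeasure (μ.map fun ω => (ω.1.2.1, ω.2.2.2)) :=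
    Measure.isProbabilityMeasure_map (by fun_prop)
  have k12 : klDiv J ((P₁.pV.prod P₂.pV).prod Q) = infoZ W P₁ P₂ := by
    rw [infoZ, mutualInfo, ← hμ, ← hJdef, ← hQdef, ← map_letterLaw_prefixes W P₁ P₂]
  have k1 : klDiv (μ.map fun ω => (ω.1.1.1, ω.2.2.2)) (P₁.pV.prod Q) = infoZ₁ W P₁ P₂ := by
    rw [infoZ₁, mutualInfo_comm (by fun_prop) (by fun_prop), mutualInfo, ← hμ, ← hQdef, hμ,
      map_letterLaw_prefix₁]
  have k2 : klDiv (μ.map fun ω => (ω.1.2.1, ω.2.2.2)) (P₂.pV.prod Q) = infoZ₂ W P₁ P₂ := by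
    rw [infoZ₂, mutualInfo_comm (by fun_prop) (by fun_prop), mutualInfo, ← hμ, ← hQdef, hμ,
      map_letterLaw_prefix₂]
  rw [← k12] at h₁₂
  rw [← k1] at h₁
  rw [← k2] at h₂
  filter_upwards [eventually_lintegral_density_rpow_le hf hf0 hC hJ h₁₂,
    eventually_lintegral_density_rpow_le hm1 (fun x => (hb1 x.1 x.2).1) (fun x => (hb1 x.1 x.2).2)
      hJ1 h₁,
    eventually_lintegral_density_rpow_le hm2 (fun x => (hb2 x.1 x.2).1) (fun x => (hb2 x.1 x.2).2)
      hJ2 h₂,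
    exists_decoding_density (by fun_prop) (by fun_prop) μ ht₁,
    exists_decoding_density (by fun_prop) (by fun_prop) μ ht₂] with s e12 e1 e2 d1 d2
  rw [hμ, map_letterLaw_prefix₁] at d1
  rw [hμ, map_letterLaw_prefix₂] at d2
  refine ⟨⟨Q, fun a b z => f ((a, b), z), iQ, fun a b => by fun_prop, fun a b z => hf0 _, ?_, ?_, ?_,
    ?_, ?_⟩, d1, d2⟩
  · intro a b ha hb
    ext t ht
    have h1 := withDensity_prod_singleton hf hJ (a, b) ht
    rw [← Set.singleton_prod_singleton, Measure.prod_prod] at h1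
    have h2 : J (({a} ×ˢ {b}) ×ˢ t) = P₁.pV {a} * P₂.pV {b} *
        ((channelLaw W (P₁.pre a) (P₂.pre b)).map (fun ω => ω.2.2.2)) t := by
      have hms : MeasurableSet (((({a} : Set A) ×ˢ ({b} : Set B)) ×ˢ t)) :=
        ((measurableSet_singleton a).prod (measurableSet_singleton b)).prod ht
      rw [← lintegral_indicator_one hms, hJdef, lintegral_map (measurable_one.indicator hms)
        (by fun_prop)]
      have h3 := lintegral_letterLaw_comp W P₁ P₂
        (f := fun a' b' ω => ((({a} : Set A) ×ˢ ({b} : Set B)) ×ˢ t).indicator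
          (1 : (A × B) × Z → ℝ≥0∞) ((a', b'), ω.2.2.2))
        ((measurable_one.indicator hms).comp (f := fun ω : ((A × X₁) × (B × X₂)) × (Y₁ × Y₂ × Z) =>
          ((ω.1.1.1, ω.1.2.1), ω.2.2.2)) (by fun_prop))
      rw [h3]
      have := Fintype.ofFinite A
      have := Fintype.ofFinite B
      rw [lintegral_fintype, Finset.sum_eq_single a, lintegral_fintype, Finset.sum_eq_single b]
      · have h4 : ∀ ω : (X₁ × X₂) × (Y₁ × Y₂ × Z), ((({a} : Set A) ×ˢ ({b} : Set B)) ×ˢ t).indicator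
          (1 : (A × B) × Z → ℝ≥0∞) ((a, b), ω.2.2.2) = t.indicator 1 ω.2.2.2 := fun ω => by
          by_cases hω : ω.2.2.2 ∈ t <;> simp [hω]
        simp_rw [h4]
        rw [← lintegral_indicator_one ht, lintegral_map (measurable_one.indicator ht) (by fun_prop)]
        ring
      · intro b' _ hb'
        simp [hb']
      · simp
      · intro a' _ ha'
        simp [ha']
      · simp
    rw [h2] at h1
    refine (ENNReal.mul_right_inj ?_ ?_).1 h1
    · exact mul_ne_zero ha hb
    · exact ENNReal.mul_ne_top (measure_ne_top _ _) (measure_ne_top _ _)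
  · filter_upwards [ae_integral_density_le_one hf hf0 hJ hsnd] with z hz
    rwa [integral_prod _ Integrable.of_finite] at hz
  · rw [← lintegral_moment_eq hf hf0 hJ] at e12
    refine le_trans (le_of_eq ?_) e12
    refine lintegral_congr fun z => ?_
    rw [integral_prod _ Integrable.of_finite]
  · rw [← lintegral_moment_eq hm1 (fun x => (hb1 x.1 x.2).1) hJ1] at e1
    simp_rw [integral_mul_const]
    exact e1
  · rw [← lintegral_moment_eq hm2 (fun x => (hb2 x.1 x.2).1) hJ2] at e2
    refine le_trans (le_of_eq ?_) e2
    refine lintegral_congr fun z => ?_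
    rw [integral_integral_swap Integrable.of_finite]
    simp_rw [integral_mul_const]

end FiniteLetterBounds

section Refinement

open InformationTheory

variable {Ω : Type*} [MeasurableSpace Ω] (J N : Measure Ω) [IsFiniteMeasure J] [IsFiniteMeasure N]

lemma ofReal_mul_log_le_klDiv {B : Set Ω} {c : ℝ} (hc : 0 < c) :
    ENNReal.ofReal (Real.log c * J.real B + (1 - c) * N.real B) ≤ klDiv J N := by
  by_cases hac : J ≪ N
  swap
  · rw [klDiv_of_not_ac hac]; exact le_top
  rw [klDiv_eq_lintegral_klFun_of_ac hac]
  set h : Ω → ℝ := fun x => (J.rnDeriv N x).toReal with hh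
  have hi : Integrable h N := Measure.integrable_toReal_rnDeriv
  have hpt : ∀ x, 0 ≤ x → x * Real.log c + (1 - c) ≤ klFun x := by
    intro x hx
    rw [klFun_apply]
    rcases hx.eq_or_lt with rfl | hx
    · simp; exact hc.le
    · have h1 := Real.add_one_le_exp (Real.log c - Real.log x)
      rw [Real.exp_sub, Real.exp_log hc, Real.exp_log hx] at h1
      have h2 := mul_le_mul_of_nonneg_left h1 hx.le
      rw [mul_div_cancel₀ _ hx.ne'] at h2
      linarith
  calc ENNReal.ofReal (Real.log c * J.real B + (1 - c) * N.real B)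
      = ENNReal.ofReal (∫ x in B, (h x * Real.log c + (1 - c)) ∂N) := by
        rw [integral_add (hi.integrableOn.mul_const _) (integrable_const _), integral_mul_const,
          Measure.setIntegral_toReal_rnDeriv hac]
        simp [mul_comm]
    _ ≤ ∫⁻ x in B, ENNReal.ofReal (h x * Real.log c + (1 - c)) ∂N := by
        have hint : Integrable (fun x => h x * Real.log c + (1 - c)) (N.restrict B) :=
          (hi.integrableOn.mul_const _).add (integrable_const _)
        rw [integral_eq_lintegral_pos_part_sub_lintegral_neg_part hint]
        refine (ENNReal.ofReal_le_ofReal (sub_le_self _ ENNReal.toReal_nonneg)).trans ?_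
        exact ENNReal.ofReal_toReal_le
    _ ≤ ∫⁻ x in B, ENNReal.ofReal (klFun (h x)) ∂N :=
        lintegral_mono fun x => ENNReal.ofReal_le_ofReal (hpt _ ENNReal.toReal_nonneg)
    _ ≤ _ := setLIntegral_le_lintegral _ _

variable {E : ℕ → Type*} [∀ m, MeasurableSpace (E m)] {g : ∀ m, Ω → E m}

/-- Divergence is the limit of the divergences along refining measurable maps. -/
theorem eventually_lt_klDiv_map (hg : ∀ m, Measurable (g m))
    (hmono : Monotone fun m => MeasurableSpace.comap (g m) inferInstance)
    (hsup : (⨆ m, MeasurableSpace.comap (g m) inferInstance) = ‹MeasurableSpace Ω›)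
    {t : ℝ≥0∞} (ht : t < klDiv J N) :
    ∀ᶠ m in atTop, t < klDiv (J.map (g m)) (N.map (g m)) := by
  let ℱ : Filtration ℕ ‹MeasurableSpace Ω› :=
    { seq := fun m => MeasurableSpace.comap (g m) inferInstance
      mono' := hmono
      le' := fun m => (hg m).comap_le }
  by_cases hac : J ≪ N
  · set h : Ω → ℝ := fun x => (J.rnDeriv N x).toReal with hh
    have hi : Integrable h N := Measure.integrable_toReal_rnDeriv
    have hmeas : StronglyMeasurable[⨆ m, ℱ m] h := by
      have : (⨆ m, ℱ m) = ‹MeasurableSpace Ω› := hsup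
      rw [this]
      exact (Measure.measurable_rnDeriv J N).ennreal_toReal.stronglyMeasurable
    have hconv := hi.tendsto_ae_condExp hmeas
    have hval : ∀ m, klDiv (J.map (g m)) (N.map (g m))
        = ∫⁻ x, ENNReal.ofReal (klFun ((N[h | ℱ m]) x)) ∂N := by
      intro m
      rw [klDiv_eq_lintegral_klFun_of_ac (hac.map (hg m)), lintegral_map (by fun_prop) (hg m)]
      refine lintegral_congr_ae ?_
      filter_upwards [toReal_rnDeriv_map hac (hg m)] with x hx
      rw [hx]
    have hfatou : klDiv J N ≤ liminf (fun m => klDiv (J.map (g m)) (N.map (g m))) atTop := by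
      simp_rw [hval]
      refine le_trans (le_of_eq ?_) (lintegral_liminf_le' fun m => ?_)
      · rw [klDiv_eq_lintegral_klFun_of_ac hac]
        refine lintegral_congr_ae ?_
        filter_upwards [hconv] with x hx
        have := ((ENNReal.continuous_ofReal.comp continuous_klFun).tendsto (h x)).comp hx
        exact this.liminf_eq.symm
      · exact (ENNReal.continuous_ofReal.comp continuous_klFun).measurable.comp_aemeasurable
          integrable_condExp.aemeasurable
    exact eventually_lt_of_lt_liminf (ht.trans_le hfatou)
  · have hex : ∃ A, MeasurableSet A ∧ N A = 0 ∧ J A ≠ 0 := by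
      by_contra hcon
      push Not at hcon
      exact hac (Measure.AbsolutelyContinuous.mk fun s hs h0 => hcon s hs h0)
    obtain ⟨A, hA, hNA, hJA⟩ := hex
    have htt : t ≠ ⊤ := (ht.trans_le le_top).ne
    set a := J.real A with ha
    have ha0 : 0 < a := ENNReal.toReal_pos hJA (measure_ne_top _ _)
    set c : ℝ := Real.exp (2 * (t.toReal + 2) / a) with hc
    have hc0 : 0 < c := Real.exp_pos _
    obtain ⟨B, ⟨m₀, hB⟩, hBA⟩ := exists_measure_symmDiff_lt_of_generateFrom_isSetRing
      (μ := J + N) (C := {B | ∃ m, MeasurableSet[ℱ m] B})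
      ⟨⟨0, @MeasurableSet.empty _ (ℱ 0)⟩,
        fun s u ⟨m, hs⟩ ⟨k, hu⟩ => ⟨max m k, (ℱ.mono (le_max_left m k) _ hs).union
          (ℱ.mono (le_max_right m k) _ hu)⟩,
        fun s u ⟨m, hs⟩ ⟨k, hu⟩ => ⟨max m k, (ℱ.mono (le_max_left m k) _ hs).diff
          (ℱ.mono (le_max_right m k) _ hu)⟩⟩
      ⟨{Set.univ}, Set.countable_singleton _, by
        rw [Set.singleton_subset_iff]; exact ⟨0, @MeasurableSet.univ _ (ℱ 0)⟩, by simp⟩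
      (hsup.symm.trans (by
        rw [← MeasurableSpace.generateFrom_iUnion_measurableSet]
        congr 1
        ext s
        simp only [Set.mem_iUnion, Set.mem_ofPred_eq]))
      hA (ε := ENNReal.ofReal (min (a / 2) (1 / c)))
      (ENNReal.ofReal_pos.2 (lt_min (by positivity) (by positivity)))
    rw [Measure.add_apply] at hBA
    have hBm : MeasurableSet B := ℱ.le m₀ _ hB
    have hmin : 0 ≤ min (a / 2) (1 / c) := le_min (by positivity) (by positivity)
    have hNB : N.real B ≤ 1 / c := by
      have h1 : N B ≤ N (symmDiff B A) := by
        calc N B ≤ N (symmDiff B A ∪ A) := measure_mono fun x hx => by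
              by_cases hxA : x ∈ A
              · exact Or.inr hxA
              · exact Or.inl (Or.inl ⟨hx, hxA⟩)
          _ ≤ N (symmDiff B A) + N A := measure_union_le _ _
          _ = _ := by rw [hNA, add_zero]
      have h2 : N B ≤ ENNReal.ofReal (min (a / 2) (1 / c)) :=
        h1.trans (le_add_self.trans hBA.le)
      exact (ENNReal.toReal_le_of_le_ofReal hmin h2).trans (min_le_right _ _)
    have hJB : a / 2 ≤ J.real B := by
      have h1 : J A ≤ J (symmDiff B A) + J B := by
        refine le_trans (measure_mono fun x hx => ?_) (measure_union_le _ _)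
        by_cases hxB : x ∈ B
        · exact Or.inr hxB
        · exact Or.inl (Or.inr ⟨hx, hxB⟩)
      have h2 : J (symmDiff B A) ≤ ENNReal.ofReal (min (a / 2) (1 / c)) :=
        le_self_add.trans hBA.le
      have h3 : a ≤ J.real (symmDiff B A) + J.real B := by
        rw [ha, Measure.real, Measure.real, Measure.real,
          ← ENNReal.toReal_add (measure_ne_top _ _) (measure_ne_top _ _)]
        exact ENNReal.toReal_mono (by finiteness) h1
      have h4 := (ENNReal.toReal_le_of_le_ofReal hmin h2).trans (min_le_left _ _)
      rw [← Measure.real] at h4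
      linarith
    filter_upwards [eventually_ge_atTop m₀] with m hm
    obtain ⟨B', hB', hBB'⟩ : MeasurableSet[ℱ m] B := ℱ.mono hm _ hB
    have hlow := ofReal_mul_log_le_klDiv (J.map (g m)) (N.map (g m)) (B := B') hc0
    refine lt_of_lt_of_le ?_ hlow
    rw [Measure.real, Measure.real, Measure.map_apply (hg m) hB', Measure.map_apply (hg m) hB', hBB',
      ← Measure.real, ← Measure.real, ← ENNReal.ofReal_toReal htt]
    have ht0 : 0 ≤ t.toReal := ENNReal.toReal_nonneg
    have h1 : t.toReal + 2 ≤ Real.log c * J.real B := by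
      rw [hc, Real.log_exp]
      calc t.toReal + 2 = 2 * (t.toReal + 2) / a * (a / 2) := by field_simp
        _ ≤ _ := by gcongr
    have h2 : -1 ≤ (1 - c) * N.real B := by
      have h3 : c * N.real B ≤ 1 := by
        calc c * N.real B ≤ c * (1 / c) := by gcongr
          _ = 1 := by field_simp
      have h4 : 0 ≤ N.real B := measureReal_nonneg
      linarith
    rw [ENNReal.ofReal_lt_ofReal_iff (by linarith)]
    linarith

end Refinement

section Quantizer

variable (V : Type*) [MeasurableSpace V] [MeasurableSpace.CountablyGenerated V]

/-- Membership in the first `m` sets of a generating sequence. -/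
noncomputable def bitQuantizer (m : ℕ) (v : V) : Fin m → Bool :=
  fun j => MeasurableSpace.mapNatBool V v j

lemma measurable_bitQuantizer (m : ℕ) : Measurable (bitQuantizer V m) :=
  measurable_pi_iff.2 fun j => (measurable_pi_apply (j : ℕ)).comp
    (MeasurableSpace.measurable_mapNatBool (α := V))

variable {S : Type*} [MeasurableSpace S]

lemma measurable_bitQuantizer_prod (m : ℕ) :
    Measurable fun x : V × S => (bitQuantizer V m x.1, x.2) :=
  ((measurable_bitQuantizer V m).comp measurable_fst).prodMk measurable_snd

lemma monotone_comap_bitQuantizer :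
    Monotone fun m => MeasurableSpace.comap (fun x : V × S => (bitQuantizer V m x.1, x.2))
      inferInstance := by
  intro m k hmk
  have : (fun x : V × S => (bitQuantizer V m x.1, x.2))
      = (fun y : (Fin k → Bool) × S => ((fun j : Fin m => y.1 (Fin.castLE hmk j)), y.2))
        ∘ fun x : V × S => (bitQuantizer V k x.1, x.2) := rfl
  simp only
  rw [this, ← MeasurableSpace.comap_comp]
  exact MeasurableSpace.comap_mono (Measurable.comap_le (by fun_prop))

lemma iSup_comap_bitQuantizer :
    (⨆ m, MeasurableSpace.comap (fun x : V × S => (bitQuantizer V m x.1, x.2)) inferInstance)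
      = (inferInstance : MeasurableSpace (V × S)) := by
  refine le_antisymm (iSup_le fun m => (measurable_bitQuantizer_prod V m).comap_le) ?_
  refine sup_le ?_ ?_
  · rw [MeasurableSpace.comap_le_iff_le_map]
    refine (MeasurableSpace.generateFrom_natGeneratingSequence V).symm.le.trans
      (MeasurableSpace.generateFrom_le ?_)
    rintro _ ⟨n, rfl⟩
    refine le_iSup (fun m => MeasurableSpace.comap
      (fun x : V × S => (bitQuantizer V m x.1, x.2)) inferInstance) (n + 1) _ ?_
    refine ⟨{y | y.1 (Fin.last n) = true}, ?_, ?_⟩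
    · have hm : Measurable fun y : (Fin (n + 1) → Bool) × S => y.1 (Fin.last n) := by fun_prop
      exact hm (measurableSet_singleton true)
    · ext x
      simp [bitQuantizer, MeasurableSpace.mapNatBool]
  · refine le_trans ?_ (le_iSup _ 0)
    have : (Prod.snd : V × S → S) = Prod.snd ∘ fun x : V × S => (bitQuantizer V 0 x.1, x.2) := rfl
    rw [this, ← MeasurableSpace.comap_comp]
    exact MeasurableSpace.comap_mono measurable_snd.comap_le

end Quantizer

section Quantization

open InformationTheory

variable {Ω Ω' A B C D : Type*} [MeasurableSpace Ω] [MeasurableSpace Ω'] [MeasurableSpace A]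
  [MeasurableSpace B] [MeasurableSpace C] [MeasurableSpace D]

lemma mutualInfo_map {g : Ω → Ω'} (hg : Measurable g) {f : Ω' → A} {h : Ω' → B} (hf : Measurable f)
    (hh : Measurable h) (μ : Measure Ω) :
    mutualInfo f h (μ.map g) = mutualInfo (fun ω => f (g ω)) (fun ω => h (g ω)) μ := by
  rw [mutualInfo, mutualInfo, Measure.map_map (hf.prodMk hh) hg, Measure.map_map hf hg,
    Measure.map_map hh hg]
  rfl

lemma klDiv_map_prod_eq {f : Ω → A} {h : Ω → B} (hf : Measurable f) (hh : Measurable h)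
    {φ : A → C} {ψ : B → D} (hφ : Measurable φ) (hψ : Measurable ψ) (μ : Measure Ω)
    [IsProbabilityMeasure μ] :
    mutualInfo (fun ω => φ (f ω)) (fun ω => ψ (h ω)) μ
      = klDiv ((μ.map fun ω => (f ω, h ω)).map (Prod.map φ ψ))
        (((μ.map f).prod (μ.map h)).map (Prod.map φ ψ)) := by
  have := Measure.isProbabilityMeasure_map (μ := μ) hf.aemeasurable
  have := Measure.isProbabilityMeasure_map (μ := μ) hh.aemeasurable
  rw [mutualInfo, Measure.map_map (hφ.prodMap hψ) (hf.prodMk hh),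
    ← Measure.map_prod_map _ _ hφ hψ, Measure.map_map hφ hf, Measure.map_map hψ hh]
  rfl

lemma mutualInfo_comp_le {f : Ω → A} {h : Ω → B} (hf : Measurable f) (hh : Measurable h)
    {φ : A → C} {ψ : B → D} (hφ : Measurable φ) (hψ : Measurable ψ) (μ : Measure Ω)
    [IsProbabilityMeasure μ] :
    mutualInfo (fun ω => φ (f ω)) (fun ω => ψ (h ω)) μ ≤ mutualInfo f h μ := by
  have := Measure.isProbabilityMeasure_map (μ := μ) hf.aemeasurable
  have := Measure.isProbabilityMeasure_map (μ := μ) hh.aemeasurable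
  have := Measure.isProbabilityMeasure_map (μ := μ) (hf.prodMk hh).aemeasurable
  rw [klDiv_map_prod_eq hf hh hφ hψ, mutualInfo]
  exact klDiv_map_le _ _ (hφ.prodMap hψ)

/-- If `h` is independent of `k`, then `I(f; h | k) = I(h; (k, f))`. -/
lemma condMutualInfo_eq_mutualInfo [StandardBorelSpace A] [Nonempty A] [StandardBorelSpace B]
    [Nonempty B] {f : Ω → A} {h : Ω → B} {k : Ω → C} (hf : Measurable f) (hh : Measurable h)
    (hk : Measurable k) (μ : Measure Ω) [IsProbabilityMeasure μ]
    (hind : μ.map (fun ω => (k ω, h ω)) = (μ.map k).prod (μ.map h)) :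
    condMutualInfo f h k μ = mutualInfo h (fun ω => (k ω, f ω)) μ := by
  have i1 := Measure.isProbabilityMeasure_map (μ := μ) hh.aemeasurable
  have i2 := Measure.isProbabilityMeasure_map (μ := μ) hk.aemeasurable
  have i3 := Measure.isProbabilityMeasure_map (μ := μ) (hk.prodMk hf).aemeasurable
  have i4 := Measure.isProbabilityMeasure_map (μ := μ) (hk.prodMk (hf.prodMk hh)).aemeasurable
  have hcond : condDistrib h k μ =ᵐ[μ.map k] Kernel.const C (μ.map h) :=
    condDistrib_ae_eq_of_measure_eq_compProd k hh.aemeasurable (by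
      rw [Measure.compProd_const]; exact hind)
  have hker : (condDistrib f k μ ×ₖ condDistrib h k μ)
      =ᵐ[μ.map k] (condDistrib f k μ ×ₖ Kernel.const C (μ.map h)) := by
    filter_upwards [hcond] with c hc
    rw [Kernel.prod_apply, Kernel.prod_apply, hc]
  rw [condMutualInfo, Measure.compProd_congr hker, mutualInfo]
  let e : C × A × B ≃ᵐ B × C × A :=
    MeasurableEquiv.prodAssoc.symm.trans MeasurableEquiv.prodComm
  rw [← klDiv_map_measurableEquiv _ _ e]
  congr 1
  · rw [Measure.map_map e.measurable (hk.prodMk (hf.prodMk hh))]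
    rfl
  · have hkf : μ.map (fun ω => (k ω, f ω)) = (μ.map k) ⊗ₘ condDistrib f k μ :=
      (compProd_map_condDistrib hf.aemeasurable).symm
    rw [hkf]
    refine Measure.ext_of_lintegral _ fun φ hφ => ?_
    have hφe : Measurable fun a : C × A × B => φ (e a) := hφ.comp e.measurable
    rw [lintegral_map hφ e.measurable, Measure.lintegral_compProd hφe,
      lintegral_prod_symm _ hφ.aemeasurable,
      Measure.lintegral_compProd (Measurable.lintegral_prod_left' hφ)]
    refine lintegral_congr fun c => ?_
    have hc : Measurable fun a : A × B => φ (e (c, a)) := hφe.comp (measurable_prodMk_left (x := c))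
    rw [Kernel.prod_apply, lintegral_prod _ hc.aemeasurable]
    rfl

end Quantization

section QuantizedInput

variable {V X A : Type*} [MeasurableSpace V] [MeasurableSpace X] [StandardBorelSpace X] [Nonempty X]
  [MeasurableSpace A]

/-- The input obtained by replacing the prefix variable `V` by `q V`. -/
noncomputable def Input.quantize (P : Input V X) (q : V → A) (hq : Measurable q) : Input A X where
  pV := P.joint.map fun x => q x.1
  pre := condDistrib (fun x : V × X => x.2) (fun x : V × X => q x.1) P.joint
  isProb := Measure.isProbabilityMeasure_map (by fun_prop)
  isMarkov := inferInstance

lemma Input.joint_quantize (P : Input V X) {q : V → A} (hq : Measurable q) :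
    (P.quantize q hq).joint = P.joint.map fun x => (q x.1, x.2) := by
  have hm : AEMeasurable (fun x : V × X => x.2) P.joint := by fun_prop
  exact compProd_map_condDistrib hm

lemma Input.map_snd_joint_quantize (P : Input V X) {q : V → A} (hq : Measurable q) :
    (P.quantize q hq).joint.map Prod.snd = P.joint.map Prod.snd := by
  rw [P.joint_quantize hq, Measure.map_map (by fun_prop) (by fun_prop)]
  rfl

end QuantizedInput

section QuantizedLetter

open InformationTheory

variable {X₁ X₂ Y₁ Y₂ Z V₁ V₂ A₁ A₂ : Type*} [MeasurableSpace X₁] [MeasurableSpace X₂]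
  [StandardBorelSpace X₁] [Nonempty X₁] [StandardBorelSpace X₂] [Nonempty X₂]
  [MeasurableSpace Y₁] [MeasurableSpace Y₂] [MeasurableSpace Z] [MeasurableSpace V₁]
  [MeasurableSpace V₂] [MeasurableSpace A₁] [MeasurableSpace A₂]
  (W : Kernel (X₁ × X₂) (Y₁ × Y₂ × Z)) [IsMarkovKernel W]
  (P₁ : Input V₁ X₁) (P₂ : Input V₂ X₂) {q₁ : V₁ → A₁} (hq₁ : Measurable q₁)
  {q₂ : V₂ → A₂} (hq₂ : Measurable q₂)

include hq₁ hq₂ in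
lemma measurable_quantize_sample :
    Measurable fun ω : ((V₁ × X₁) × (V₂ × X₂)) × (Y₁ × Y₂ × Z) =>
      (((q₁ ω.1.1.1, ω.1.1.2), (q₂ ω.1.2.1, ω.1.2.2)), ω.2) := by
  fun_prop

lemma letterLaw_quantize :
    letterLaw W (P₁.quantize q₁ hq₁) (P₂.quantize q₂ hq₂)
      = (letterLaw W P₁ P₂).map fun ω =>
        (((q₁ ω.1.1.1, ω.1.1.2), (q₂ ω.1.2.1, ω.1.2.2)), ω.2) := by
  refine Measure.ext_of_lintegral _ fun φ hφ => ?_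
  have hm := measurable_quantize_sample (X₁ := X₁) (X₂ := X₂) (Y₁ := Y₁) (Y₂ := Y₂) (Z := Z) hq₁ hq₂
  have hφm : Measurable fun ω : ((V₁ × X₁) × (V₂ × X₂)) × (Y₁ × Y₂ × Z) =>
      φ (((q₁ ω.1.1.1, ω.1.1.2), (q₂ ω.1.2.1, ω.1.2.2)), ω.2) := hφ.comp hm
  rw [lintegral_map hφ hm, letterLaw, letterLaw, Measure.lintegral_compProd hφ,
    Measure.lintegral_compProd hφm, P₁.joint_quantize, P₂.joint_quantize,
    Measure.map_prod_map _ _ (by fun_prop) (by fun_prop), lintegral_map _ (by fun_prop)]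
  · rfl
  · exact Measurable.lintegral_kernel_prod_right' hφ

lemma infoZ₁_quantize_le :
    infoZ₁ W (P₁.quantize q₁ hq₁) (P₂.quantize q₂ hq₂) ≤ infoZ₁ W P₁ P₂ := by
  rw [infoZ₁, infoZ₁, letterLaw_quantize,
    mutualInfo_map (measurable_quantize_sample hq₁ hq₂) (by fun_prop) (by fun_prop)]
  exact mutualInfo_comp_le (f := fun ω : ((V₁ × X₁) × (V₂ × X₂)) × (Y₁ × Y₂ × Z) => ω.2.2.2)
    (h := fun ω => ω.1.1.1) (φ := id) (by fun_prop) (by fun_prop) measurable_id hq₁ _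

lemma infoZ₂_quantize_le :
    infoZ₂ W (P₁.quantize q₁ hq₁) (P₂.quantize q₂ hq₂) ≤ infoZ₂ W P₁ P₂ := by
  rw [infoZ₂, infoZ₂, letterLaw_quantize,
    mutualInfo_map (measurable_quantize_sample hq₁ hq₂) (by fun_prop) (by fun_prop)]
  exact mutualInfo_comp_le (f := fun ω : ((V₁ × X₁) × (V₂ × X₂)) × (Y₁ × Y₂ × Z) => ω.2.2.2)
    (h := fun ω => ω.1.2.1) (φ := id) (by fun_prop) (by fun_prop) measurable_id hq₂ _

lemma infoZ_quantize_le :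
    infoZ W (P₁.quantize q₁ hq₁) (P₂.quantize q₂ hq₂) ≤ infoZ W P₁ P₂ := by
  rw [infoZ, infoZ, letterLaw_quantize,
    mutualInfo_map (measurable_quantize_sample hq₁ hq₂) (by fun_prop) (by fun_prop)]
  exact mutualInfo_comp_le
    (f := fun ω : ((V₁ × X₁) × (V₂ × X₂)) × (Y₁ × Y₂ × Z) => (ω.1.1.1, ω.1.2.1))
    (h := fun ω => ω.2.2.2) (φ := Prod.map q₁ q₂) (ψ := id) (by fun_prop) (by fun_prop)
    (hq₁.prodMap hq₂) measurable_id _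

lemma infoY₂_eq_mutualInfo [StandardBorelSpace Y₂] [Nonempty Y₂] [StandardBorelSpace V₁]
    [Nonempty V₁] :
    infoY₂ W P₁ P₂
      = mutualInfo (fun ω => ω.1.1.1) (fun ω => (ω.1.2.2, ω.2.2.1)) (letterLaw W P₁ P₂) := by
  refine condMutualInfo_eq_mutualInfo (by fun_prop) (by fun_prop) (by fun_prop) _ ?_
  have h1 : (fun ω : ((V₁ × X₁) × (V₂ × X₂)) × (Y₁ × Y₂ × Z) => (ω.1.2.2, ω.1.1.1))
      = Prod.swap ∘ Prod.map Prod.fst Prod.snd ∘ Prod.fst := rfl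
  have h2 : (fun ω : ((V₁ × X₁) × (V₂ × X₂)) × (Y₁ × Y₂ × Z) => ω.1.2.2)
      = Prod.snd ∘ Prod.snd ∘ Prod.fst := rfl
  rw [h1, map_letterLaw_prefix₁, h2, ← Measure.map_map (by fun_prop) (by fun_prop),
    ← Measure.map_map (by fun_prop) (by fun_prop), ← Measure.map_map (by fun_prop) (by fun_prop),
    ← Measure.map_map (by fun_prop) (by fun_prop), map_fst_letterLaw,
    ← Measure.map_prod_map _ _ (by fun_prop) (by fun_prop), map_fst_joint, Measure.prod_swap,
    Measure.map_snd_prod]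
  simp

lemma infoY₁_eq_mutualInfo [StandardBorelSpace Y₁] [Nonempty Y₁] [StandardBorelSpace V₂]
    [Nonempty V₂] :
    infoY₁ W P₁ P₂
      = mutualInfo (fun ω => ω.1.2.1) (fun ω => (ω.1.1.2, ω.2.1)) (letterLaw W P₁ P₂) := by
  refine condMutualInfo_eq_mutualInfo (by fun_prop) (by fun_prop) (by fun_prop) _ ?_
  have h1 : (fun ω : ((V₁ × X₁) × (V₂ × X₂)) × (Y₁ × Y₂ × Z) => (ω.1.1.2, ω.1.2.1))
      = Prod.map Prod.snd Prod.fst ∘ Prod.fst := rfl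
  have h2 : (fun ω : ((V₁ × X₁) × (V₂ × X₂)) × (Y₁ × Y₂ × Z) => ω.1.1.2)
      = Prod.snd ∘ Prod.fst ∘ Prod.fst := rfl
  rw [h1, map_letterLaw_prefix₂, h2, ← Measure.map_map (by fun_prop) (by fun_prop),
    ← Measure.map_map (by fun_prop) (by fun_prop),
    ← Measure.map_map (by fun_prop) (by fun_prop), map_fst_letterLaw,
    ← Measure.map_prod_map _ _ (by fun_prop) (by fun_prop), map_fst_joint,
    Measure.map_fst_prod]
  simp

lemma eventually_lt_mutualInfo_bitQuantizer {Ω V S : Type*} [MeasurableSpace Ω]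
    [MeasurableSpace V] [MeasurableSpace.CountablyGenerated V] [MeasurableSpace S]
    {f : Ω → V} {h : Ω → S} (hf : Measurable f)
    (hh : Measurable h) (μ : Measure Ω) [IsProbabilityMeasure μ] {t : ℝ≥0∞}
    (ht : t < mutualInfo f h μ) :
    ∀ᶠ m in atTop, t < mutualInfo (fun ω => bitQuantizer V m (f ω)) h μ := by
  have := Measure.isProbabilityMeasure_map (μ := μ) hf.aemeasurable
  have := Measure.isProbabilityMeasure_map (μ := μ) hh.aemeasurable
  have := Measure.isProbabilityMeasure_map (μ := μ) (hf.prodMk hh).aemeasurable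
  filter_upwards [eventually_lt_klDiv_map _ _ (measurable_bitQuantizer_prod V (S := S))
    (monotone_comap_bitQuantizer V) (iSup_comap_bitQuantizer V) ht] with m hm
  refine hm.trans_le (le_of_eq ?_)
  exact (klDiv_map_prod_eq hf hh (measurable_bitQuantizer V m) measurable_id μ).symm

lemma eventually_lt_toReal_mutualInfo_bitQuantizer {Ω V S : Type*} [MeasurableSpace Ω]
    [MeasurableSpace V] [MeasurableSpace.CountablyGenerated V] [MeasurableSpace S]
    {f : Ω → V} {h : Ω → S} (hf : Measurable f)
    (hh : Measurable h) (μ : Measure Ω) [IsProbabilityMeasure μ] {t : ℝ}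
    (ht : t < 0 ∨ ENNReal.ofReal t < mutualInfo f h μ) :
    ∀ᶠ m in atTop, t < (mutualInfo (fun ω => bitQuantizer V m (f ω)) h μ).toReal := by
  rcases lt_or_ge t 0 with h0 | h0
  · exact Eventually.of_forall fun m => h0.trans_le ENNReal.toReal_nonneg
  · replace ht := ht.resolve_left h0.not_gt
    filter_upwards [eventually_lt_mutualInfo_bitQuantizer hf hh μ ht] with m hm
    exact (ENNReal.ofReal_lt_iff_lt_toReal h0 (mutualInfo_ne_top_of_finite
      ((measurable_bitQuantizer V m).comp hf) hh μ)).1 hm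

/-- Quantizing the prefix variables finely enough loses nothing. -/
theorem eventually_letterBounds_quantize [StandardBorelSpace Y₁] [Nonempty Y₁]
    [StandardBorelSpace Y₂] [Nonempty Y₂] [StandardBorelSpace V₁] [Nonempty V₁]
    [StandardBorelSpace V₂] [Nonempty V₂] {r₁₂ r₁ r₂ t₁ t₂ : ℝ}
    (h₁₂ : infoZ W P₁ P₂ < ENNReal.ofReal r₁₂) (h₁ : infoZ₁ W P₁ P₂ < ENNReal.ofReal r₁)
    (h₂ : infoZ₂ W P₁ P₂ < ENNReal.ofReal r₂) (ht₁ : t₁ < 0 ∨ ENNReal.ofReal t₁ < infoY₂ W P₁ P₂)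
    (ht₂ : t₂ < 0 ∨ ENNReal.ofReal t₂ < infoY₁ W P₁ P₂) :
    ∀ᶠ m in atTop, ∀ᶠ s in 𝓝[>] (0 : ℝ),
      LetterBounds W (P₁.quantize _ (measurable_bitQuantizer V₁ m))
        (P₂.quantize _ (measurable_bitQuantizer V₂ m)) s r₁₂ r₁ r₂ t₁ t₂ := by
  rw [infoY₂_eq_mutualInfo] at ht₁
  rw [infoY₁_eq_mutualInfo] at ht₂
  filter_upwards [eventually_lt_toReal_mutualInfo_bitQuantizer (by fun_prop) (by fun_prop) _ ht₁,
    eventually_lt_toReal_mutualInfo_bitQuantizer (by fun_prop) (by fun_prop) _ ht₂] with m h3 h4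
  have hm := measurable_quantize_sample (X₁ := X₁) (X₂ := X₂) (Y₁ := Y₁) (Y₂ := Y₂) (Z := Z)
    (measurable_bitQuantizer V₁ m) (measurable_bitQuantizer V₂ m)
  refine eventually_letterBounds W _ _
    (ENNReal.toReal_lt_of_lt_ofReal ((infoZ_quantize_le W P₁ P₂ _ _).trans_lt h₁₂))
    (ENNReal.toReal_lt_of_lt_ofReal ((infoZ₁_quantize_le W P₁ P₂ _ _).trans_lt h₁))
    (ENNReal.toReal_lt_of_lt_ofReal ((infoZ₂_quantize_le W P₁ P₂ _ _).trans_lt h₂)) ?_ ?_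
  · rwa [letterLaw_quantize, mutualInfo_map hm (by fun_prop) (by fun_prop)]
  · rwa [letterLaw_quantize, mutualInfo_map hm (by fun_prop) (by fun_prop)]

end QuantizedLetter

section Frequencies

/-- A sequence of letters with prescribed limiting frequencies. -/
theorem exists_seq_tendsto_average {ι : Type*} [Fintype ι] {q : ι → ℝ} (hq : ∀ i, 0 ≤ q i)
    (hq1 : ∑ i, q i = 1) :
    ∃ a : ℕ → ι, (∀ k, 0 < q (a k)) ∧ ∀ f : ι → ℝ,
      Tendsto (fun n : ℕ => (∑ k : Fin n, f (a k)) / n) atTop (𝓝 (∑ i, q i * f i)) := by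
  classical
  let _ : MeasurableSpace ι := ⊤
  let p : Measure ι := ∑ i, ENNReal.ofReal (q i) • Measure.dirac i
  have hp : IsProbabilityMeasure p := ⟨by
    simp only [p, Measure.coe_finsetSum, Finset.sum_apply, Measure.smul_apply, smul_eq_mul,
      measure_univ, mul_one]
    rw [← ENNReal.ofReal_sum_of_nonneg fun i _ => hq i, hq1, ENNReal.ofReal_one]⟩
  have hint : ∀ f : ι → ℝ, ∫ i, f i ∂p = ∑ i, q i * f i := fun f => by
    rw [integral_finsetSum_measure fun i _ => (Integrable.of_finite (μ := Measure.dirac i)).smul_measure ENNReal.ofReal_ne_top]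
    refine Finset.sum_congr rfl fun i _ => ?_
    rw [integral_smul_measure, integral_dirac, ENNReal.toReal_ofReal (hq i), smul_eq_mul]
  let μ : Measure (ℕ → ι) := Measure.infinitePi fun _ => p
  have hev : ∀ k, μ.map (fun ω => ω k) = p := fun k => Measure.infinitePi_map_eval _ k
  have hpos : ∀ᵐ ω ∂μ, ∀ k, 0 < q (ω k) := by
    rw [ae_all_iff]
    intro k
    have h0 : ∀ᵐ i ∂p, 0 < q i := by
      rw [ae_iff]
      simp only [p, Measure.coe_finsetSum, Finset.sum_apply, Measure.smul_apply, smul_eq_mul,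
        Finset.sum_eq_zero_iff, Finset.mem_univ, true_imp_iff, not_lt]
      intro i
      by_cases hi : q i ≤ 0
      · simp [ENNReal.ofReal_of_nonpos hi]
      · simp [hi]
    rw [← hev k] at h0
    exact ae_of_ae_map (measurable_pi_apply k).aemeasurable h0
  have hlln : ∀ᵐ ω ∂μ, ∀ j : ι, Tendsto (fun n : ℕ =>
      (∑ k ∈ Finset.range n, if ω k = j then (1 : ℝ) else 0) / n) atTop (𝓝 (q j)) := by
    rw [ae_all_iff]
    intro j
    have hm : Measurable fun i : ι => if i = j then (1 : ℝ) else 0 := measurable_of_finite _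
    have h := strong_law_ae_real (μ := μ) (fun k ω => if ω k = j then (1 : ℝ) else 0) ?_ ?_ ?_
    · have e : ∫ ω, (if ω 0 = j then (1 : ℝ) else 0) ∂μ = q j := by
        have := integral_map (μ := μ) (measurable_pi_apply 0).aemeasurable
          (f := fun i : ι => if i = j then (1 : ℝ) else 0) hm.aestronglyMeasurable
        rw [← this, hev 0, hint]
        simp
      rwa [e] at h
    · refine Integrable.of_bound (C := 1) (hm.comp (measurable_pi_apply 0)).aestronglyMeasurable
        (Eventually.of_forall fun ω => ?_)
      split_ifs <;> simp
    · intro k l hkl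
      exact (iIndepFun_infinitePi (P := fun _ : ℕ => p) (fun _ => hm)).indepFun hkl
    · intro k
      refine IdentDistrib.comp (u := fun i : ι => if i = j then (1 : ℝ) else 0)
        (f := fun ω : ℕ → ι => ω k) (g := fun ω : ℕ → ι => ω 0)
        ⟨(measurable_pi_apply k).aemeasurable, (measurable_pi_apply 0).aemeasurable, ?_⟩ hm
      rw [hev, hev]
  obtain ⟨a, ha, hlim⟩ := (hpos.and hlln).exists
  refine ⟨a, ha, fun f => ?_⟩
  have h := tendsto_finsetSum Finset.univ fun j _ => (hlim j).mul_const (f j)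
  refine h.congr fun n => ?_
  have e : ∀ j, (∑ k ∈ Finset.range n, if a k = j then (1 : ℝ) else 0) / n * f j
      = (∑ k : Fin n, if a k = j then f j else 0) / n := fun j => by
    rw [Finset.sum_range fun k => if a k = j then (1 : ℝ) else 0, div_mul_eq_mul_div,
      Finset.sum_mul]
    simp
  simp_rw [e]
  rw [← Finset.sum_div, Finset.sum_comm]
  simp

end Frequencies

section WeakLaw

variable {ι X : Type*} [Finite ι] [MeasurableSpace X]

lemma exists_truncation_integral_le (μ : ι → Measure X) [∀ i, IsProbabilityMeasure (μ i)]
    {g : X → ℝ} (hint : ∀ i, Integrable g (μ i)) {γ : ℝ} (hγ : 0 < γ) :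
    ∃ A : ℝ, 0 < A ∧ ∀ i, ∫ x, |g x - truncation g A x| ∂(μ i) ≤ γ := by
  have h : ∀ i, Tendsto (fun A : ℝ => ∫ x, |g x - truncation g A x| ∂(μ i)) atTop (𝓝 0) := by
    intro i
    have h0 : ∫ x, (0 : ℝ) ∂(μ i) = 0 := by simp
    rw [← h0]
    refine tendsto_integral_filter_of_dominated_convergence (fun x => 2 * |g x|)
      (Eventually.of_forall fun A => ?_) (Eventually.of_forall fun A => ae_of_all _ fun x => ?_)
      ((hint i).abs.const_mul 2) (ae_of_all _ fun x => ?_)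
    · exact ((hint i).1.sub (hint i).1.truncation).norm
    · rw [Real.norm_eq_abs, abs_abs, two_mul]
      exact (abs_sub _ _).trans (add_le_add le_rfl (abs_truncation_le_abs_self _ _ _))
    · refine tendsto_const_nhds.congr' ?_
      filter_upwards [eventually_gt_atTop |g x|] with A hA
      rw [truncation_eq_self hA, sub_self, abs_zero]
  have h' : ∀ᶠ A : ℝ in atTop, ∀ i, ∫ x, |g x - truncation g A x| ∂(μ i) < γ :=
    eventually_all.2 fun i => (h i).eventually (gt_mem_nhds hγ)
  obtain ⟨A, hA, hA0⟩ := (h'.and (eventually_gt_atTop 0)).exists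
  exact ⟨A, hA0, fun i => (hA i).le⟩

/-- The weak law of large numbers for independent samples from finitely many distributions. -/
theorem eventually_pi_sum_gt_le (μ : ι → Measure X) [∀ i, IsProbabilityMeasure (μ i)] {g : X → ℝ}
    (hint : ∀ i, Integrable g (μ i)) {δ ε : ℝ} (hδ : 0 < δ) (hε : 0 < ε) :
    ∀ᶠ n : ℕ in atTop, ∀ J : Fin n → ι, Measure.pi (fun k => μ (J k))
      {x | ∑ k, ∫ y, g y ∂(μ (J k)) + n * δ < ∑ k, g (x k)} ≤ ENNReal.ofReal ε := by
  obtain ⟨A, hA0, hA⟩ := exists_truncation_integral_le μ hint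
    (γ := min (δ / 4) (ε * δ / 8)) (by positivity)
  set h := truncation g A with hh
  have hhm : ∀ i, AEStronglyMeasurable h (μ i) := fun i => (hint i).1.truncation
  have hhi : ∀ i, Integrable h (μ i) := fun i => (hint i).1.integrable_truncation
  filter_upwards [eventually_gt_atTop 0, eventually_ge_atTop ⌈32 * A ^ 2 / (δ ^ 2 * ε)⌉₊]
    with n hn0 hn J
  have hn0' : (0 : ℝ) < n := by exact_mod_cast hn0
  have hn' : 32 * A ^ 2 / (δ ^ 2 * ε) ≤ n := (Nat.le_ceil _).trans (by exact_mod_cast hn)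
  rw [div_le_iff₀ (by positivity)] at hn'
  set P := Measure.pi fun k => μ (J k) with hP
  have hmp : ∀ k, MeasurePreserving (fun x : Fin n → X => x k) P (μ (J k)) :=
    fun k => measurePreserving_eval _ k
  have hev : ∀ (k : Fin n) {f : X → ℝ}, Integrable f (μ (J k)) →
      Integrable (fun x : Fin n → X => f (x k)) P :=
    fun k f hf => (hmp k).integrable_comp_of_integrable hf
  have hevint : ∀ (k : Fin n) {f : X → ℝ}, AEStronglyMeasurable f (μ (J k)) →
      ∫ x, f (x k) ∂P = ∫ y, f y ∂(μ (J k)) := fun k f hf => integral_comp_eval hf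
  have hd : ∀ i, Integrable (fun x => |g x - h x|) (μ i) := fun i => ((hint i).sub (hhi i)).abs
  have hmean : ∫ x, ∑ k, h (x k) ∂P = ∑ k, ∫ y, h y ∂(μ (J k)) := by
    rw [integral_finsetSum _ fun k _ => hev k (hhi _)]
    exact Finset.sum_congr rfl fun k _ => hevint k (hhm _)
  have hvar : variance (fun x => ∑ k, h (x k)) P ≤ n * A ^ 2 := by
    have e := variance_sum_pi (μ := fun k => μ (J k)) (X := fun _ => h)
      fun k => (hint _).1.memLp_truncation
    have e' : (∑ k : Fin n, fun x : Fin n → X => h (x k)) = fun x => ∑ k, h (x k) := by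
      ext x; simp
    rw [e'] at e
    rw [hP, e]
    refine (Finset.sum_le_card_nsmul _ _ (A ^ 2) fun k _ => ?_).trans (by simp)
    refine (variance_le_sq_of_bounded (a := -A) (b := A) (ae_of_all _ fun x => ?_)
      (hhm _).aemeasurable).trans (le_of_eq (by ring))
    have := abs_truncation_le_bound g A x
    rw [abs_of_pos hA0] at this
    exact abs_le.1 this
  have hcheb : P {x | n * δ / 4 ≤ |∑ k, h (x k) - ∑ k, ∫ y, h y ∂(μ (J k))|}
      ≤ ENNReal.ofReal (ε / 2) := by
    have hL : MemLp (fun x : Fin n → X => ∑ k, h (x k)) 2 P := memLp_finsetSum _ fun k _ =>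
      MemLp.comp_measurePreserving (g := h) ((hint (J k)).1.memLp_truncation) (hmp k)
    have := meas_ge_le_variance_div_sq hL (c := n * δ / 4) (by positivity)
    rw [hmean] at this
    refine this.trans (ENNReal.ofReal_le_ofReal ?_)
    rw [div_le_iff₀ (by positivity)]
    refine hvar.trans ?_
    nlinarith
  have hmark : P {x | n * δ / 4 ≤ ∑ k, |g (x k) - h (x k)|} ≤ ENNReal.ofReal (ε / 2) := by
    have hm := mul_meas_ge_le_integral_of_nonneg (μ := P)
      (f := fun x : Fin n → X => ∑ k, |g (x k) - h (x k)|)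
      (ae_of_all _ fun x => Finset.sum_nonneg fun k _ => abs_nonneg _)
      (integrable_finsetSum _ fun k _ => hev k (hd _)) (n * δ / 4)
    rw [integral_finsetSum _ fun k _ => hev k (hd _)] at hm
    have hb : ∑ k : Fin n, ∫ x, |g (x k) - h (x k)| ∂P ≤ n * (ε * δ / 8) := by
      refine (Finset.sum_le_card_nsmul _ _ (ε * δ / 8) fun k _ => ?_).trans (by simp)
      rw [hevint k (f := fun y => |g y - h y|) (hd _).1]
      exact (hA _).trans (min_le_right _ _)
    rw [← ENNReal.ofReal_toReal (measure_ne_top P _)]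
    refine ENNReal.ofReal_le_ofReal ?_
    have h4 : (0 : ℝ) < n * δ / 4 := by positivity
    refine le_of_mul_le_mul_left ((hm.trans hb).trans (le_of_eq (by ring))) h4
  have hsub : {x : Fin n → X | ∑ k, ∫ y, g y ∂(μ (J k)) + n * δ < ∑ k, g (x k)}
      ⊆ {x | n * δ / 4 ≤ |∑ k, h (x k) - ∑ k, ∫ y, h y ∂(μ (J k))|}
        ∪ {x | n * δ / 4 ≤ ∑ k, |g (x k) - h (x k)|} := by
    intro x hx
    rw [Set.mem_union]
    simp only [Set.mem_ofPred_eq] at hx ⊢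
    by_contra! hc
    obtain ⟨hc1, hc2⟩ := hc
    have h1 : ∑ k, g (x k) ≤ ∑ k, h (x k) + ∑ k, |g (x k) - h (x k)| := by
      rw [← Finset.sum_add_distrib]
      exact Finset.sum_le_sum fun k _ => by linarith [le_abs_self (g (x k) - h (x k))]
    have h2 : ∑ k, ∫ y, h y ∂(μ (J k)) ≤ ∑ k, ∫ y, g y ∂(μ (J k)) + n * (δ / 4) := by
      have h3 : ∀ i, ∫ y, h y ∂(μ i) ≤ ∫ y, g y ∂(μ i) + δ / 4 := fun i => by
        have h5 : ∫ y, (h y - g y) ∂(μ i) ≤ ∫ y, |g y - h y| ∂(μ i) :=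
          integral_mono ((hhi i).sub (hint i)) (hd i) fun y => by
            show h y - g y ≤ |g y - h y|
            rw [abs_sub_comm]; exact le_abs_self _
        rw [integral_sub (hhi i) (hint i)] at h5
        linarith [hA i, min_le_left (δ / 4) (ε * δ / 8)]
      refine (Finset.sum_le_sum fun k _ => h3 (J k)).trans (le_of_eq ?_)
      rw [Finset.sum_add_distrib]
      simp
    linarith [(abs_lt.1 hc1).2, mul_pos hn0' hδ]
  refine (measure_mono hsub).trans ((measure_union_le _ _).trans ?_)
  refine (add_le_add hcheb hmark).trans (le_of_eq ?_)
  rw [← ENNReal.ofReal_add (by positivity) (by positivity), add_halves]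

/-- The law of an input block with independent letters. -/
lemma lintegral_pi_pre {V : Type*} [MeasurableSpace V] [Finite V] [MeasurableSingletonClass V]
    {n : ℕ} (P : Fin n → Input V X) {F : Set (Fin n → X)} (hF : MeasurableSet F) :
    ∫⁻ u, Measure.pi (fun k => (P k).pre (u k)) F ∂(Measure.pi fun k => (P k).pV)
      = Measure.pi (fun k => (P k).joint.map Prod.snd) F := by
  have hi : ∀ k, IsProbabilityMeasure ((P k).joint.map Prod.snd) :=
    fun k => Measure.isProbabilityMeasure_map (by fun_prop)
  let K : Kernel (Fin n → V) (Fin n → X) := ⟨fun u => Measure.pi fun k => (P k).pre (u k),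
    measurable_of_finite _⟩
  have e : (Measure.pi fun k => (P k).joint.map Prod.snd) = (Measure.pi fun k => (P k).pV).bind K := by
    refine Measure.pi_eq fun s hs => ?_
    rw [Measure.bind_apply (.univ_pi hs) K.measurable.aemeasurable]
    have : ∀ u, K u (Set.univ.pi s) = ∏ k, (P k).pre (u k) (s k) := fun u => Measure.pi_pi _ _
    simp_rw [this]
    rw [lintegral_pi_prod _ fun k => (P k).pre.measurable_coe (hs k)]
    refine Finset.prod_congr rfl fun k _ => ?_
    rw [Measure.map_apply measurable_snd (hs k), Input.joint,
      Measure.compProd_apply (measurable_snd (hs k))]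
    rfl
  rw [e, Measure.bind_apply hF K.measurable.aemeasurable]
  rfl

end WeakLaw

section CostConcentration

variable {ι X : Type*} [Fintype ι] [MeasurableSpace X]

/-- Independent letters with limiting frequencies `q` satisfy the average cost constraint with
probability tending to one, if the mean cost is below `c`, or if it is at most `c` and no smaller
cost exists. -/
theorem eventually_pi_cost_le {q : ι → ℝ} (hq : ∀ i, 0 ≤ q i) (hq1 : ∑ i, q i = 1) {a : ℕ → ι}
    (ha : ∀ k, 0 < q (a k))
    (hlim : ∀ f : ι → ℝ, Tendsto (fun n : ℕ => (∑ k : Fin n, f (a k)) / n) atTop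
      (𝓝 (∑ i, q i * f i)))
    (μ : ι → Measure X) [∀ i, IsProbabilityMeasure (μ i)] {g : X → ℝ}
    (hint : ∀ i, Integrable g (μ i)) {c : ℝ}
    (hc : ∑ i, q i * ∫ x, g x ∂(μ i) < c ∨ ∑ i, q i * ∫ x, g x ∂(μ i) ≤ c ∧ ∀ x, c ≤ g x)
    {ε : ℝ} (hε : 0 < ε) :
    ∀ᶠ n : ℕ in atTop, Measure.pi (fun k : Fin n => μ (a k))
      {x | (1 / (n : ℝ)) * ∑ k, g (x k) ≤ c}ᶜ ≤ ENNReal.ofReal ε := by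
  rcases hc with hc | ⟨hc, hcg⟩
  · set E := ∑ i, q i * ∫ x, g x ∂(μ i)
    filter_upwards [eventually_pi_sum_gt_le μ hint (δ := (c - E) / 2) (by linarith) hε,
      (hlim fun i => ∫ x, g x ∂(μ i)).eventually (gt_mem_nhds (show E < E + (c - E) / 2 by linarith)),
      eventually_gt_atTop 0] with n h1 h2 hn
    have hn' : (0 : ℝ) < n := by exact_mod_cast hn
    refine (measure_mono ?_).trans (h1 fun k => a k)
    intro x hx
    simp only [Set.mem_compl_iff, Set.mem_ofPred_eq, not_le] at hx ⊢
    rw [div_lt_iff₀ hn'] at h2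
    rw [one_div, ← div_eq_inv_mul, lt_div_iff₀ hn'] at hx
    nlinarith
  · have hle : ∀ i, c ≤ ∫ x, g x ∂(μ i) := fun i => by
      have := integral_mono (integrable_const c) (hint i) hcg
      simpa using this
    have hz : ∀ i, q i * (∫ x, g x ∂(μ i) - c) = 0 := by
      have h0 : ∑ i, q i * (∫ x, g x ∂(μ i) - c) = 0 := by
        refine le_antisymm ?_ (Finset.sum_nonneg fun i _ =>
          mul_nonneg (hq i) (sub_nonneg.2 (hle i)))
        simp_rw [mul_sub]
        rw [Finset.sum_sub_distrib, ← Finset.sum_mul, hq1]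
        linarith
      intro i
      exact (Finset.sum_eq_zero_iff_of_nonneg fun i _ =>
        mul_nonneg (hq i) (sub_nonneg.2 (hle i))).1 h0 i (Finset.mem_univ i)
    have hae : ∀ k, ∀ᵐ x ∂(μ (a k)), g x = c := fun k => by
      have hk : ∫ x, (g x - c) ∂(μ (a k)) = 0 := by
        rw [integral_sub (hint _) (integrable_const c)]
        have := (mul_eq_zero.1 (hz (a k))).resolve_left (ha k).ne'
        simpa using this
      have := (integral_eq_zero_iff_of_nonneg (fun x => sub_nonneg.2 (hcg x))
        ((hint _).sub (integrable_const c))).1 hk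
      filter_upwards [this] with x hx
      exact sub_eq_zero.1 hx
    filter_upwards [eventually_gt_atTop 0] with n hn
    have hn' : (n : ℝ) ≠ 0 := by exact_mod_cast hn.ne'
    have hall : ∀ᵐ x ∂(Measure.pi fun k : Fin n => μ (a k)), ∀ k, g (x k) = c := by
      rw [ae_all_iff]
      intro k
      exact (measurePreserving_eval (fun k : Fin n => μ (a k)) k).quasiMeasurePreserving.ae (hae k)
    have h0 : Measure.pi (fun k : Fin n => μ (a k)) {x | (1 / (n : ℝ)) * ∑ k, g (x k) ≤ c}ᶜ = 0 := by
      rw [← mem_ae_iff]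
      filter_upwards [hall] with x hx
      simp only [hx]
      simp [hn']
    rw [h0]
    exact bot_le

end CostConcentration

section Exponents

lemma tendsto_exp_mul_sub_atTop {S : ℕ → ℝ} {a b s : ℝ}
    (hS : Tendsto (fun n : ℕ => S n / n) atTop (𝓝 a)) (hab : a < b) (hs : 0 < s) :
    Tendsto (fun n : ℕ => Real.exp (s * (S n - n * b))) atTop (𝓝 0) := by
  refine Real.tendsto_exp_atBot.comp ?_
  have h : Tendsto (fun n : ℕ => (n : ℝ) * (s * (S n / n - b))) atTop atBot :=
    tendsto_natCast_atTop_atTop.atTop_mul_neg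
      (mul_neg_of_pos_of_neg hs (sub_neg.2 hab)) ((hS.sub_const b).const_mul s)
  refine h.congr' ?_
  filter_upwards [eventually_gt_atTop 0] with n hn
  have hn' : (n : ℝ) ≠ 0 := by exact_mod_cast hn.ne'
  field_simp

lemma tendsto_leakExponentBound {β s : ℝ} (hs : 0 < s) {S₁₂ S₁ S₂ : ℕ → ℝ} {z₁₂ z₁ z₂ a b : ℝ}
    (h₁₂ : Tendsto (fun n : ℕ => S₁₂ n / n) atTop (𝓝 z₁₂))
    (h₁ : Tendsto (fun n : ℕ => S₁ n / n) atTop (𝓝 z₁))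
    (h₂ : Tendsto (fun n : ℕ => S₂ n / n) atTop (𝓝 z₂)) (hab : z₁₂ < a + b) (ha : z₁ < a)
    (hb : z₂ < b) {A B : ℕ → ℝ} (hA : ∀ n : ℕ, Real.exp (n * a) ≤ A n)
    (hB : ∀ n : ℕ, Real.exp (n * b) ≤ B n) :
    Tendsto (fun n => leakExponentBound β s (S₁₂ n) (S₁ n) (S₂ n) (A n) (B n)) atTop
      (𝓝 (3 * Real.log β)) := by
  have key : ∀ {S A : ℕ → ℝ} {z a : ℝ}, Tendsto (fun n : ℕ => S n / n) atTop (𝓝 z) → z < a →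
      (∀ n : ℕ, Real.exp (n * a) ≤ A n) →
      Tendsto (fun n => (A n) ^ (-s) * Real.exp (s * S n)) atTop (𝓝 0) := by
    intro S A z a hS hza hA
    refine squeeze_zero (fun n => mul_nonneg (Real.rpow_nonneg ((Real.exp_pos _).le.trans (hA n)) _)
      (Real.exp_pos _).le) (fun n => ?_) (tendsto_exp_mul_sub_atTop hS hza hs)
    have h := Real.rpow_le_rpow_of_nonpos (Real.exp_pos _) (hA n) (neg_nonpos.2 hs.le)
    rw [← Real.exp_mul] at h
    refine (mul_le_mul_of_nonneg_right h (Real.exp_pos _).le).trans (le_of_eq ?_)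
    rw [← Real.exp_add]
    congr 1
    ring
  have hAB : ∀ n : ℕ, Real.exp (n * (a + b)) ≤ A n * B n := fun n => by
    rw [mul_add, Real.exp_add]
    exact mul_le_mul (hA n) (hB n) (Real.exp_pos _).le ((Real.exp_pos _).le.trans (hA n))
  have h := (((key h₁₂ hab hAB).add (key h₁ ha hA)).add (key h₂ hb hB)).const_mul (β ^ 3 / s)
  have h' := h.const_add (3 * Real.log β)
  simpa [leakExponentBound] using h'

lemma exp_le_natCeil (x : ℝ) : Real.exp x ≤ (⌈Real.exp x⌉₊ : ℝ) := Nat.le_ceil _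

lemma natCeil_exp_le {x : ℝ} (hx : 0 ≤ x) : (⌈Real.exp x⌉₊ : ℝ) ≤ 2 * Real.exp x := by
  have := Nat.ceil_lt_add_one (Real.exp_pos x).le
  have := Real.one_le_exp hx
  linarith

lemma tendsto_log_natCeil_exp_div {r : ℝ} (hr : 0 ≤ r) :
    Tendsto (fun n : ℕ => Real.log (⌈Real.exp (n * r)⌉₊ : ℝ) / n) atTop (𝓝 r) := by
  have hu : Tendsto (fun n : ℕ => r + Real.log 2 / n) atTop (𝓝 r) := by
    simpa using (tendsto_const_div_atTop_nhds_zero_nat (Real.log 2)).const_add r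
  refine tendsto_of_tendsto_of_tendsto_of_le_of_le' tendsto_const_nhds hu ?_ ?_
  · filter_upwards [eventually_gt_atTop 0] with n hn
    have hn' : (0 : ℝ) < n := by exact_mod_cast hn
    rw [le_div_iff₀ hn', mul_comm]
    exact (Real.le_log_iff_exp_le ((Real.exp_pos _).trans_le (exp_le_natCeil _))).2
      (exp_le_natCeil _)
  · filter_upwards [eventually_gt_atTop 0] with n hn
    have hn' : (0 : ℝ) < n := by exact_mod_cast hn
    rw [div_le_iff₀ hn', add_mul, div_mul_cancel₀ _ hn'.ne']
    refine (Real.log_le_log ((Real.exp_pos _).trans_le (exp_le_natCeil _))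
      (natCeil_exp_le (by positivity))).trans (le_of_eq ?_)
    rw [Real.log_mul two_ne_zero (Real.exp_pos _).ne', Real.log_exp]
    ring

lemma eventually_decoding_bound {S : ℕ → ℝ} {y r ρ β s η : ℝ} (hr : 0 ≤ r) (hρ : 0 ≤ ρ)
    (hS : Tendsto (fun n : ℕ => S n / n) atTop (𝓝 y)) (hs : 0 < s) (hη : 0 < η) (hβ : 0 ≤ β)
    (h : r = 0 ∨ r + ρ < y) :
    ∃ τ : ℝ, ∀ᶠ n : ℕ in atTop, ⌈Real.exp (n * r)⌉₊ = 1 ∨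
      β ^ 4 * Real.exp (s * (n * τ - S n)) + ((⌈Real.exp (n * r)⌉₊ : ℝ) * ⌈Real.exp (n * ρ)⌉₊)
        * (β ^ 5 * Real.exp (-(n * τ))) ≤ η := by
  rcases h with rfl | h
  · exact ⟨0, Eventually.of_forall fun n => Or.inl (by simp)⟩
  · obtain ⟨τ, hτ1, hτ2⟩ := exists_between h
    refine ⟨τ, ?_⟩
    have h1 : Tendsto (fun n : ℕ => Real.exp (s * (n * τ - S n))) atTop (𝓝 0) := by
      have hS' : Tendsto (fun n : ℕ => (-S n) / n) atTop (𝓝 (-y)) := by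
        simpa [neg_div] using hS.neg
      refine (tendsto_exp_mul_sub_atTop hS' (neg_lt_neg hτ2) hs).congr fun n => ?_
      congr 1
      ring
    have h2 : Tendsto (fun n : ℕ => Real.exp (1 * (n * (r + ρ) - n * τ))) atTop (𝓝 0) := by
      refine tendsto_exp_mul_sub_atTop (a := r + ρ) ?_ hτ1 one_pos
      refine tendsto_const_nhds.congr' ?_
      filter_upwards [eventually_gt_atTop 0] with n hn
      have hn' : (n : ℝ) ≠ 0 := by exact_mod_cast hn.ne'
      field_simp
    have h3 := (h1.const_mul (β ^ 4)).add (h2.const_mul (4 * β ^ 5))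
    rw [mul_zero, mul_zero, add_zero] at h3
    filter_upwards [h3.eventually (gt_mem_nhds hη)] with n hn
    refine Or.inr (le_trans (add_le_add le_rfl ?_) hn.le)
    have hM := natCeil_exp_le (x := n * r) (by positivity)
    have hL := natCeil_exp_le (x := n * ρ) (by positivity)
    have hML := mul_le_mul hM hL (by positivity) (by positivity)
    refine (mul_le_mul_of_nonneg_right hML (by positivity)).trans (le_of_eq ?_)
    have e : Real.exp (1 * (n * (r + ρ) - n * τ))
        = Real.exp (n * r) * Real.exp (n * ρ) * Real.exp (-(n * τ)) := by
      rw [← Real.exp_add, ← Real.exp_add]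
      congr 1
      ring
    rw [e]
    ring

lemma exists_conditioning_level {η : ℝ} (hη : 0 < η) :
    ∃ ε : ℝ≥0, 0 < ε ∧ ε < 1 ∧ 3 * Real.log ((((1 - ε)⁻¹ : ℝ≥0) : ℝ) ^ 2) < η := by
  have hc : ContinuousAt (fun x : ℝ≥0 => 3 * Real.log ((((1 - x)⁻¹ : ℝ≥0) : ℝ) ^ 2)) 0 := by
    have h1 : ContinuousAt (fun x : ℝ≥0 => (1 - x)⁻¹) 0 :=
      ContinuousAt.inv₀ (by fun_prop) (by simp)
    have h2 : ContinuousAt (fun x : ℝ≥0 => (((1 - x)⁻¹ : ℝ≥0) : ℝ) ^ 2) 0 :=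
      (NNReal.continuous_coe.continuousAt.comp h1).pow 2
    exact (h2.log (by simp)).const_mul 3
  have h0 := hc.tendsto
  simp only [tsub_zero, inv_one, NNReal.coe_one, one_pow, Real.log_one, mul_zero] at h0
  have h := h0.eventually (gt_mem_nhds hη)
  have h' : ∀ᶠ x : ℝ≥0 in 𝓝[>] 0, 3 * Real.log ((((1 - x)⁻¹ : ℝ≥0) : ℝ) ^ 2) < η :=
    h.filter_mono nhdsWithin_le_nhds
  obtain ⟨ε, h1, h2⟩ := (h'.and (Ioo_mem_nhdsGT (show (0 : ℝ≥0) < 1 from one_pos))).exists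
  exact ⟨ε, h2.1, h2.2, h1⟩

end Exponents

section BlockCodes

variable {X₁ X₂ Y₁ Y₂ Z A B ι : Type*} [MeasurableSpace X₁] [MeasurableSpace X₂]
  [MeasurableSpace Y₁] [MeasurableSpace Y₂] [MeasurableSpace Z]
  [Finite A] [MeasurableSpace A] [MeasurableSingletonClass A] [Finite B] [MeasurableSpace B]
  [MeasurableSingletonClass B] [Fintype ι]
  (W : Kernel (X₁ × X₂) (Y₁ × Y₂ × Z)) [IsMarkovKernel W]

/-- Codes for a time-shared family of letters: rates `R₁`, `R₂` with local randomness of rates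
`ρ₁`, `ρ₂` are achievable if the decoding and resolvability conditions hold on average. -/
theorem eventually_exists_code_of_family (P₁ : ι → Input A X₁) (P₂ : ι → Input B X₂)
    {q : ι → ℝ} (hq : ∀ i, 0 ≤ q i) (hq1 : ∑ i, q i = 1) {z z₁ z₂ y₂ y₁ : ι → ℝ}
    (hLB : ∀ᶠ s in 𝓝[>] (0 : ℝ), ∀ i,
      LetterBounds W (P₁ i) (P₂ i) s (z i) (z₁ i) (z₂ i) (y₂ i) (y₁ i))
    {g₁ : X₁ → ℝ} (hg₁ : Measurable g₁) {g₂ : X₂ → ℝ} (hg₂ : Measurable g₂) {c₁ c₂ : ℝ}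
    (hi₁ : ∀ i, Integrable g₁ ((P₁ i).joint.map Prod.snd))
    (hi₂ : ∀ i, Integrable g₂ ((P₂ i).joint.map Prod.snd))
    (hc₁ : ∑ i, q i * ∫ x, g₁ x ∂((P₁ i).joint.map Prod.snd) < c₁ ∨
      ∑ i, q i * ∫ x, g₁ x ∂((P₁ i).joint.map Prod.snd) ≤ c₁ ∧ ∀ x, c₁ ≤ g₁ x)
    (hc₂ : ∑ i, q i * ∫ x, g₂ x ∂((P₂ i).joint.map Prod.snd) < c₂ ∨
      ∑ i, q i * ∫ x, g₂ x ∂((P₂ i).joint.map Prod.snd) ≤ c₂ ∧ ∀ x, c₂ ≤ g₂ x)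
    (hx₁ : ∃ x, g₁ x ≤ c₁) (hx₂ : ∃ x, g₂ x ≤ c₂)
    {r₁ r₂ ρ₁ ρ₂ : ℝ} (hr₁ : 0 ≤ r₁) (hr₂ : 0 ≤ r₂) (hρ₁ : 0 ≤ ρ₁) (hρ₂ : 0 ≤ ρ₂)
    (hd₁ : r₁ = 0 ∨ r₁ + ρ₁ < ∑ i, q i * y₂ i) (hd₂ : r₂ = 0 ∨ r₂ + ρ₂ < ∑ i, q i * y₁ i)
    (hz₁ : ∑ i, q i * z₁ i < ρ₁) (hz₂ : ∑ i, q i * z₂ i < ρ₂) {ε : ℝ} (hε : 0 < ε) :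
    ∀ᶠ n : ℕ in atTop,
      (∑ i, q i * z i < ρ₁ + ρ₂ → ∃ C : Code X₁ X₂ Y₁ Y₂ n, C.PeakCost g₁ g₂ c₁ c₂ ∧
        |Real.log C.M₁ / n - r₁| < ε ∧ |Real.log C.M₂ / n - r₂| < ε ∧
        C.errorProb W + C.leakage W ≤ ENNReal.ofReal ε) ∧
      (∑ i, q i * z i < ρ₁ + ρ₂ + r₁ → ∑ i, q i * z i < ρ₁ + ρ₂ + r₂ →
        ∃ C : Code X₁ X₂ Y₁ Y₂ n, C.PeakCost g₁ g₂ c₁ c₂ ∧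
        |Real.log C.M₁ / n - r₁| < ε ∧ |Real.log C.M₂ / n - r₂| < ε ∧
        C.errorProb W + (C.leakage₁ W + C.leakage₂ W) ≤ ENNReal.ofReal ε) := by
  obtain ⟨a, ha, hlim⟩ := exists_seq_tendsto_average hq hq1
  obtain ⟨ε₀, hε0, hε1, hlog⟩ := exists_conditioning_level (η := ε / 8) (by positivity)
  set β : ℝ := (((1 - ε₀)⁻¹ : ℝ≥0) : ℝ) with hβ
  have hβ0 : 0 ≤ β := NNReal.coe_nonneg _
  obtain ⟨s, hsLB, hs⟩ := (hLB.and (Ioc_mem_nhdsGT (show (0 : ℝ) < 1 from one_pos))).exists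
  have hp₁ : ∀ i, IsProbabilityMeasure ((P₁ i).joint.map Prod.snd) :=
    fun i => Measure.isProbabilityMeasure_map (by fun_prop)
  have hp₂ : ∀ i, IsProbabilityMeasure ((P₂ i).joint.map Prod.snd) :=
    fun i => Measure.isProbabilityMeasure_map (by fun_prop)
  have hε02 : (0 : ℝ) < (ε₀ : ℝ) ^ 2 := by positivity
  have hcost₁ := eventually_pi_cost_le hq hq1 ha hlim _ hi₁ hc₁ hε02
  have hcost₂ := eventually_pi_cost_le hq hq1 ha hlim _ hi₂ hc₂ hε02
  obtain ⟨τ₁, hτ₁⟩ := eventually_decoding_bound (η := ε / 8) hr₁ hρ₁ (hlim y₂) hs.1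
    (by positivity) hβ0 hd₁
  obtain ⟨τ₂, hτ₂⟩ := eventually_decoding_bound (η := ε / 8) hr₂ hρ₂ (hlim y₁) hs.1
    (by positivity) hβ0 hd₂
  have hceil : ∀ (x y : ℝ) (n : ℕ), Real.exp (n * (x + y))
      ≤ (⌈Real.exp (n * x)⌉₊ : ℝ) * ⌈Real.exp (n * y)⌉₊ := fun x y n => by
    rw [mul_add, Real.exp_add]
    exact mul_le_mul (exp_le_natCeil _) (exp_le_natCeil _) (Real.exp_pos _).le (by positivity)
  have hleak : ∀ {u v : ℝ} {U V : ℕ → ℝ}, (∀ n : ℕ, Real.exp (n * u) ≤ U n) →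
      (∀ n : ℕ, Real.exp (n * v) ≤ V n) → ρ₁ ≤ u → ρ₂ ≤ v → ∑ i, q i * z i < u + v →
      ∀ᶠ n : ℕ in atTop, leakExponentBound (β ^ 2) s (∑ k : Fin n, z (a k)) (∑ k : Fin n, z₁ (a k))
        (∑ k : Fin n, z₂ (a k)) (U n) (V n) ≤ ε / 8 := by
    intro u v U V hU hV hu hv huv
    have := tendsto_leakExponentBound (β := β ^ 2) hs.1 (hlim z) (hlim z₁) (hlim z₂) huv
      (hz₁.trans_le hu) (hz₂.trans_le hv) hU hV
    exact (this.eventually (gt_mem_nhds hlog)).mono fun n hn => hn.le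
  have hJ : ∀ᶠ n : ℕ in atTop, ∑ i, q i * z i < ρ₁ + ρ₂ →
      leakExponentBound (β ^ 2) s (∑ k : Fin n, z (a k)) (∑ k : Fin n, z₁ (a k))
        (∑ k : Fin n, z₂ (a k)) ⌈Real.exp (n * ρ₁)⌉₊ ⌈Real.exp (n * ρ₂)⌉₊ ≤ ε / 8 := by
    rw [eventually_imp_distrib_left]
    exact hleak (fun n => exp_le_natCeil _) (fun n => exp_le_natCeil _) le_rfl le_rfl
  have hI₁ : ∀ᶠ n : ℕ in atTop, ∑ i, q i * z i < ρ₁ + ρ₂ + r₂ →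
      leakExponentBound (β ^ 2) s (∑ k : Fin n, z (a k)) (∑ k : Fin n, z₁ (a k))
        (∑ k : Fin n, z₂ (a k)) ⌈Real.exp (n * ρ₁)⌉₊
        ((⌈Real.exp (n * r₂)⌉₊ : ℝ) * ⌈Real.exp (n * ρ₂)⌉₊) ≤ ε / 8 := by
    rw [eventually_imp_distrib_left]
    intro h
    exact hleak (fun n => exp_le_natCeil _) (hceil r₂ ρ₂) le_rfl (by linarith) (by linarith)
  have hI₂ : ∀ᶠ n : ℕ in atTop, ∑ i, q i * z i < ρ₁ + ρ₂ + r₁ →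
      leakExponentBound (β ^ 2) s (∑ k : Fin n, z (a k)) (∑ k : Fin n, z₁ (a k))
        (∑ k : Fin n, z₂ (a k)) ((⌈Real.exp (n * r₁)⌉₊ : ℝ) * ⌈Real.exp (n * ρ₁)⌉₊)
        ⌈Real.exp (n * ρ₂)⌉₊ ≤ ε / 8 := by
    rw [eventually_imp_distrib_left]
    intro h
    exact hleak (hceil r₁ ρ₁) (fun n => exp_le_natCeil _) (by linarith) le_rfl (by linarith)
  have hrate : ∀ {r : ℝ}, 0 ≤ r → ∀ᶠ n : ℕ in atTop,
      |Real.log (⌈Real.exp (n * r)⌉₊ : ℝ) / n - r| < ε := fun hr =>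
    (tendsto_log_natCeil_exp_div hr).eventually (Metric.ball_mem_nhds _ hε)
  have hpos : ∀ x : ℝ, 0 < ⌈Real.exp x⌉₊ := fun x => Nat.ceil_pos.2 (Real.exp_pos x)
  obtain ⟨x₁, hx₁⟩ := hx₁
  obtain ⟨x₂, hx₂⟩ := hx₂
  filter_upwards [hcost₁, hcost₂, hτ₁, hτ₂, hJ, hI₁, hI₂, hrate hr₁, hrate hr₂,
    eventually_gt_atTop 0] with n hcost₁ hcost₂ hτ₁ hτ₂ hJ hI₁ hI₂ hrate₁ hrate₂ hn
  have hn' : (n : ℝ) ≠ 0 := by exact_mod_cast hn.ne'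
  have hF₁ : MeasurableSet {x : Fin n → X₁ | (1 / (n : ℝ)) * ∑ k, g₁ (x k) ≤ c₁} :=
    measurableSet_le (by fun_prop) measurable_const
  have hF₂ : MeasurableSet {x : Fin n → X₂ | (1 / (n : ℝ)) * ∑ k, g₂ (x k) ≤ c₂} :=
    measurableSet_le (by fun_prop) measurable_const
  have e2 : ENNReal.ofReal ((ε₀ : ℝ) ^ 2) = ((ε₀ ^ 2 : ℝ≥0) : ℝ≥0∞) := by
    rw [← NNReal.coe_pow, ENNReal.ofReal_coe_nnreal]
  obtain ⟨⟨C, hC1, hC2, hC3, hC4, hC5⟩, ⟨C', hC1', hC2', hC3', hC4', hC5'⟩⟩ :=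
    exists_code_of_letterBounds W (fun k : Fin n => P₁ (a k)) (fun k => P₂ (a k))
      (fun k => hsLB (a k)) hs.1 hs.2 hF₁ hF₂
      ⟨fun _ => x₁, by simpa [hn'] using hx₁⟩ ⟨fun _ => x₂, by simpa [hn'] using hx₂⟩ hε0 hε1
      (by rw [lintegral_pi_pre _ hF₁.compl, ← e2]; exact hcost₁)
      (by rw [lintegral_pi_pre _ hF₂.compl, ← e2]; exact hcost₂)
      (hpos (n * r₁)) (hpos (n * ρ₁)) (hpos (n * r₂)) (hpos (n * ρ₂)) hβ hτ₁ hτ₂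
  have h8 : (0 : ℝ) ≤ ε / 8 := by positivity
  refine ⟨fun hz => ⟨C, ⟨hC3, hC4⟩, by rwa [hC1], by rwa [hC2], hC5.trans ?_⟩,
    fun hz1 hz2 => ⟨C', ⟨hC3', hC4'⟩, by rwa [hC1'], by rwa [hC2'], hC5'.trans ?_⟩⟩
  · refine (add_le_add le_rfl (ENNReal.ofReal_le_ofReal (hJ hz))).trans ?_
    rw [← ENNReal.ofReal_add h8 h8, ← ENNReal.ofReal_add (by positivity) h8]
    exact ENNReal.ofReal_le_ofReal (by linarith)
  · refine (add_le_add le_rfl (add_le_add (ENNReal.ofReal_le_ofReal (hI₁ hz2))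
      (ENNReal.ofReal_le_ofReal (hI₂ hz1)))).trans ?_
    rw [← ENNReal.ofReal_add h8 h8, ← ENNReal.ofReal_add (by positivity) (by positivity)]
    exact ENNReal.ofReal_le_ofReal (by linarith)

end BlockCodes

section RealExponents

/-- Real exponents extracted from a nonempty single-letter region: the leakage informations are
finite, and the main channel informations may be replaced by finite lower bounds. -/
lemma exists_real_exponents {Y₂ Y₁ Z₁ Z₂ Z : ℝ≥0∞} {r₁ r₂ r : ℝ}
    (h₁ : (r₁ : EReal) ≤ (Y₂ : EReal) - (Z₁ : EReal))
    (h₂ : (r₂ : EReal) ≤ (Y₁ : EReal) - (Z₂ : EReal))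
    (h : (r : EReal) ≤ (Y₂ : EReal) + (Y₁ : EReal) - (Z : EReal)) :
    Z₁ ≠ ⊤ ∧ Z₂ ≠ ⊤ ∧ Z ≠ ⊤ ∧ ∃ y₂ y₁ : ℝ, ENNReal.ofReal y₂ ≤ Y₂ ∧ ENNReal.ofReal y₁ ≤ Y₁ ∧
      r₁ ≤ y₂ - Z₁.toReal ∧ r₂ ≤ y₁ - Z₂.toReal ∧ r ≤ y₂ + y₁ - Z.toReal := by
  have hZ₁ : Z₁ ≠ ⊤ := by
    rintro rfl
    simp at h₁
  have hZ₂ : Z₂ ≠ ⊤ := by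
    rintro rfl
    simp at h₂
  have hZ : Z ≠ ⊤ := by
    rintro rfl
    simp at h
  refine ⟨hZ₁, hZ₂, hZ, ?_⟩
  lift Z₁ to ℝ≥0 using hZ₁
  lift Z₂ to ℝ≥0 using hZ₂
  lift Z to ℝ≥0 using hZ
  have hsub : ∀ {a b c : ℝ}, (a : EReal) ≤ (b : EReal) - (c : EReal) → a ≤ b - c := fun h => by
    rw [← EReal.coe_sub] at h
    exact EReal.coe_le_coe_iff.1 h
  simp only [EReal.coe_nnreal_eq_coe_real, ENNReal.coe_toReal] at h₁ h₂ h ⊢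
  rcases eq_or_ne Y₂ ⊤ with rfl | hY₂ <;> rcases eq_or_ne Y₁ ⊤ with rfl | hY₁
  · refine ⟨|r₁| + |r| + Z₁ + Z, |r₂| + Z₂, le_top, le_top, ?_, ?_, ?_⟩ <;>
      linarith [le_abs_self r₁, le_abs_self r₂, le_abs_self r, abs_nonneg r, abs_nonneg r₁,
        abs_nonneg r₂, Z₁.2, Z₂.2, Z.2, Z₁.coe_nonneg, Z₂.coe_nonneg, Z.coe_nonneg]
  · lift Y₁ to ℝ≥0 using hY₁
    refine ⟨|r₁| + |r| + Z₁ + Z, Y₁, le_top, by simp, ?_, hsub h₂, ?_⟩ <;>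
      linarith [le_abs_self r₁, le_abs_self r, abs_nonneg r, abs_nonneg r₁, Y₁.coe_nonneg,
        Z₁.coe_nonneg, Z₂.coe_nonneg, Z.coe_nonneg]
  · lift Y₂ to ℝ≥0 using hY₂
    refine ⟨Y₂, |r₂| + |r| + Z₂ + Z, by simp, le_top, hsub h₁, ?_, ?_⟩ <;>
      linarith [le_abs_self r₂, le_abs_self r, abs_nonneg r, abs_nonneg r₂, Y₂.coe_nonneg,
        Z₁.coe_nonneg, Z₂.coe_nonneg, Z.coe_nonneg]
  · lift Y₁ to ℝ≥0 using hY₁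
    lift Y₂ to ℝ≥0 using hY₂
    refine ⟨Y₂, Y₁, by simp, by simp, hsub h₁, hsub h₂, hsub ?_⟩
    rwa [EReal.coe_add]

lemma ofReal_sub_lt_of_ofReal_le {y δ : ℝ} (hδ : 0 < δ) {D : ℝ≥0∞} (h : ENNReal.ofReal y ≤ D) :
    y - δ < 0 ∨ ENNReal.ofReal (y - δ) < D := by
  rcases lt_or_ge (y - δ) 0 with h0 | h0
  · exact Or.inl h0
  · exact Or.inr (lt_of_lt_of_le ((ENNReal.ofReal_lt_ofReal_iff (by linarith)).2 (by linarith)) h)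

lemma lt_ofReal_toReal_add {D : ℝ≥0∞} (hD : D ≠ ⊤) {δ : ℝ} (hδ : 0 < δ) :
    D < ENNReal.ofReal (D.toReal + δ) := by
  rw [ENNReal.lt_ofReal_iff_toReal_lt hD]
  linarith

/-- Message and randomness rates close to a given point of the averaged region. -/
lemma exists_rates {z z₁ z₂ y₂ y₁ r₁ r₂ r δ : ℝ} (hδ : 0 < δ) (hz : 0 ≤ z) (hz₁ : 0 ≤ z₁)
    (hz₂ : 0 ≤ z₂) (hr₁ : 0 ≤ r₁) (hr₂ : 0 ≤ r₂) (h₁ : r₁ ≤ y₂ - z₁) (h₂ : r₂ ≤ y₁ - z₂)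
    (h : r ≤ y₂ + y₁ - z) :
    ∃ R₁ R₂ ρ₁ ρ₂ : ℝ, 0 ≤ R₁ ∧ 0 ≤ R₂ ∧ 0 ≤ ρ₁ ∧ 0 ≤ ρ₂ ∧ |R₁ - r₁| ≤ 10 * δ ∧
      |R₂ - r₂| ≤ 10 * δ ∧ (R₁ = 0 ∨ R₁ + ρ₁ < y₂ - δ) ∧ (R₂ = 0 ∨ R₂ + ρ₂ < y₁ - δ) ∧
      z₁ + δ < ρ₁ ∧ z₂ + δ < ρ₂ ∧ (r₁ + r₂ ≤ r → z + δ < ρ₁ + ρ₂) ∧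
      (r₂ ≤ r → z + δ < ρ₁ + ρ₂ + R₁) ∧ (r₁ ≤ r → z + δ < ρ₁ + ρ₂ + R₂) := by
  rcases le_total r₁ (10 * δ) with c₁ | c₁ <;> rcases le_total r₂ (10 * δ) with c₂ | c₂
  · refine ⟨0, 0, z + z₁ + z₂ + 2 * δ, z + z₁ + z₂ + 2 * δ, le_rfl, le_rfl, by positivity,
      by positivity, ?_, ?_, Or.inl rfl, Or.inl rfl, by linarith, by linarith,
      fun _ => by linarith, fun _ => by linarith, fun _ => by linarith⟩ <;>
    rw [abs_le] <;> constructor <;> linarith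
  · refine ⟨0, r₂ - 10 * δ, z + z₁ + z₂ + 2 * δ, y₁ - r₂ + 8 * δ, le_rfl, by linarith,
      by positivity, by linarith, ?_, ?_, Or.inl rfl, Or.inr (by linarith), by linarith,
      by linarith, fun _ => by linarith, fun _ => by linarith, fun _ => by linarith⟩ <;>
    rw [abs_le] <;> constructor <;> linarith
  · refine ⟨r₁ - 10 * δ, 0, y₂ - r₁ + 8 * δ, z + z₁ + z₂ + 2 * δ, by linarith, le_rfl,
      by linarith, by positivity, ?_, ?_, Or.inr (by linarith), Or.inl rfl, by linarith,
      by linarith, fun _ => by linarith, fun _ => by linarith, fun _ => by linarith⟩ <;>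
    rw [abs_le] <;> constructor <;> linarith
  · refine ⟨r₁ - 10 * δ, r₂ - 10 * δ, y₂ - r₁ + 8 * δ, y₁ - r₂ + 8 * δ, by linarith,
      by linarith, by linarith, by linarith, ?_, ?_, Or.inr (by linarith), Or.inr (by linarith),
      by linarith, by linarith, fun _ => by linarith, fun _ => by linarith,
      fun _ => by linarith⟩ <;>
    rw [abs_le] <;> constructor <;> linarith

end RealExponents

section LetterPoints

variable {X₁ X₂ Y₁ Y₂ Z : Type*} [MeasurableSpace X₁] [MeasurableSpace X₂] [MeasurableSpace Y₁]
  [MeasurableSpace Y₂] [MeasurableSpace Z] [StandardBorelSpace Y₁] [Nonempty Y₁]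
  [StandardBorelSpace Y₂] [Nonempty Y₂]

/-- The triples of cost levels, rate pairs and bounds for the third inequality of the regions which
a single letter can attain. -/
def letterPoints (W : Kernel (X₁ × X₂) (Y₁ × Y₂ × Z)) [IsMarkovKernel W] (g₁ : X₁ → ℝ)
    (g₂ : X₂ → ℝ) : Set ((ℝ × ℝ) × (ℝ × ℝ) × ℝ) :=
  {p | ∃ (V₁ V₂ : Type) (_ : MeasurableSpace V₁) (_ : MeasurableSpace V₂)
    (_ : StandardBorelSpace V₁) (_ : StandardBorelSpace V₂) (_ : Nonempty V₁) (_ : Nonempty V₂)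
    (P₁ : Input V₁ X₁) (P₂ : Input V₂ X₂),
    P₁.CostLE g₁ p.1.1 ∧ P₂.CostLE g₂ p.1.2 ∧ 0 ≤ p.2.1.1 ∧ 0 ≤ p.2.1.2 ∧
    (p.2.1.1 : EReal) ≤ (infoY₂ W P₁ P₂ : EReal) - (infoZ₁ W P₁ P₂ : EReal) ∧
    (p.2.1.2 : EReal) ≤ (infoY₁ W P₁ P₂ : EReal) - (infoZ₂ W P₁ P₂ : EReal) ∧
    (p.2.2 : EReal) ≤
      (infoY₂ W P₁ P₂ : EReal) + (infoY₁ W P₁ P₂ : EReal) - (infoZ W P₁ P₂ : EReal)}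

/-- Cost levels and rate pairs attained by time sharing between letters, where the rates and the
bound for the third inequality are related by `K`. -/
def sharedRates (W : Kernel (X₁ × X₂) (Y₁ × Y₂ × Z)) [IsMarkovKernel W] (g₁ : X₁ → ℝ)
    (g₂ : X₂ → ℝ) (K : Set ((ℝ × ℝ) × ℝ)) : Set ((ℝ × ℝ) × (ℝ × ℝ)) :=
  {p | ∃ r, (p.2, r) ∈ K ∧ (p.1, p.2, r) ∈ convexHull ℝ (letterPoints W g₁ g₂)}

/-- The relation between rates and third bound under joint secrecy. -/
def jointRelation : Set ((ℝ × ℝ) × ℝ) := {k | k.1.1 + k.1.2 ≤ k.2}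

/-- The relation between rates and third bound under individual secrecy. -/
def individualRelation : Set ((ℝ × ℝ) × ℝ) := {k | k.1.1 ≤ k.2 ∧ k.1.2 ≤ k.2}

lemma convex_jointRelation : Convex ℝ jointRelation := by
  intro x hx y hy a b ha hb _
  simp only [jointRelation, Set.mem_ofPred_eq, Prod.fst_add, Prod.snd_add, Prod.smul_fst,
    Prod.smul_snd, smul_eq_mul] at hx hy ⊢
  nlinarith [mul_le_mul_of_nonneg_left hx ha, mul_le_mul_of_nonneg_left hy hb]

lemma convex_individualRelation : Convex ℝ individualRelation := by
  intro x hx y hy a b ha hb _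
  simp only [individualRelation, Set.mem_ofPred_eq, Prod.fst_add, Prod.snd_add, Prod.smul_fst,
    Prod.smul_snd, smul_eq_mul] at hx hy ⊢
  exact ⟨add_le_add (mul_le_mul_of_nonneg_left hx.1 ha) (mul_le_mul_of_nonneg_left hy.1 hb),
    add_le_add (mul_le_mul_of_nonneg_left hx.2 ha) (mul_le_mul_of_nonneg_left hy.2 hb)⟩

variable (W : Kernel (X₁ × X₂) (Y₁ × Y₂ × Z)) [IsMarkovKernel W] (g₁ : X₁ → ℝ) (g₂ : X₂ → ℝ)

lemma convex_sharedRates {K : Set ((ℝ × ℝ) × ℝ)} (hK : Convex ℝ K) :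
    Convex ℝ (sharedRates W g₁ g₂ K) := by
  rintro x ⟨r, hr, hx⟩ y ⟨t, ht, hy⟩ a b ha hb hab
  exact ⟨a * r + b * t, hK hr ht ha hb hab, convex_convexHull ℝ _ hx hy ha hb hab⟩

lemma convex_section_sharedRates {K : Set ((ℝ × ℝ) × ℝ)} (hK : Convex ℝ K) (d : ℝ × ℝ) :
    Convex ℝ {R | (d, R) ∈ sharedRates W g₁ g₂ K} := by
  intro x hx y hy a b ha hb hab
  have h := convex_sharedRates W g₁ g₂ hK hx hy ha hb hab
  have e : a • (d, x) + b • (d, y) = (d, a • x + b • y) :=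
    Prod.ext (Convex.combo_self hab d) rfl
  rwa [e] at h

lemma regionJoint_subset_closure (c₁ c₂ : ℝ) : regionJoint W g₁ g₂ c₁ c₂
    ⊆ closure {R | ((c₁, c₂), R) ∈ sharedRates W g₁ g₂ jointRelation} := by
  refine closure_mono (convexHull_min ?_
    (convex_section_sharedRates W g₁ g₂ convex_jointRelation _))
  rintro R ⟨V₁, V₂, m₁, m₂, s₁, s₂, n₁, n₂, P₁, P₂, h₁, h₂, hr₁, hr₂, hi₁, hi₂, hi⟩
  exact ⟨R.1 + R.2, le_refl (R.1 + R.2), subset_convexHull ℝ _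
    ⟨V₁, V₂, m₁, m₂, s₁, s₂, n₁, n₂, P₁, P₂, h₁, h₂, hr₁, hr₂, hi₁, hi₂, hi⟩⟩

lemma regionIndividual_subset_closure (c₁ c₂ : ℝ) : regionIndividual W g₁ g₂ c₁ c₂
    ⊆ closure {R | ((c₁, c₂), R) ∈ sharedRates W g₁ g₂ individualRelation} := by
  refine closure_mono (convexHull_min ?_
    (convex_section_sharedRates W g₁ g₂ convex_individualRelation _))
  rintro R ⟨V₁, V₂, m₁, m₂, s₁, s₂, n₁, n₂, P₁, P₂, h₁, h₂, hr₁, hr₂, hi₁, hi₂, hi⟩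
  refine ⟨max R.1 R.2, ⟨le_max_left _ _, le_max_right _ _⟩, subset_convexHull ℝ _
    ⟨V₁, V₂, m₁, m₂, s₁, s₂, n₁, n₂, P₁, P₂, h₁, h₂, hr₁, hr₂, hi₁, hi₂, ?_⟩⟩
  rwa [add_comm (infoY₂ W P₁ P₂ : EReal)]

lemma mutualInfo_eq_zero_of_subsingleton {Ω A B : Type*} [MeasurableSpace Ω] [MeasurableSpace A]
    [MeasurableSpace B] [Subsingleton A] (f : Ω → A) {h : Ω → B} (hh : Measurable h)
    (μ : Measure Ω) [IsProbabilityMeasure μ] : mutualInfo f h μ = 0 := by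
  have := Measure.isProbabilityMeasure_map (μ := μ) hh.aemeasurable
  obtain ⟨ω₀⟩ := nonempty_of_isProbabilityMeasure μ
  have hf : f = fun _ => f ω₀ := funext fun ω => Subsingleton.elim _ _
  have hm : Measurable fun b : B => (f ω₀, b) := measurable_prodMk_left
  rw [mutualInfo, hf, Measure.map_const, measure_univ, one_smul, Measure.dirac_prod,
    Measure.map_map hm hh]
  exact InformationTheory.klDiv_self _

lemma const_mem_sharedRates {K : Set ((ℝ × ℝ) × ℝ)} (hK : ((0, 0), 0) ∈ K)
    (hg₁ : Measurable g₁) (hg₂ : Measurable g₂) (x₁ : X₁) (x₂ : X₂) :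
    ((g₁ x₁, g₂ x₂), (0, 0)) ∈ sharedRates W g₁ g₂ K := by
  let P₁ : Input Unit X₁ := ⟨Measure.dirac (), Kernel.const _ (Measure.dirac x₁), inferInstance,
    inferInstance⟩
  let P₂ : Input Unit X₂ := ⟨Measure.dirac (), Kernel.const _ (Measure.dirac x₂), inferInstance,
    inferInstance⟩
  have e₁ : P₁.joint.map Prod.snd = Measure.dirac x₁ := by
    simp [P₁, Input.joint]
  have e₂ : P₂.joint.map Prod.snd = Measure.dirac x₂ := by
    simp [P₂, Input.joint]
  have hz : infoZ W P₁ P₂ = 0 := mutualInfo_eq_zero_of_subsingleton _ (by fun_prop) _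
  have hz₁ : infoZ₁ W P₁ P₂ = 0 := by
    rw [infoZ₁, mutualInfo_comm (by fun_prop) (by fun_prop)]
    exact mutualInfo_eq_zero_of_subsingleton _ (by fun_prop) _
  have hz₂ : infoZ₂ W P₁ P₂ = 0 := by
    rw [infoZ₂, mutualInfo_comm (by fun_prop) (by fun_prop)]
    exact mutualInfo_eq_zero_of_subsingleton _ (by fun_prop) _
  refine ⟨0, hK, subset_convexHull ℝ _ ⟨Unit, Unit, inferInstance, inferInstance, inferInstance,
    inferInstance, inferInstance, inferInstance, P₁, P₂, ?_, ?_, le_rfl, le_rfl, ?_, ?_, ?_⟩⟩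
  · rw [Input.CostLE, e₁]
    exact ⟨integrable_dirac' hg₁.stronglyMeasurable (by simp),
      (integral_dirac' _ _ hg₁.stronglyMeasurable).le⟩
  · rw [Input.CostLE, e₂]
    exact ⟨integrable_dirac' hg₂.stronglyMeasurable (by simp),
      (integral_dirac' _ _ hg₂.stronglyMeasurable).le⟩
  · rw [hz₁]
    simp [EReal.coe_ennreal_nonneg]
  · rw [hz₂]
    simp [EReal.coe_ennreal_nonneg]
  · rw [hz]
    simp [add_nonneg, EReal.coe_ennreal_nonneg]

lemma Input.CostLE.exists_le {V X : Type*} [MeasurableSpace V] [MeasurableSpace X] {P : Input V X}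
    {g : X → ℝ} {c : ℝ} (h : P.CostLE g c) : ∃ x, g x ≤ c := by
  have := Measure.isProbabilityMeasure_map (μ := P.joint) measurable_snd.aemeasurable
  obtain ⟨x, hx⟩ := exists_le_integral h.1
  exact ⟨x, hx.trans h.2⟩

lemma exists_le_convexCombination {X : Type*} {g : X → ℝ} {c d a b : ℝ} (hc : ∃ x, g x ≤ c)
    (hd : ∃ x, g x ≤ d) (ha : 0 ≤ a) (hb : 0 ≤ b) (hab : a + b = 1) : ∃ x, g x ≤ a * c + b * d := by
  obtain ⟨x, hx⟩ := hc
  obtain ⟨y, hy⟩ := hd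
  obtain rfl : b = 1 - a := by linarith
  rcases le_total (g x) (g y) with h | h
  · exact ⟨x, by nlinarith⟩
  · exact ⟨y, by nlinarith⟩

lemma exists_cost_le_of_mem_sharedRates {K : Set ((ℝ × ℝ) × ℝ)} {p : (ℝ × ℝ) × (ℝ × ℝ)}
    (hp : p ∈ sharedRates W g₁ g₂ K) : (∃ x, g₁ x ≤ p.1.1) ∧ ∃ x, g₂ x ≤ p.1.2 := by
  obtain ⟨r, -, hr⟩ := hp
  have hsub : convexHull ℝ (letterPoints W g₁ g₂)
      ⊆ {t | (∃ x, g₁ x ≤ t.1.1) ∧ ∃ x, g₂ x ≤ t.1.2} := by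
    refine convexHull_min ?_ ?_
    · rintro t ⟨V₁, V₂, m₁, m₂, s₁, s₂, n₁, n₂, P₁, P₂, h₁, h₂, -⟩
      exact ⟨h₁.exists_le, h₂.exists_le⟩
    · intro x hx y hy a b ha hb hab
      exact ⟨exists_le_convexCombination hx.1 hy.1 ha hb hab,
        exists_le_convexCombination hx.2 hy.2 ha hb hab⟩
  exact hsub hr

lemma exists_lt_or_forall_le {X : Type*} {g : X → ℝ} {c e : ℝ} (h : ∃ x, g x ≤ e) (hec : e ≤ c) :
    ∃ x, g x < c ∨ g x ≤ c ∧ ∀ y, c ≤ g y := by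
  obtain ⟨x, hx⟩ := h
  by_cases h : ∃ y, g y < c
  · exact h.imp fun y hy => Or.inl hy
  · push Not at h
    exact ⟨x, Or.inr ⟨hx.trans hec, h⟩⟩

lemma mix_lt_or_le {X : Type*} {g : X → ℝ} {c e d l : ℝ} (hl : 0 < l) (hl1 : l ≤ 1) (he : e ≤ c)
    (h : d < c ∨ d ≤ c ∧ ∀ y, c ≤ g y) :
    (1 - l) * e + l * d < c ∨ (1 - l) * e + l * d ≤ c ∧ ∀ y, c ≤ g y := by
  rcases h with h | ⟨h, h'⟩
  · exact Or.inl (by nlinarith)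
  · exact Or.inr ⟨by nlinarith, h'⟩

/-- A point with costs at most `c₁`, `c₂` is approximated by one with slack in each cost constraint
that can be strict at all. -/
lemma exists_slack {K : Set ((ℝ × ℝ) × ℝ)} (hK : Convex ℝ K) (hK0 : ((0, 0), 0) ∈ K)
    (hg₁ : Measurable g₁) (hg₂ : Measurable g₂) {c₁ c₂ : ℝ} {p : (ℝ × ℝ) × (ℝ × ℝ)}
    (hp : p ∈ sharedRates W g₁ g₂ K) (hp₁ : p.1.1 ≤ c₁) (hp₂ : p.1.2 ≤ c₂) {ε : ℝ} (hε : 0 < ε) :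
    ∃ t ∈ sharedRates W g₁ g₂ K, (t.1.1 < c₁ ∨ t.1.1 ≤ c₁ ∧ ∀ x, c₁ ≤ g₁ x) ∧
      (t.1.2 < c₂ ∨ t.1.2 ≤ c₂ ∧ ∀ x, c₂ ≤ g₂ x) ∧ |t.2.1 - p.2.1| < ε ∧ |t.2.2 - p.2.2| < ε := by
  obtain ⟨hx₁, hx₂⟩ := exists_cost_le_of_mem_sharedRates W g₁ g₂ hp
  obtain ⟨x₁, hx₁⟩ := exists_lt_or_forall_le hx₁ hp₁
  obtain ⟨x₂, hx₂⟩ := exists_lt_or_forall_le hx₂ hp₂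
  set B := |p.2.1| + |p.2.2| + 1 with hB
  have hB0 : 0 < B := by positivity
  set l := min 1 (ε / (2 * B)) with hl
  have hl0 : 0 < l := by positivity
  have hl1 : l ≤ 1 := min_le_left _ _
  have hlB : l * B < ε := by
    have := min_le_right 1 (ε / (2 * B))
    rw [← hl, le_div_iff₀ (by positivity)] at this
    linarith
  refine ⟨(1 - l) • p + l • ((g₁ x₁, g₂ x₂), (0, 0)), convex_sharedRates W g₁ g₂ hK hp
    (const_mem_sharedRates W g₁ g₂ hK0 hg₁ hg₂ x₁ x₂) (by linarith) hl0.le (by ring),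
    mix_lt_or_le hl0 hl1 hp₁ hx₁, mix_lt_or_le hl0 hl1 hp₂ hx₂, ?_, ?_⟩
  · have e : ((1 - l) • p + l • (((g₁ x₁, g₂ x₂), (0, 0)) : (ℝ × ℝ) × (ℝ × ℝ))).2.1 - p.2.1
        = -(l * p.2.1) := by
      simp; ring
    rw [e, abs_neg, abs_mul, abs_of_pos hl0]
    refine lt_of_le_of_lt (mul_le_mul_of_nonneg_left ?_ hl0.le) hlB
    linarith [abs_nonneg p.2.2]
  · have e : ((1 - l) • p + l • (((g₁ x₁, g₂ x₂), (0, 0)) : (ℝ × ℝ) × (ℝ × ℝ))).2.2 - p.2.2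
        = -(l * p.2.2) := by
      simp; ring
    rw [e, abs_neg, abs_mul, abs_of_pos hl0]
    refine lt_of_le_of_lt (mul_le_mul_of_nonneg_left ?_ hl0.le) hlB
    linarith [abs_nonneg p.2.1]

end LetterPoints

section Achievability

variable {X₁ X₂ Y₁ Y₂ Z : Type*} [MeasurableSpace X₁] [MeasurableSpace X₂] [MeasurableSpace Y₁]
  [MeasurableSpace Y₂] [MeasurableSpace Z] [StandardBorelSpace X₁] [StandardBorelSpace X₂]
  [StandardBorelSpace Y₁] [Nonempty Y₁] [StandardBorelSpace Y₂] [Nonempty Y₂]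
  (W : Kernel (X₁ × X₂) (Y₁ × Y₂ × Z)) [IsMarkovKernel W] {g₁ : X₁ → ℝ} {g₂ : X₂ → ℝ}

lemma Input.nonempty {V X : Type*} [MeasurableSpace V] [MeasurableSpace X] (P : Input V X) :
    Nonempty X := by
  obtain ⟨v⟩ := nonempty_of_isProbabilityMeasure P.pV
  exact nonempty_of_isProbabilityMeasure (P.pre v)

lemma Input.CostLE.quantize {V X A : Type*} [MeasurableSpace V] [MeasurableSpace X]
    [StandardBorelSpace X] [Nonempty X] [MeasurableSpace A] {P : Input V X} {g : X → ℝ} {c : ℝ}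
    (h : P.CostLE g c) {q : V → A} (hq : Measurable q) : (P.quantize q hq).CostLE g c := by
  rwa [Input.CostLE, P.map_snd_joint_quantize hq]

/-- Every attainable point of a single letter is nearly attained by letters with finite prefix
alphabets. -/
lemma exists_finite_letters {p : (ℝ × ℝ) × (ℝ × ℝ) × ℝ} (hp : p ∈ letterPoints W g₁ g₂) {δ : ℝ}
    (hδ : 0 < δ) :
    ∃ z z₁ z₂ y₂ y₁ : ℝ, 0 ≤ z ∧ 0 ≤ z₁ ∧ 0 ≤ z₂ ∧ 0 ≤ p.2.1.1 ∧ 0 ≤ p.2.1.2 ∧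
      p.2.1.1 ≤ y₂ - z₁ ∧ p.2.1.2 ≤ y₁ - z₂ ∧ p.2.2 ≤ y₂ + y₁ - z ∧
      ∀ᶠ m in atTop, ∃ (P₁ : Input (Fin m → Bool) X₁) (P₂ : Input (Fin m → Bool) X₂),
        P₁.CostLE g₁ p.1.1 ∧ P₂.CostLE g₂ p.1.2 ∧
        ∀ᶠ s in 𝓝[>] (0 : ℝ), LetterBounds W P₁ P₂ s (z + δ) (z₁ + δ) (z₂ + δ) (y₂ - δ) (y₁ - δ) := by
  obtain ⟨V₁, V₂, m₁, m₂, s₁, s₂, n₁, n₂, P₁, P₂, h₁, h₂, hr₁, hr₂, hi₁, hi₂, hi⟩ := hp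
  have := P₁.nonempty
  have := P₂.nonempty
  obtain ⟨hz₁, hz₂, hz, y₂, y₁, hy₂, hy₁, hb₁, hb₂, hb⟩ := exists_real_exponents hi₁ hi₂ hi
  refine ⟨_, _, _, y₂, y₁, ENNReal.toReal_nonneg, ENNReal.toReal_nonneg, ENNReal.toReal_nonneg,
    hr₁, hr₂, hb₁, hb₂, hb, ?_⟩
  filter_upwards [eventually_letterBounds_quantize W P₁ P₂ (lt_ofReal_toReal_add hz hδ)
    (lt_ofReal_toReal_add hz₁ hδ) (lt_ofReal_toReal_add hz₂ hδ)
    (ofReal_sub_lt_of_ofReal_le hδ hy₂) (ofReal_sub_lt_of_ofReal_le hδ hy₁)] with m hm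
  exact ⟨_, _, h₁.quantize _, h₂.quantize _, hm⟩

/-- Codes close to a point of the time-shared region with slack in the cost constraints. -/
theorem eventually_exists_code_of_mem_convexHull (hg₁ : Measurable g₁) (hg₂ : Measurable g₂)
    {c₁ c₂ : ℝ} {p : (ℝ × ℝ) × (ℝ × ℝ) × ℝ} (hp : p ∈ convexHull ℝ (letterPoints W g₁ g₂))
    (hc₁ : p.1.1 < c₁ ∨ p.1.1 ≤ c₁ ∧ ∀ x, c₁ ≤ g₁ x)
    (hc₂ : p.1.2 < c₂ ∨ p.1.2 ≤ c₂ ∧ ∀ x, c₂ ≤ g₂ x)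
    (hx₁ : ∃ x, g₁ x ≤ c₁) (hx₂ : ∃ x, g₂ x ≤ c₂) {ε : ℝ} (hε : 0 < ε) :
    ∀ᶠ n : ℕ in atTop,
      ((p.2.1, p.2.2) ∈ jointRelation → ∃ C : Code X₁ X₂ Y₁ Y₂ n, C.PeakCost g₁ g₂ c₁ c₂ ∧
        |Real.log C.M₁ / n - p.2.1.1| < ε ∧ |Real.log C.M₂ / n - p.2.1.2| < ε ∧
        C.errorProb W + C.leakage W ≤ ENNReal.ofReal ε) ∧
      ((p.2.1, p.2.2) ∈ individualRelation → ∃ C : Code X₁ X₂ Y₁ Y₂ n, C.PeakCost g₁ g₂ c₁ c₂ ∧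
        |Real.log C.M₁ / n - p.2.1.1| < ε ∧ |Real.log C.M₂ / n - p.2.1.2| < ε ∧
        C.errorProb W + (C.leakage₁ W + C.leakage₂ W) ≤ ENNReal.ofReal ε) := by
  obtain ⟨ι, _, q, t, hq, hq1, ht, rfl⟩ := mem_convexHull_iff_exists_fintype.1 hp
  set δ := ε / 20 with hδ
  have hδ0 : 0 < δ := by positivity
  choose z z₁ z₂ y₂ y₁ hz hz₁ hz₂ hr₁ hr₂ hb₁ hb₂ hb hm using
    fun i => exists_finite_letters W (ht i) hδ0
  obtain ⟨m, hm⟩ := (eventually_all.2 hm).exists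
  choose P₁ P₂ hP₁ hP₂ hLB using hm
  have e₁ : (∑ i, q i • t i).1.1 = ∑ i, q i * (t i).1.1 := by
    simp [Prod.fst_sum]
  have e₂ : (∑ i, q i • t i).1.2 = ∑ i, q i * (t i).1.2 := by
    simp [Prod.fst_sum, Prod.snd_sum]
  have e₃ : (∑ i, q i • t i).2.1.1 = ∑ i, q i * (t i).2.1.1 := by
    simp [Prod.fst_sum, Prod.snd_sum]
  have e₄ : (∑ i, q i • t i).2.1.2 = ∑ i, q i * (t i).2.1.2 := by
    simp [Prod.fst_sum, Prod.snd_sum]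
  have e₅ : (∑ i, q i • t i).2.2 = ∑ i, q i * (t i).2.2 := by
    simp [Prod.snd_sum]
  set T := ∑ i, q i • t i with hT
  have hnn : ∀ {f : ι → ℝ}, (∀ i, 0 ≤ f i) → 0 ≤ ∑ i, q i * f i :=
    fun hf => Finset.sum_nonneg fun i _ => mul_nonneg (hq i) (hf i)
  have hmono : ∀ {f h : ι → ℝ}, (∀ i, f i ≤ h i) → ∑ i, q i * f i ≤ ∑ i, q i * h i :=
    fun hf => Finset.sum_le_sum fun i _ => mul_le_mul_of_nonneg_left (hf i) (hq i)
  have hadd : ∀ f : ι → ℝ, ∑ i, q i * (f i + δ) = ∑ i, q i * f i + δ := fun f => by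
    simp_rw [mul_add]
    rw [Finset.sum_add_distrib, ← Finset.sum_mul, hq1, one_mul]
  have hsub : ∀ f : ι → ℝ, ∑ i, q i * (f i - δ) = ∑ i, q i * f i - δ := fun f => by
    simp_rw [mul_sub]
    rw [Finset.sum_sub_distrib, ← Finset.sum_mul, hq1, one_mul]
  have hk₁ : T.2.1.1 ≤ ∑ i, q i * y₂ i - ∑ i, q i * z₁ i := by
    rw [e₃, ← Finset.sum_sub_distrib]
    simp_rw [← mul_sub]
    exact hmono hb₁
  have hk₂ : T.2.1.2 ≤ ∑ i, q i * y₁ i - ∑ i, q i * z₂ i := by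
    rw [e₄, ← Finset.sum_sub_distrib]
    simp_rw [← mul_sub]
    exact hmono hb₂
  have hk : T.2.2 ≤ ∑ i, q i * y₂ i + ∑ i, q i * y₁ i - ∑ i, q i * z i := by
    rw [e₅, ← Finset.sum_add_distrib, ← Finset.sum_sub_distrib]
    simp_rw [← mul_add, ← mul_sub]
    exact hmono hb
  obtain ⟨R₁, R₂, ρ₁, ρ₂, hR₁, hR₂, hρ₁, hρ₂, hRr₁, hRr₂, hd₁, hd₂, hs₁, hs₂, hJ, hI₁, hI₂⟩ :=
    exists_rates hδ0 (hnn hz) (hnn hz₁) (hnn hz₂) (e₃ ▸ hnn hr₁) (e₄ ▸ hnn hr₂) hk₁ hk₂ hk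
  have hcost : ∀ {e c : ℝ} {Q : Prop}, (e < c ∨ e ≤ c ∧ Q) → ∀ {E : ℝ}, E ≤ e →
      (E < c ∨ E ≤ c ∧ Q) := fun h E hE =>
    h.imp (fun h => hE.trans_lt h) fun h => ⟨hE.trans h.1, h.2⟩
  have hcodes := eventually_exists_code_of_family W P₁ P₂ hq hq1
    (z := fun i => z i + δ) (z₁ := fun i => z₁ i + δ) (z₂ := fun i => z₂ i + δ)
    (y₂ := fun i => y₂ i - δ) (y₁ := fun i => y₁ i - δ) (eventually_all.2 hLB) hg₁ hg₂
    (fun i => (hP₁ i).1) (fun i => (hP₂ i).1)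
    (hcost hc₁ (e₁ ▸ hmono fun i => (hP₁ i).2)) (hcost hc₂ (e₂ ▸ hmono fun i => (hP₂ i).2))
    hx₁ hx₂ hR₁ hR₂ hρ₁ hρ₂ (by rwa [hsub]) (by rwa [hsub]) (by rwa [hadd]) (by rwa [hadd])
    (ε := ε / 2) (by positivity)
  have hclose : ∀ {x r y : ℝ}, |x - r| < ε / 2 → |r - y| ≤ 10 * δ → |x - y| < ε := by
    intro x r y h1 h2
    have := abs_sub_le x r y
    linarith
  have hhalf : ENNReal.ofReal (ε / 2) ≤ ENNReal.ofReal ε := ENNReal.ofReal_le_ofReal (by linarith)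
  filter_upwards [hcodes] with n hn
  rw [hadd] at hn
  refine ⟨fun h => ?_, fun h => ?_⟩
  · obtain ⟨C, hC1, hC2, hC3, hC4⟩ := hn.1 (hJ h)
    exact ⟨C, hC1, hclose hC2 hRr₁, hclose hC3 hRr₂, hC4.trans hhalf⟩
  · obtain ⟨C, hC1, hC2, hC3, hC4⟩ := hn.2 (hI₁ h.2) (hI₂ h.1)
    exact ⟨C, hC1, hclose hC2 hRr₁, hclose hC3 hRr₂, hC4.trans hhalf⟩

end Achievability

section Diagonal

lemma exists_diagonal {p : ℕ → ℕ → Prop} (h : ∀ k, ∀ᶠ n in atTop, p k n) :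
    ∃ φ : ℕ → ℕ, Tendsto φ atTop atTop ∧ ∀ᶠ n in atTop, p (φ n) n := by
  classical
  choose N hN using fun k => eventually_atTop.1 (h k)
  refine ⟨fun n => Nat.findGreatest (fun k => N k ≤ n) n, tendsto_atTop.2 fun k => ?_, ?_⟩
  · filter_upwards [eventually_ge_atTop k, eventually_ge_atTop (N k)] with n h1 h2
    exact Nat.le_findGreatest h1 h2
  · filter_upwards [eventually_ge_atTop (N 0)] with n hn
    exact hN _ _ (Nat.findGreatest_spec (P := fun k => N k ≤ n) (Nat.zero_le n) hn)

variable {X₁ X₂ Y₁ Y₂ Z : Type*} [MeasurableSpace X₁] [MeasurableSpace X₂] [MeasurableSpace Y₁]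
  [MeasurableSpace Y₂] [MeasurableSpace Z] {g₁ : X₁ → ℝ} {g₂ : X₂ → ℝ} {c₁ c₂ : ℝ}

/-- A code with a single message that always sends cheap letters. -/
lemma exists_peakCost (hg₁ : Measurable g₁) (hg₂ : Measurable g₂) (hx₁ : ∃ x, g₁ x ≤ c₁)
    (hx₂ : ∃ x, g₂ x ≤ c₂) {n : ℕ} (hn : 1 ≤ n) :
    ∃ C : Code X₁ X₂ Y₁ Y₂ n, C.PeakCost g₁ g₂ c₁ c₂ := by
  obtain ⟨x₁, hx₁⟩ := hx₁
  obtain ⟨x₂, hx₂⟩ := hx₂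
  have hn' : (n : ℝ) ≠ 0 := by
    have : n ≠ 0 := by omega
    exact_mod_cast this
  refine ⟨⟨1, 1, one_pos, one_pos, Kernel.const _ (Measure.dirac fun _ => x₁),
    Kernel.const _ (Measure.dirac fun _ => x₂), inferInstance, inferInstance, fun _ => 0,
    fun _ => 0, measurable_const, measurable_const⟩, fun m => ?_, fun m => ?_⟩
  · simp only [Kernel.const_apply]
    rw [ae_dirac_iff (measurableSet_le (by fun_prop) measurable_const)]
    simpa [hn'] using hx₁
  · simp only [Kernel.const_apply]
    rw [ae_dirac_iff (measurableSet_le (by fun_prop) measurable_const)]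
    simpa [hn'] using hx₂

/-- Passing from codes for every accuracy to one sequence of codes. -/
lemma exists_code_sequence (W : Kernel (X₁ × X₂) (Y₁ × Y₂ × Z)) [IsMarkovKernel W]
    (hg₁ : Measurable g₁) (hg₂ : Measurable g₂) (hx₁ : ∃ x, g₁ x ≤ c₁)
    (hx₂ : ∃ x, g₂ x ≤ c₂) {r₁ r₂ : ℝ} (L : ∀ n, Code X₁ X₂ Y₁ Y₂ n → ℝ≥0∞)
    (h : ∀ ε : ℝ, 0 < ε → ∀ᶠ n : ℕ in atTop, ∃ C : Code X₁ X₂ Y₁ Y₂ n, C.PeakCost g₁ g₂ c₁ c₂ ∧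
      |Real.log C.M₁ / n - r₁| < ε ∧ |Real.log C.M₂ / n - r₂| < ε ∧
      C.errorProb W + L n C ≤ ENNReal.ofReal ε) :
    ∃ C : ∀ n : ℕ, Code X₁ X₂ Y₁ Y₂ n,
      (∀ n, 1 ≤ n → (C n).PeakCost g₁ g₂ c₁ c₂) ∧
      Tendsto (fun n : ℕ => Real.log ((C n).M₁ : ℝ) / (n : ℝ)) atTop (𝓝 r₁) ∧
      Tendsto (fun n : ℕ => Real.log ((C n).M₂ : ℝ) / (n : ℝ)) atTop (𝓝 r₂) ∧
      Tendsto (fun n => (C n).errorProb W) atTop (𝓝 0) ∧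
      Tendsto (fun n => L n (C n)) atTop (𝓝 0) := by
  obtain ⟨φ, hφ, hgood⟩ := exists_diagonal fun k => h (1 / ((k : ℝ) + 1)) (by positivity)
  have hex : ∀ n, ∃ C : Code X₁ X₂ Y₁ Y₂ n, (1 ≤ n → C.PeakCost g₁ g₂ c₁ c₂) ∧
      ((∃ C : Code X₁ X₂ Y₁ Y₂ n, C.PeakCost g₁ g₂ c₁ c₂ ∧
        |Real.log C.M₁ / n - r₁| < 1 / ((φ n : ℝ) + 1) ∧
        |Real.log C.M₂ / n - r₂| < 1 / ((φ n : ℝ) + 1) ∧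
        C.errorProb W + L n C ≤ ENNReal.ofReal (1 / ((φ n : ℝ) + 1))) →
        |Real.log C.M₁ / n - r₁| < 1 / ((φ n : ℝ) + 1) ∧
        |Real.log C.M₂ / n - r₂| < 1 / ((φ n : ℝ) + 1) ∧
        C.errorProb W + L n C ≤ ENNReal.ofReal (1 / ((φ n : ℝ) + 1))) := by
    intro n
    by_cases hn : ∃ C : Code X₁ X₂ Y₁ Y₂ n, C.PeakCost g₁ g₂ c₁ c₂ ∧
        |Real.log C.M₁ / n - r₁| < 1 / ((φ n : ℝ) + 1) ∧
        |Real.log C.M₂ / n - r₂| < 1 / ((φ n : ℝ) + 1) ∧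
        C.errorProb W + L n C ≤ ENNReal.ofReal (1 / ((φ n : ℝ) + 1))
    · obtain ⟨C, hC⟩ := hn
      exact ⟨C, fun _ => hC.1, fun _ => hC.2⟩
    · obtain ⟨x₁, -⟩ := id hx₁
      obtain ⟨x₂, -⟩ := id hx₂
      rcases Nat.lt_or_ge n 1 with h0 | h1
      · exact ⟨⟨1, 1, one_pos, one_pos, Kernel.const _ (Measure.dirac fun _ => x₁),
          Kernel.const _ (Measure.dirac fun _ => x₂), inferInstance, inferInstance, fun _ => 0,
          fun _ => 0, measurable_const, measurable_const⟩, fun h1 => by omega, fun h => (hn h).elim⟩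
      · obtain ⟨C, hC⟩ := exists_peakCost (Y₁ := Y₁) (Y₂ := Y₂) hg₁ hg₂ hx₁ hx₂ h1
        exact ⟨C, fun _ => hC, fun h => (hn h).elim⟩
  choose C hC1 hC2 using hex
  have h0 : Tendsto (fun n => 1 / ((φ n : ℝ) + 1)) atTop (𝓝 0) :=
    tendsto_one_div_add_atTop_nhds_zero_nat.comp hφ
  have h0' : Tendsto (fun n => ENNReal.ofReal (1 / ((φ n : ℝ) + 1))) atTop (𝓝 0) := by
    simpa using ENNReal.tendsto_ofReal h0
  have hev : ∀ᶠ n in atTop, |Real.log (C n).M₁ / n - r₁| < 1 / ((φ n : ℝ) + 1) ∧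
        |Real.log (C n).M₂ / n - r₂| < 1 / ((φ n : ℝ) + 1) ∧
        (C n).errorProb W + L n (C n) ≤ ENNReal.ofReal (1 / ((φ n : ℝ) + 1)) :=
    hgood.mono fun n hn => hC2 n hn
  refine ⟨C, hC1, ?_, ?_, ?_, ?_⟩
  · exact tendsto_iff_dist_tendsto_zero.2 (squeeze_zero' (Eventually.of_forall fun n => dist_nonneg)
      (hev.mono fun n hn => hn.1.le) h0)
  · exact tendsto_iff_dist_tendsto_zero.2 (squeeze_zero' (Eventually.of_forall fun n => dist_nonneg)
      (hev.mono fun n hn => hn.2.1.le) h0)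
  · exact tendsto_of_tendsto_of_tendsto_of_le_of_le' tendsto_const_nhds h0'
      (Eventually.of_forall fun n => bot_le) (hev.mono fun n hn => le_self_add.trans hn.2.2)
  · exact tendsto_of_tendsto_of_tendsto_of_le_of_le' tendsto_const_nhds h0'
      (Eventually.of_forall fun n => bot_le) (hev.mono fun n hn => le_add_self.trans hn.2.2)

end Diagonal

section Capacity

variable {X₁ X₂ Y₁ Y₂ Z : Type*} [MeasurableSpace X₁] [MeasurableSpace X₂] [MeasurableSpace Y₁]
  [MeasurableSpace Y₂] [MeasurableSpace Z] [StandardBorelSpace X₁] [StandardBorelSpace X₂]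
  [StandardBorelSpace Y₁] [Nonempty Y₁] [StandardBorelSpace Y₂] [Nonempty Y₂]
  (W : Kernel (X₁ × X₂) (Y₁ × Y₂ × Z)) [IsMarkovKernel W] {g₁ : X₁ → ℝ} {g₂ : X₂ → ℝ} {c₁ c₂ : ℝ}

/-- Rate pairs approximated by time-shared points with admissible costs. -/
def approximable (W : Kernel (X₁ × X₂) (Y₁ × Y₂ × Z)) [IsMarkovKernel W] (g₁ : X₁ → ℝ)
    (g₂ : X₂ → ℝ) (c₁ c₂ : ℝ) (K : Set ((ℝ × ℝ) × ℝ)) : Set (ℝ × ℝ) :=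
  {R | ∀ ε : ℝ, 0 < ε → ∃ t ∈ sharedRates W g₁ g₂ K, t.1.1 ≤ c₁ ∧ t.1.2 ≤ c₂ ∧
    |t.2.1 - R.1| < ε ∧ |t.2.2 - R.2| < ε}

lemma approximable_subset_capacityJoint (hg₁ : Measurable g₁) (hg₂ : Measurable g₂) :
    approximable W g₁ g₂ c₁ c₂ jointRelation ⊆ capacityJoint W g₁ g₂ c₁ c₂ := by
  intro R hR
  obtain ⟨t₀, ht₀, h₁, h₂, -⟩ := hR 1 one_pos
  obtain ⟨hx₁, hx₂⟩ := exists_cost_le_of_mem_sharedRates W g₁ g₂ ht₀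
  replace hx₁ := hx₁.imp fun x hx => hx.trans h₁
  replace hx₂ := hx₂.imp fun x hx => hx.trans h₂
  refine exists_code_sequence W hg₁ hg₂ hx₁ hx₂ (fun n C => C.leakage W) fun ε hε => ?_
  obtain ⟨t, ht, ht₁, ht₂, hR₁, hR₂⟩ := hR (ε / 3) (by positivity)
  obtain ⟨t', ⟨r, hK, hr⟩, hc₁, hc₂, hd₁, hd₂⟩ := exists_slack W g₁ g₂ convex_jointRelation
    (by simp [jointRelation]) hg₁ hg₂ ht ht₁ ht₂ (ε := ε / 3) (by positivity)
  filter_upwards [eventually_exists_code_of_mem_convexHull W hg₁ hg₂ hr hc₁ hc₂ hx₁ hx₂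
    (ε := ε / 3) (by positivity)] with n hn
  obtain ⟨C, hC, hC₁, hC₂, hC'⟩ := hn.1 hK
  refine ⟨C, hC, ?_, ?_, hC'.trans (ENNReal.ofReal_le_ofReal (by linarith))⟩
  · rw [abs_lt] at *
    constructor <;> linarith
  · rw [abs_lt] at *
    constructor <;> linarith

lemma approximable_subset_capacityIndividual (hg₁ : Measurable g₁) (hg₂ : Measurable g₂) :
    approximable W g₁ g₂ c₁ c₂ individualRelation ⊆ capacityIndividual W g₁ g₂ c₁ c₂ := by
  intro R hR
  obtain ⟨t₀, ht₀, h₁, h₂, -⟩ := hR 1 one_pos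
  obtain ⟨hx₁, hx₂⟩ := exists_cost_le_of_mem_sharedRates W g₁ g₂ ht₀
  replace hx₁ := hx₁.imp fun x hx => hx.trans h₁
  replace hx₂ := hx₂.imp fun x hx => hx.trans h₂
  obtain ⟨C, hC, hM₁, hM₂, he, hl⟩ := exists_code_sequence W hg₁ hg₂ hx₁ hx₂
    (r₁ := R.1) (r₂ := R.2) (fun n C => C.leakage₁ W + C.leakage₂ W) fun ε hε => by
    obtain ⟨t, ht, ht₁, ht₂, hR₁, hR₂⟩ := hR (ε / 3) (by positivity)
    obtain ⟨t', ⟨r, hK, hr⟩, hc₁, hc₂, hd₁, hd₂⟩ := exists_slack W g₁ g₂ convex_individualRelation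
      (by simp [individualRelation]) hg₁ hg₂ ht ht₁ ht₂ (ε := ε / 3) (by positivity)
    filter_upwards [eventually_exists_code_of_mem_convexHull W hg₁ hg₂ hr hc₁ hc₂ hx₁ hx₂
      (ε := ε / 3) (by positivity)] with n hn
    obtain ⟨C, hC, hC₁, hC₂, hC'⟩ := hn.2 hK
    refine ⟨C, hC, ?_, ?_, hC'.trans (ENNReal.ofReal_le_ofReal (by linarith))⟩
    · rw [abs_lt] at *
      constructor <;> linarith
    · rw [abs_lt] at *
      constructor <;> linarith
  exact ⟨C, hC, hM₁, hM₂, he,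
    tendsto_of_tendsto_of_tendsto_of_le_of_le tendsto_const_nhds hl (fun n => bot_le)
      fun n => le_self_add,
    tendsto_of_tendsto_of_tendsto_of_le_of_le tendsto_const_nhds hl (fun n => bot_le)
      fun n => le_add_self⟩

lemma average_mem_approximable {K : Set ((ℝ × ℝ) × ℝ)} (hK : Convex ℝ K) {m : ℕ}
    {Q d₁ d₂ : Fin m → ℝ} {r : Fin m → ℝ × ℝ} (hQ : ∀ j, 0 ≤ Q j) (hQ1 : ∑ j, Q j = 1)
    (hd₁ : ∑ j, Q j * d₁ j ≤ c₁) (hd₂ : ∑ j, Q j * d₂ j ≤ c₂)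
    (hr : ∀ j, r j ∈ closure {R | ((d₁ j, d₂ j), R) ∈ sharedRates W g₁ g₂ K}) :
    (∑ j, Q j * (r j).1, ∑ j, Q j * (r j).2) ∈ approximable W g₁ g₂ c₁ c₂ K := by
  intro ε hε
  choose t ht htr using fun j => Metric.mem_closure_iff.1 (hr j) (ε / 2) (by positivity)
  have hclose : ∀ {f h : Fin m → ℝ}, (∀ j, |h j - f j| < ε / 2) →
      |∑ j, Q j * h j - ∑ j, Q j * f j| < ε := by
    intro f h hfh
    rw [← Finset.sum_sub_distrib]
    simp_rw [← mul_sub]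
    refine lt_of_le_of_lt (Finset.abs_sum_le_sum_abs _ _) ?_
    have : ∑ j, |Q j * (h j - f j)| ≤ ∑ j, Q j * (ε / 2) := Finset.sum_le_sum fun j _ => by
      rw [abs_mul, abs_of_nonneg (hQ j)]
      exact mul_le_mul_of_nonneg_left (hfh j).le (hQ j)
    rw [← Finset.sum_mul, hQ1, one_mul] at this
    linarith
  refine ⟨∑ j, Q j • ((d₁ j, d₂ j), t j), (convex_sharedRates W g₁ g₂ hK).sum_mem
    (fun j _ => hQ j) hQ1 fun j _ => ht j, ?_, ?_, ?_, ?_⟩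
  · simpa [Prod.fst_sum, Prod.snd_sum] using hd₁
  · simpa [Prod.fst_sum, Prod.snd_sum] using hd₂
  · have := hclose (f := fun j => (r j).1) (h := fun j => (t j).1) fun j => by
      have h := (le_max_left _ _).trans_lt ((dist_comm _ _).trans_lt (htr j))
      exact h
    simpa [Prod.fst_sum, Prod.snd_sum] using this
  · have := hclose (f := fun j => (r j).2) (h := fun j => (t j).2) fun j => by
      have h := (le_max_right _ _).trans_lt ((dist_comm _ _).trans_lt (htr j))
      exact h
    simpa [Prod.fst_sum, Prod.snd_sum] using this

lemma closure_subset_approximable {K : Set ((ℝ × ℝ) × ℝ)} (hK : Convex ℝ K) :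
    closure {R | ((c₁, c₂), R) ∈ sharedRates W g₁ g₂ K} ⊆ approximable W g₁ g₂ c₁ c₂ K := by
  intro R hR
  have := average_mem_approximable W hK (m := 1) (Q := fun _ => 1) (d₁ := fun _ => c₁)
    (d₂ := fun _ => c₂) (c₁ := c₁) (c₂ := c₂) (r := fun _ => R) (by simp) (by simp) (by simp)
    (by simp) fun _ => hR
  simpa using this

end Capacity

end TWWC

theorem theorem2
    {X₁ X₂ Y₁ Y₂ Z : Type*}
    [MeasurableSpace X₁] [StandardBorelSpace X₁] [MeasurableSpace X₂] [StandardBorelSpace X₂]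
    [MeasurableSpace Y₁] [StandardBorelSpace Y₁] [Nonempty Y₁]
    [MeasurableSpace Y₂] [StandardBorelSpace Y₂] [Nonempty Y₂]
    [MeasurableSpace Z] [StandardBorelSpace Z]
    (W : Kernel (X₁ × X₂) (Y₁ × Y₂ × Z)) [IsMarkovKernel W]
    (g₁ : X₁ → ℝ) (hg₁ : Measurable g₁) (g₂ : X₂ → ℝ) (hg₂ : Measurable g₂) (c₁ c₂ : ℝ) :
    TWWC.regionJoint W g₁ g₂ c₁ c₂ ⊆ TWWC.capacityJoint W g₁ g₂ c₁ c₂ ∧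
    TWWC.regionIndividual W g₁ g₂ c₁ c₂ ⊆ TWWC.capacityIndividual W g₁ g₂ c₁ c₂ ∧
    TWWC.timeShared (TWWC.regionJoint W g₁ g₂) g₁ g₂ c₁ c₂ ⊆
      TWWC.capacityJoint W g₁ g₂ c₁ c₂ ∧
    TWWC.timeShared (TWWC.regionIndividual W g₁ g₂) g₁ g₂ c₁ c₂ ⊆
      TWWC.capacityIndividual W g₁ g₂ c₁ c₂ := by
  refine ⟨fun R hR => ?_, fun R hR => ?_, ?_, ?_⟩
  · exact TWWC.approximable_subset_capacityJoint W hg₁ hg₂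
      (TWWC.closure_subset_approximable W TWWC.convex_jointRelation
        (TWWC.regionJoint_subset_closure W g₁ g₂ c₁ c₂ hR))
  · exact TWWC.approximable_subset_capacityIndividual W hg₁ hg₂
      (TWWC.closure_subset_approximable W TWWC.convex_individualRelation
        (TWWC.regionIndividual_subset_closure W g₁ g₂ c₁ c₂ hR))
  · rintro R ⟨m, Q, d₁, d₂, r, hQ, hQ1, -, -, hd₁, hd₂, hr, rfl⟩
    exact TWWC.approximable_subset_capacityJoint W hg₁ hg₂
      (TWWC.average_mem_approximable W TWWC.convex_jointRelation hQ hQ1 hd₁ hd₂ fun j =>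
        TWWC.regionJoint_subset_closure W g₁ g₂ _ _ (hr j))
  · rintro R ⟨m, Q, d₁, d₂, r, hQ, hQ1, -, -, hd₁, hd₂, hr, rfl⟩
    exact TWWC.approximable_subset_capacityIndividual W hg₁ hg₂
      (TWWC.average_mem_approximable W TWWC.convex_individualRelation hQ hQ1 hd₁ hd₂ fun j =>
        TWWC.regionIndividual_subset_closure W g₁ g₂ _ _ (hr j))
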